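/- Let $N\ge 0$ and $m\ge 1$ be integers, let $\mathbb{T}^{n}=(\mathbb{R}/2\pi\mathbb{Z})^{n}$ and $S^1=\mathbb{T}^1$, and let $\mathscr{C}^\infty(\mathbb{T}^n)$ carry its usual Fréchet topology (uniform convergence of all derivatives). Let $Q:\mathscr{C}^\infty(\mathbb{T}^{N+1})\to\mathscr{C}^\infty(\mathbb{T}^{N+1})$ be a continuous linear operator, with discrete symbol $Q(y,\eta)=e^{-iy\cdot\eta}\,(Q e^{iy\cdot\eta})(y)$ for $y\in\mathbb{T}^{N+1}$, $\eta\in\mathbb{Z}^{N+1}$. Assume that * $Q$ is of order $m$: for every multi-index $\alpha$ there is $C_\alpha>0$ with $|\partial_y^\alpha Q(y,\eta)|\le C_\alpha(1+|\eta|)^m$ for all $y,\eta$; * $Q$ is of tube type: writing $y=(t,x)\in S^1\times\mathbb{T}^N$ and $\eta=(\tau,\xi)\in\mathbb{Z}\times\mathbb{Z}^N$, the symbol depends only on $(t,\xi)$; write $Q(y,\eta)=c(t,\xi)$ and $Q=c(t,D_x)$; * $c(t,D_x)$ is positively homogeneous of degree $m$: $c(t,n\xi)=n^m c(t,\xi)$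 for all $t\in S^1$, $\xi\in\mathbb{Z}^N$ and all integers $n\ge 1$. Put $P=D_t+c(t,D_x)$ with $D_t=-i\partial_t$, $b(t,\xi)=\operatorname{Im}c(t,\xi)$, $c_0(\xi)=\frac{1}{2\pi}\int_0^{2\pi}c(t,\xi)\,dt$, $\mathcal Z=\{\xi\in\mathbb{Z}^N: c_0(\xi)\in\mathbb{Z}\}$ and $B(t,\xi)=\int_0^t b(s,\xi)\,ds$; for $\xi\in\mathcal Z$ the function $B(\cdot,\xi)$ is $2\pi$-periodic, hence a function on $S^1$. Call $P$ globally solvable if its range is closed in $\mathscr{C}^\infty(\mathbb{T}^{N+1})$. Then $P$ is globally solvable if and only if the following three conditions hold: 1. there are $C>0$ and an integer $M\ge 0$ such that $|\tau+c_0(\xi)|\ge C(1+|\xi|)^{-M}$ for all $\tau\in\mathbb{Z}$ and all $\xi\in\mathbb{Z}^N\setminus\mathcal Z$; 2. for every $\xi\in\mathbb{Z}^N\setminus\mathcal Z$ with $\xi\neq0$, the function $b(\cdot,\xi)$ does not change sign, that is, $b(\cdot,\xi)\ge 0$ on $S^1$ or $b(\cdot,\xi)\le 0$ on $S^1$; 3.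 for every $\xi\in\mathcal Z$ with $\xi\ne0$ and every $\lambda\in\mathbb{R}$, the set $\{t\in S^1: B(t,\xi)<\lambda\}$ is connected (the empty set being regarded as connected). -/

import Mathlib

open Real Set MeasureTheory
open scoped ContDiff

noncomputable section

/-! ### Smooth functions on the torus `𝕋ⁿ = (ℝ / 2πℤ)ⁿ` -/

/-- The vector `2πk` of the period lattice `(2πℤ)ⁿ`. -/
def torusPeriod {n : ℕ} (k : Fin n → ℤ) : Fin n → ℝ := fun j => 2 * π * (k j : ℝ)

/-- The complex vector space of smooth functions `ℝⁿ → ℂ` that are `2π`-periodic in each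
variable. -/
def smoothPeriodic (n : ℕ) : Submodule ℂ ((Fin n → ℝ) → ℂ) where
  carrier := {f | ContDiff ℝ ∞ f ∧ ∀ (k : Fin n → ℤ) (y : Fin n → ℝ), f (y + torusPeriod k) = f y}
  add_mem' := by
    rintro f g ⟨hf, hf'⟩ ⟨hg, hg'⟩
    exact ⟨hf.add hg, fun k y => by simp [hf' k y, hg' k y]⟩
  zero_mem' := ⟨contDiff_const, fun _ _ => rfl⟩
  smul_mem' := by
    rintro a f ⟨hf, hf'⟩
    exact ⟨hf.const_smul a, fun k y => by simp [hf' k y]⟩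

/-- The space `C^∞(𝕋ⁿ)`. It is a type of its own, so that it carries the `C^∞` topology defined
below and not the topology of pointwise convergence. -/
def SmoothTorus (n : ℕ) : Type := smoothPeriodic n

namespace SmoothTorus

variable {n : ℕ}

instance : AddCommGroup (SmoothTorus n) := inferInstanceAs (AddCommGroup (smoothPeriodic n))

instance : Module ℂ (SmoothTorus n) := inferInstanceAs (Module ℂ (smoothPeriodic n))

instance : FunLike (SmoothTorus n) (Fin n → ℝ) ℂ where
  coe f := f.1
  coe_injective _ _ h := Subtype.ext h

/-- The element of `C^∞(𝕋ⁿ)` given by a smooth function that is periodic in each variable. -/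
def mk (f : (Fin n → ℝ) → ℂ) (hf : ContDiff ℝ ∞ f)
    (hf' : ∀ (k : Fin n → ℤ) (y : Fin n → ℝ), f (y + torusPeriod k) = f y) : SmoothTorus n :=
  ⟨f, hf, hf'⟩

theorem mk_apply (f : (Fin n → ℝ) → ℂ) (hf : ContDiff ℝ ∞ f)
    (hf' : ∀ (k : Fin n → ℤ) (y : Fin n → ℝ), f (y + torusPeriod k) = f y) (y : Fin n → ℝ) :
    mk f hf hf' y = f y := rfl

theorem contDiff (f : SmoothTorus n) : ContDiff ℝ ∞ (f : (Fin n → ℝ) → ℂ) := f.2.1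

theorem periodic (f : SmoothTorus n) (k : Fin n → ℤ) (y : Fin n → ℝ) :
    f (y + torusPeriod k) = f y := f.2.2 k y

theorem coe_add (f g : SmoothTorus n) :
    ((f + g : SmoothTorus n) : (Fin n → ℝ) → ℂ) = (f : (Fin n → ℝ) → ℂ) + g := rfl

theorem coe_smul (a : ℂ) (f : SmoothTorus n) :
    ((a • f : SmoothTorus n) : (Fin n → ℝ) → ℂ) = a • (f : (Fin n → ℝ) → ℂ) := rfl

theorem coe_zero : ((0 : SmoothTorus n) : (Fin n → ℝ) → ℂ) = 0 := rfl

/-- Every point of `ℝⁿ` is a lattice translate of a point of the box `[0, 2π]ⁿ`. -/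
theorem exists_box (y : Fin n → ℝ) :
    ∃ k : Fin n → ℤ, y + torusPeriod k ∈ Icc (0 : Fin n → ℝ) (fun _ => 2 * π) := by
  have h2 : (0 : ℝ) < 2 * π := by positivity
  refine ⟨fun j => -⌊y j / (2 * π)⌋, fun j => ?_, fun j => ?_⟩
  · have := Int.floor_le (y j / (2 * π))
    rw [le_div_iff₀ h2] at this
    simp only [torusPeriod, Pi.add_apply, Pi.zero_apply]
    push_cast
    linarith
  · have := (Int.lt_floor_add_one (y j / (2 * π))).le
    rw [div_le_iff₀ h2] at this
    simp only [torusPeriod, Pi.add_apply]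
    push_cast
    linarith

theorem bddAbove_iteratedFDeriv (f : SmoothTorus n) (k : ℕ) :
    BddAbove (range fun y => ‖iteratedFDeriv ℝ k (f : (Fin n → ℝ) → ℂ) y‖) := by
  have hc : Continuous fun y => ‖iteratedFDeriv ℝ k (f : (Fin n → ℝ) → ℂ) y‖ :=
    (f.contDiff.continuous_iteratedFDeriv (by exact_mod_cast le_top)).norm
  obtain ⟨C, hC⟩ := (isCompact_Icc (a := (0 : Fin n → ℝ)) (b := fun _ => 2 * π)).bddAbove_image
    hc.continuousOn
  refine ⟨C, ?_⟩
  rintro _ ⟨y, rfl⟩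
  obtain ⟨l, hl⟩ := exists_box y
  have hf : (fun z => f (z + torusPeriod l)) = (f : (Fin n → ℝ) → ℂ) := funext (f.periodic l)
  have := iteratedFDeriv_comp_add_right (𝕜 := ℝ) (f := (f : (Fin n → ℝ) → ℂ)) k (torusPeriod l) y
  rw [hf] at this
  simp only [this]
  exact hC ⟨_, hl, rfl⟩

/-- The seminorm `f ↦ sup_y ‖f⁽ᵏ⁾(y)‖`, where `f⁽ᵏ⁾` is the full `k`-th derivative. -/
def derivSeminorm (n k : ℕ) : Seminorm ℂ (SmoothTorus n) :=
  Seminorm.of (fun f => ⨆ y, ‖iteratedFDeriv ℝ k (f : (Fin n → ℝ) → ℂ) y‖)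
    (fun f g => by
      refine ciSup_le fun y => ?_
      have hk : ((k : ℕ∞) : WithTop ℕ∞) ≤ ∞ := by exact_mod_cast le_top
      rw [coe_add, iteratedFDeriv_add_apply (f.contDiff.of_le hk).contDiffAt
        (g.contDiff.of_le hk).contDiffAt]
      exact (norm_add_le _ _).trans (add_le_add (le_ciSup (bddAbove_iteratedFDeriv f k) y)
        (le_ciSup (bddAbove_iteratedFDeriv g k) y)))
    (fun a f => by
      have hk : ((k : ℕ∞) : WithTop ℕ∞) ≤ ∞ := by exact_mod_cast le_top
      rw [Real.mul_iSup_of_nonneg (norm_nonneg a)]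
      congr 1
      funext y
      rw [coe_smul, iteratedFDeriv_const_smul_apply (f.contDiff.of_le hk).contDiffAt, norm_smul])

/-- The Fréchet topology of `C^∞(𝕋ⁿ)`: uniform convergence of all derivatives. -/
instance : TopologicalSpace (SmoothTorus n) :=
  (SeminormFamily.moduleFilterBasis (𝕜 := ℂ) (derivSeminorm n)).topology

theorem withSeminorms : WithSeminorms (derivSeminorm n) := ⟨rfl⟩

/-- The operator `D_j = -i ∂_j` on `C^∞(𝕋ⁿ)`. -/
def D (j : Fin n) : SmoothTorus n →ₗ[ℂ] SmoothTorus n where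
  toFun f := mk (fun y => -Complex.I * fderiv ℝ (f : (Fin n → ℝ) → ℂ) y (Pi.single j 1))
    (contDiff_const.mul ((f.contDiff.fderiv_right (m := ∞) (by simp)).clm_apply contDiff_const))
    (fun k y => by
      have hf : (fun z => f (z + torusPeriod k)) = (f : (Fin n → ℝ) → ℂ) := funext (f.periodic k)
      have h := fderiv_comp_add_right (𝕜 := ℝ) (f := (f : (Fin n → ℝ) → ℂ)) (x := y)
        (torusPeriod k)
      rw [hf] at h
      rw [h])
  map_add' f g := DFunLike.ext _ _ fun y => by
    have hf := (f.contDiff.differentiable (by simp)) y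
    have hg := (g.contDiff.differentiable (by simp)) y
    rw [mk_apply, coe_add f g, fderiv_add hf hg, coe_add, Pi.add_apply, mk_apply, mk_apply,
      add_apply, mul_add]
  map_smul' a f := DFunLike.ext _ _ fun y => by
    have hf := (f.contDiff.differentiable (by simp)) y
    rw [RingHom.id_apply, mk_apply, coe_smul a f, fderiv_const_smul hf, coe_smul, Pi.smul_apply,
      mk_apply, smul_apply, smul_eq_mul, smul_eq_mul]
    ring

/-- The exponential `y ↦ e^{i y·η}`, for `η ∈ ℤⁿ`. -/
def expo (η : Fin n → ℤ) : SmoothTorus n :=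
  mk (fun y => Complex.exp (Complex.I * ((∑ j, y j * (η j : ℝ) : ℝ) : ℂ)))
    (by
      have h : ContDiff ℝ ∞ fun y : Fin n → ℝ => ∑ j, y j * (η j : ℝ) :=
        ContDiff.sum fun j _ => (contDiff_apply ℝ ℝ j).mul contDiff_const
      exact (contDiff_const.mul (Complex.ofRealCLM.contDiff.comp h)).cexp)
    (fun k y => by
      rw [Complex.exp_eq_exp_iff_exists_int]
      refine ⟨∑ j, k j * η j, ?_⟩
      simp only [torusPeriod, Pi.add_apply, add_mul, Finset.sum_add_distrib]
      push_cast
      rw [mul_add, Finset.sum_mul, Finset.mul_sum, Finset.mul_sum]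
      congr 1
      exact Finset.sum_congr rfl fun j _ => by ring)

end SmoothTorus

/-! ### Pseudodifferential operators on the torus -/

/-- The Euclidean norm `|η|` of `η ∈ ℤⁿ`. -/
def latticeNorm {n : ℕ} (η : Fin n → ℤ) : ℝ := √(∑ j, (η j : ℝ) ^ 2)

/-- The discrete symbol `Q(y, η) = e^{-i y·η} (Q e^{i y·η})(y)`. -/
def discreteSymbol {n : ℕ} (Q : SmoothTorus n →L[ℂ] SmoothTorus n) (y : Fin n → ℝ)
    (η : Fin n → ℤ) : ℂ :=
  Complex.exp (-Complex.I * ((∑ j, y j * (η j : ℝ) : ℝ) : ℂ)) * Q (SmoothTorus.expo η) y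

/-- `Q` is a pseudodifferential operator of order `m` on `𝕋ⁿ`: each derivative in `y` of its
discrete symbol is bounded by a constant times `(1 + |η|)^m`. -/
def HasOrder {n : ℕ} (Q : SmoothTorus n →L[ℂ] SmoothTorus n) (m : ℝ) : Prop :=
  ∀ k : ℕ, ∃ C : ℝ, 0 < C ∧ ∀ (y : Fin n → ℝ) (η : Fin n → ℤ),
    ‖iteratedFDeriv ℝ k (fun z => discreteSymbol Q z η) y‖ ≤ C * (1 + latticeNorm η) ^ m

/-! ### Tube type operators on `𝕋^{N+1} = S¹_t × 𝕋^N_x`; the variable `t` is the coordinate `0` -/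

section Tube

variable {N : ℕ}

/-- `c` is of tube type, `c = c(t, D_x)`: for `y = (t, x)` and `η = (τ, ξ)`, its discrete symbol
depends only on `t` and `ξ`. -/
def IsTubeType (c : SmoothTorus (N + 1) →L[ℂ] SmoothTorus (N + 1)) : Prop :=
  ∀ (t : ℝ) (x x' : Fin N → ℝ) (τ τ' : ℤ) (ξ : Fin N → ℤ),
    discreteSymbol c (Fin.cons t x : Fin (N + 1) → ℝ) (Fin.cons τ ξ : Fin (N + 1) → ℤ) =
      discreteSymbol c (Fin.cons t x' : Fin (N + 1) → ℝ) (Fin.cons τ' ξ : Fin (N + 1) → ℤ)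

/-- The symbol `c(t, ξ)` of a tube type operator. -/
def tubeSymbol (c : SmoothTorus (N + 1) →L[ℂ] SmoothTorus (N + 1)) (t : ℝ) (ξ : Fin N → ℤ) : ℂ :=
  discreteSymbol c (Fin.cons t 0 : Fin (N + 1) → ℝ) (Fin.cons 0 ξ : Fin (N + 1) → ℤ)

/-- Positive homogeneity of degree `m`: `c(t, nξ) = n^m c(t, ξ)` for all positive integers `n`. -/
def IsPosHomogeneous (c : SmoothTorus (N + 1) →L[ℂ] SmoothTorus (N + 1)) (m : ℕ) : Prop :=
  ∀ (t : ℝ) (ξ : Fin N → ℤ) (n : ℕ), 1 ≤ n →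
    tubeSymbol c t ((n : ℤ) • ξ) = (n : ℂ) ^ m * tubeSymbol c t ξ

/-- The operator `P = D_t + c(t, D_x)`. -/
def tubeOperator (c : SmoothTorus (N + 1) →L[ℂ] SmoothTorus (N + 1)) :
    SmoothTorus (N + 1) →ₗ[ℂ] SmoothTorus (N + 1) :=
  SmoothTorus.D 0 + (c : SmoothTorus (N + 1) →ₗ[ℂ] SmoothTorus (N + 1))

/-- `P` is globally solvable: its range is closed in `C^∞(𝕋ⁿ)`. -/
def GloballySolvable {n : ℕ} (P : SmoothTorus n →ₗ[ℂ] SmoothTorus n) : Prop :=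
  IsClosed (range P)

/-- The average `c_0(ξ) = (2π)⁻¹ ∫_0^{2π} c(t, ξ) dt`. -/
def symbolAverage (c : SmoothTorus (N + 1) →L[ℂ] SmoothTorus (N + 1)) (ξ : Fin N → ℤ) : ℂ :=
  (2 * (π : ℂ))⁻¹ * ∫ t in (0 : ℝ)..(2 * π), tubeSymbol c t ξ

/-- The set `𝒵` of all `ξ ∈ ℤ^N` with `c_0(ξ) ∈ ℤ`. -/
def resonantSet (c : SmoothTorus (N + 1) →L[ℂ] SmoothTorus (N + 1)) : Set (Fin N → ℤ) :=
  {ξ | ∃ k : ℤ, symbolAverage c ξ = (k : ℂ)}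

/-- The diophantine condition: `|τ + c_0(ξ)| ≥ C (1 + |ξ|)^{-M}` for `τ ∈ ℤ`, `ξ ∉ 𝒵`. -/
def DiophantineCondition (c : SmoothTorus (N + 1) →L[ℂ] SmoothTorus (N + 1)) : Prop :=
  ∃ C : ℝ, 0 < C ∧ ∃ M : ℕ, ∀ (τ : ℤ) (ξ : Fin N → ℤ), ξ ∉ resonantSet c →
    C * (1 + latticeNorm ξ) ^ (-(M : ℤ)) ≤ ‖(τ : ℂ) + symbolAverage c ξ‖

/-- The symbol `b(t, ξ)` of the imaginary part of `c(t, D_x)`. -/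
def imSymbol (c : SmoothTorus (N + 1) →L[ℂ] SmoothTorus (N + 1)) (t : ℝ) (ξ : Fin N → ℤ) : ℝ :=
  (tubeSymbol c t ξ).im

/-- The primitive `B(t, ξ) = ∫_0^t b(s, ξ) ds`. -/
def imPrimitive (c : SmoothTorus (N + 1) →L[ℂ] SmoothTorus (N + 1)) (t : ℝ) (ξ : Fin N → ℤ) : ℝ :=
  ∫ s in (0 : ℝ)..t, imSymbol c s ξ

/-- The sublevel set of all points of `S¹ = ℝ / 2πℤ` at which `B(·, ξ) < lam`. For `ξ ∈ 𝒵` the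
function `B(·, ξ)` is `2π`-periodic, so that the representative `t` does not matter. -/
def sublevelSet (c : SmoothTorus (N + 1) →L[ℂ] SmoothTorus (N + 1)) (ξ : Fin N → ℤ) (lam : ℝ) :
    Set (AddCircle (2 * π)) :=
  {θ | ∃ t : ℝ, (t : AddCircle (2 * π)) = θ ∧ imPrimitive c t ξ < lam}

end Tube

end

/-! Because `c` is of tube type, `P` preserves every space of modes `g(t) e^{i x·ξ}` and acts there
as the ordinary differential operator `-i ∂_t + c(t, ξ)` on the circle. With `C(t) = ∫_0^t c(s, ξ)
ds` the factor `e^{iC}` integrates the equation, and its modulus is `e^{-B}`. If `ξ ∉ 𝒵`, then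
`e^{iC(2π)} ≠ 1` and the periodic solution exists and is unique. If `ξ ∈ 𝒵`, the right side must be
annihilated by the functional `g ↦ ∫ e^{iC} g`, and solutions are unique up to multiples of
`e^{-iC}`. The question is therefore whether the modes can be solved with at most polynomial loss in
`|ξ|`.

Sufficiency (`globallySolvable_of_conditions`): the range is shown to be the common kernel of the
continuous functionals `compatibility c ξ`, `ξ ∈ 𝒵`, hence closed. Off `𝒵` the sign of `b` makes `B`
monotone, so integrating over one period in the right direction loses only the divisor `|1 - e^{±2πi
c_0}|`, which the diophantine condition bounds below. On `𝒵` the solution is made to vanish at a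
maximum point of `B`; connected sublevel sets let every `t` be reached from there along an arc on
which `B ≥ B(t)`, and no divisor appears. The equation itself then controls all derivatives
(`IsTubeType.rapidlyDecreasing_derivSeminorm`).

Necessity: by `GloballySolvable.exists_rapidlyDecreasing`, closed range turns a rapidly decreasing
family `P U_i` into one solved by modes `V_i` that are rapidly decreasing in sup norm. Each violated
condition yields a family for which every choice of `V_i` stays bounded below. Small divisors give
eigenmodes with tiny eigenvalues. A peak of `B` gives, by homogeneity, the waves of
`IsTubeType.exists_concentrated` at the multiples `nξ`: a cutoff times `e^{-n^m(iC + K)}`, large on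
the peak, while `P` sees only the derivative of the cutoff, placed where `B < K`. When `b` changes
sign off `𝒵`, uniqueness gives `V_i = U_i`. When a sublevel set is disconnected, the possible
correction by `e^{-iC}` is controlled at a second point outside the sublevel set, where the wave
vanishes. -/

/-! ### The lattice `ℤⁿ` -/

section Lattice

variable {n : ℕ}

theorem latticeNorm_nonneg (η : Fin n → ℤ) : 0 ≤ latticeNorm η := Real.sqrt_nonneg _

theorem abs_le_latticeNorm (η : Fin n → ℤ) (j : Fin n) : |(η j : ℝ)| ≤ latticeNorm η := by
  rw [latticeNorm, ← Real.sqrt_sq_eq_abs]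
  exact Real.sqrt_le_sqrt (Finset.single_le_sum (f := fun i => (η i : ℝ) ^ 2)
    (fun i _ => sq_nonneg _) (Finset.mem_univ j))

theorem latticeNorm_le_sum (η : Fin n → ℤ) : latticeNorm η ≤ ∑ j, |(η j : ℝ)| := by
  rw [latticeNorm, Real.sqrt_le_left (Finset.sum_nonneg fun _ _ => abs_nonneg _)]
  simp_rw [← sq_abs (Int.cast _ : ℝ)]
  exact Finset.sum_sq_le_sq_sum_of_nonneg fun i _ => abs_nonneg _

theorem one_le_one_add_latticeNorm (η : Fin n → ℤ) : 1 ≤ 1 + latticeNorm η := by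
  linarith [latticeNorm_nonneg η]

theorem latticeNorm_cons (τ : ℤ) (ξ : Fin n → ℤ) :
    latticeNorm (Fin.cons τ ξ : Fin (n + 1) → ℤ) = √((τ : ℝ) ^ 2 + latticeNorm ξ ^ 2) := by
  rw [latticeNorm, latticeNorm, Real.sq_sqrt (Finset.sum_nonneg fun _ _ => sq_nonneg _),
    Fin.sum_univ_succ]
  simp

theorem latticeNorm_cons_zero (ξ : Fin n → ℤ) :
    latticeNorm (Fin.cons 0 ξ : Fin (n + 1) → ℤ) = latticeNorm ξ := by
  rw [latticeNorm_cons]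
  simp [Real.sqrt_sq (latticeNorm_nonneg ξ)]

theorem latticeNorm_le_latticeNorm_cons (τ : ℤ) (ξ : Fin n → ℤ) :
    latticeNorm ξ ≤ latticeNorm (Fin.cons τ ξ : Fin (n + 1) → ℤ) := by
  rw [latticeNorm_cons]
  exact Real.le_sqrt_of_sq_le (by nlinarith [sq_nonneg (τ : ℝ)])

theorem latticeNorm_nsmul (k : ℕ) (ξ : Fin n → ℤ) :
    latticeNorm ((k : ℤ) • ξ) = k * latticeNorm ξ := by
  rw [latticeNorm, latticeNorm, ← Real.sqrt_sq (Nat.cast_nonneg (α := ℝ) k),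
    ← Real.sqrt_mul (sq_nonneg _), Finset.mul_sum]
  congr 1
  refine Finset.sum_congr rfl fun j _ => ?_
  simp [mul_pow]

theorem finite_latticeNorm_le (R : ℝ) : {ξ : Fin n → ℤ | latticeNorm ξ ≤ R}.Finite := by
  refine (Set.Finite.pi (t := fun _ : Fin n => Set.Icc (-⌈R⌉) ⌈R⌉)
    fun _ => Set.finite_Icc _ _).subset fun ξ hξ j _ => ?_
  have h := (abs_le_latticeNorm ξ j).trans (le_trans hξ (Int.le_ceil R))
  rw [abs_le] at h
  exact ⟨by exact_mod_cast h.1, by exact_mod_cast h.2⟩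

theorem summable_int_inv_one_add_sq : Summable fun τ : ℤ => (1 + (τ : ℝ) ^ 2)⁻¹ := by
  have h : Summable fun τ : ℤ => 1 / (τ : ℝ) ^ 2 := Real.summable_one_div_int_pow.2 one_lt_two
  refine Summable.of_norm_bounded_eventually h ?_
  filter_upwards [(Set.finite_singleton (0 : ℤ)).compl_mem_cofinite] with τ hτ
  have h0 : (0 : ℝ) < (τ : ℝ) ^ 2 := by
    have : (τ : ℝ) ≠ 0 := by exact_mod_cast hτ
    positivity
  rw [Real.norm_of_nonneg (by positivity), one_div]
  exact inv_anti₀ h0 (by linarith)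

theorem summable_prod_inv_one_add_sq (n : ℕ) :
    Summable fun η : Fin n → ℤ => ∏ j, (1 + (η j : ℝ) ^ 2)⁻¹ := by
  induction n with
  | zero => exact Summable.of_finite
  | succ n ih =>
    rw [← (Fin.consEquiv fun _ : Fin (n + 1) => ℤ).summable_iff]
    have := summable_int_inv_one_add_sq.mul_of_nonneg ih (fun _ => by positivity)
      (fun _ => Finset.prod_nonneg fun _ _ => by positivity)
    refine this.congr fun p => ?_
    simp [Fin.consEquiv, Fin.prod_univ_succ, mul_comm]

/-- Each of the `n` factors `1 + η_j²` is at most `(1 + |η|)²`, whence the exponent `2n`. The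
product on the right is summable one variable at a time. -/
theorem inv_one_add_latticeNorm_pow_le (η : Fin n → ℤ) :
    ((1 + latticeNorm η) ^ (2 * n))⁻¹ ≤ ∏ j, (1 + (η j : ℝ) ^ 2)⁻¹ := by
  have h : ∏ j, (1 + (η j : ℝ) ^ 2) ≤ ∏ _j : Fin n, (1 + latticeNorm η) ^ 2 := by
    refine Finset.prod_le_prod (fun _ _ => by positivity) fun j _ => ?_
    have h1 := abs_le_latticeNorm η j
    have h2 := sq_abs (η j : ℝ)
    nlinarith [abs_nonneg (η j : ℝ), latticeNorm_nonneg η]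
  rw [Finset.prod_inv_distrib]
  refine inv_anti₀ (Finset.prod_pos fun _ _ => by positivity) ?_
  simpa [pow_mul] using h

theorem summable_inv_one_add_latticeNorm_pow (n : ℕ) :
    Summable fun η : Fin n → ℤ => ((1 + latticeNorm η) ^ (2 * n))⁻¹ :=
  Summable.of_nonneg_of_le
    (fun η => inv_nonneg.2 (pow_nonneg (zero_le_one.trans (one_le_one_add_latticeNorm η)) _))
    inv_one_add_latticeNorm_pow_le (summable_prod_inv_one_add_sq n)

end Lattice

/-! ### The Fréchet space `C^∞(𝕋ⁿ)` -/

namespace SmoothTorus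

variable {n : ℕ}

theorem norm_iteratedFDeriv_le (k : ℕ) (f : SmoothTorus n) (y : Fin n → ℝ) :
    ‖iteratedFDeriv ℝ k (f : (Fin n → ℝ) → ℂ) y‖ ≤ derivSeminorm n k f :=
  le_ciSup (bddAbove_iteratedFDeriv f k) y

theorem derivSeminorm_le {k : ℕ} {f : SmoothTorus n} {C : ℝ}
    (h : ∀ y, ‖iteratedFDeriv ℝ k (f : (Fin n → ℝ) → ℂ) y‖ ≤ C) : derivSeminorm n k f ≤ C :=
  ciSup_le h

theorem norm_apply_le (f : SmoothTorus n) (y : Fin n → ℝ) : ‖f y‖ ≤ derivSeminorm n 0 f := by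
  simpa using norm_iteratedFDeriv_le 0 f y

theorem derivSeminorm_zero_le {f : SmoothTorus n} {C : ℝ} (h : ∀ y, ‖f y‖ ≤ C) :
    derivSeminorm n 0 f ≤ C :=
  derivSeminorm_le fun y => by simpa using h y

@[simp] theorem add_apply (f g : SmoothTorus n) (y : Fin n → ℝ) : (f + g) y = f y + g y := rfl

@[simp] theorem smul_apply (a : ℂ) (f : SmoothTorus n) (y : Fin n → ℝ) : (a • f) y = a * f y := rfl

@[simp] theorem zero_apply (y : Fin n → ℝ) : (0 : SmoothTorus n) y = 0 := rfl

@[simp] theorem sub_apply (f g : SmoothTorus n) (y : Fin n → ℝ) : (f - g) y = f y - g y := rfl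

theorem differentiableAt (f : SmoothTorus n) (y : Fin n → ℝ) :
    DifferentiableAt ℝ (f : (Fin n → ℝ) → ℂ) y :=
  f.contDiff.differentiable (by simp) y

theorem D_apply (j : Fin n) (f : SmoothTorus n) (y : Fin n → ℝ) :
    D j f y = -Complex.I * fderiv ℝ (f : (Fin n → ℝ) → ℂ) y (Pi.single j 1) := rfl

/-- Evaluation at a point, as a linear map. -/
def evalₗ (y : Fin n → ℝ) : SmoothTorus n →ₗ[ℂ] ℂ where
  toFun f := f y
  map_add' _ _ := rfl
  map_smul' _ _ := rfl

@[simp] theorem evalₗ_apply (y : Fin n → ℝ) (f : SmoothTorus n) : evalₗ y f = f y := rfl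

@[simp] theorem sum_apply {ι : Type*} (s : Finset ι) (F : ι → SmoothTorus n) (y : Fin n → ℝ) :
    (∑ i ∈ s, F i) y = ∑ i ∈ s, F i y :=
  map_sum (evalₗ y) F s

instance : IsTopologicalAddGroup (SmoothTorus n) := withSeminorms.topologicalAddGroup

theorem continuous_derivSeminorm (k : ℕ) : Continuous (derivSeminorm n k) :=
  withSeminorms.continuous_seminorm k

theorem continuous_functional_of_le {φ : SmoothTorus n →ₗ[ℂ] ℂ} {q : SmoothTorus n → ℝ}
    (hq : Continuous q) (hq0 : q 0 = 0) (h : ∀ f, ‖φ f‖ ≤ q f) : Continuous φ := by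
  refine continuous_of_continuousAt_zero φ ?_
  rw [ContinuousAt, map_zero]
  exact squeeze_zero_norm h (hq0 ▸ hq.tendsto 0)

theorem continuous_eval (y : Fin n → ℝ) : Continuous fun f : SmoothTorus n => f y :=
  continuous_functional_of_le (φ := evalₗ y) (continuous_derivSeminorm 0) (map_zero _)
    fun f => norm_apply_le f y

theorem derivSeminorm_D_le (k : ℕ) (j : Fin n) (f : SmoothTorus n) :
    derivSeminorm n k (D j f) ≤ derivSeminorm n (k + 1) f := by
  refine derivSeminorm_le fun y => ?_
  -- `D j f` is the differential of `f` followed by a fixed functional; its norm is at most `1`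
  -- because `ℝⁿ` carries the sup norm.
  let L : ((Fin n → ℝ) →L[ℝ] ℂ) →L[ℝ] ℂ :=
    (-Complex.I) • ContinuousLinearMap.apply ℝ ℂ (Pi.single j (1 : ℝ) : Fin n → ℝ)
  have hL : ‖L‖ ≤ 1 := by
    refine ContinuousLinearMap.opNorm_le_bound _ zero_le_one fun A => ?_
    have h := A.le_opNorm (Pi.single j (1 : ℝ))
    have h2 : ‖(Pi.single j (1 : ℝ) : Fin n → ℝ)‖ ≤ 1 := by
      refine (pi_norm_le_iff_of_nonneg zero_le_one).2 fun i => ?_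
      by_cases hi : i = j
      · subst hi; simp
      · simp [Pi.single_eq_of_ne hi]
    simp only [L, _root_.smul_apply, ContinuousLinearMap.apply_apply, norm_smul,
      norm_neg, Complex.norm_I, one_mul]
    exact h.trans (by nlinarith [norm_nonneg A])
  have hf : ContDiff ℝ ∞ (fderiv ℝ (f : (Fin n → ℝ) → ℂ)) :=
    f.contDiff.fderiv_right (m := ∞) (by simp)
  have h := L.norm_iteratedFDeriv_comp_left (x := y) hf.contDiffAt
    (show ((k : ℕ∞) : WithTop ℕ∞) ≤ ∞ by exact_mod_cast le_top)
  have he : (D j f : (Fin n → ℝ) → ℂ) = L ∘ fderiv ℝ (f : (Fin n → ℝ) → ℂ) := rfl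
  rw [he]
  refine h.trans ?_
  rw [norm_iteratedFDeriv_fderiv]
  have := norm_iteratedFDeriv_le (k + 1) f y
  nlinarith [norm_nonneg (iteratedFDeriv ℝ (k + 1) (f : (Fin n → ℝ) → ℂ) y)]

theorem fderiv_eq_sum (f : SmoothTorus n) (y : Fin n → ℝ) :
    fderiv ℝ (f : (Fin n → ℝ) → ℂ) y = ∑ j, (Complex.I * D j f y) •
      (Complex.ofRealCLM.comp (ContinuousLinearMap.proj (R := ℝ) j : (Fin n → ℝ) →L[ℝ] ℝ)) := by
  ext v
  have hv : v = ∑ j, v j • (Pi.single j (1 : ℝ) : Fin n → ℝ) := by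
    rw [← Finset.univ_sum_single v]
    refine Finset.sum_congr rfl fun j _ => ?_
    ext i
    by_cases hi : i = j
    · subst hi; simp
    · simp [Pi.single_eq_of_ne hi]
  conv_lhs => rw [hv, map_sum]
  rw [_root_.sum_apply]
  refine Finset.sum_congr rfl fun j _ => ?_
  simp only [map_smul, D_apply, _root_.smul_apply, ContinuousLinearMap.comp_apply,
    ContinuousLinearMap.proj_apply, Complex.ofRealCLM_apply, Complex.real_smul, smul_eq_mul]
  linear_combination ((v j : ℂ) * fderiv ℝ (f : (Fin n → ℝ) → ℂ) y (Pi.single j 1)) *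
    Complex.I_sq

/-- The differential is the combination of the coordinate functionals with coefficients `i D_j f`,
and these functionals have norm at most `1`. Full derivatives can thus be estimated by iterating the
operators `D j`, which act simply on exponentials and modes. -/
theorem derivSeminorm_succ_le (k : ℕ) (f : SmoothTorus n) :
    derivSeminorm n (k + 1) f ≤ ∑ j, derivSeminorm n k (D j f) := by
  refine derivSeminorm_le fun y => ?_
  have hk : ((k : ℕ∞) : WithTop ℕ∞) ≤ ∞ := by exact_mod_cast le_top
  let e (j : Fin n) : (Fin n → ℝ) →L[ℝ] ℂ :=
    Complex.ofRealCLM.comp (ContinuousLinearMap.proj (R := ℝ) j : (Fin n → ℝ) →L[ℝ] ℝ)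
  let L (j : Fin n) : ℂ →L[ℝ] ((Fin n → ℝ) →L[ℝ] ℂ) :=
    LinearMap.mkContinuous
      { toFun := fun a => (Complex.I * a) • e j
        map_add' := fun a b => by
          ext v
          simp [mul_add, add_mul]
        map_smul' := fun r a => by
          ext v
          simp [mul_comm, mul_left_comm, mul_assoc] } 1 (fun a => by
        refine ContinuousLinearMap.opNorm_le_bound _ (by positivity) fun v => ?_
        have := norm_le_pi_norm v j
        simp only [LinearMap.coe_mk, AddHom.coe_mk, _root_.smul_apply, smul_eq_mul,
          norm_mul, Complex.norm_I, one_mul, e, ContinuousLinearMap.comp_apply,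
          Complex.ofRealCLM_apply, Complex.norm_real, ContinuousLinearMap.proj_apply]
        gcongr)
  have hL (j : Fin n) : ‖L j‖ ≤ 1 := LinearMap.mkContinuous_norm_le _ zero_le_one _
  have he : fderiv ℝ (f : (Fin n → ℝ) → ℂ) = fun y => ∑ j, (L j ∘ D j f) y := by
    funext y
    exact fderiv_eq_sum f y
  rw [← norm_iteratedFDeriv_fderiv, he, iteratedFDeriv_fun_sum_apply
    fun j _ => (((L j).contDiff.comp (D j f).contDiff).of_le hk).contDiffAt]
  refine (norm_sum_le _ _).trans (Finset.sum_le_sum fun j _ => ?_)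
  refine ((L j).norm_iteratedFDeriv_comp_left (D j f).contDiff.contDiffAt hk).trans ?_
  have := norm_iteratedFDeriv_le k (D j f) y
  nlinarith [norm_nonneg (iteratedFDeriv ℝ k (D j f : (Fin n → ℝ) → ℂ) y), hL j]

/-- A series in `C^∞(𝕋ⁿ)` converges if all its series of seminorms do. -/
theorem exists_hasSum {ι : Type*} (F : ι → SmoothTorus n)
    (hF : ∀ k, Summable fun i => derivSeminorm n k (F i)) : ∃ f, HasSum F f := by
  have hs : ContDiff ℝ ∞ fun y => ∑' i, F i y :=
    contDiff_tsum (N := ⊤) (fun i => (F i).contDiff) (fun k _ => hF k)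
      (fun k i y _ => norm_iteratedFDeriv_le k (F i) y)
  refine ⟨mk _ hs fun k y => by simp only [periodic], ?_⟩
  rw [HasSum, withSeminorms.tendsto_nhds]
  intro k ε hε
  have hk : ((k : ℕ∞) : WithTop ℕ∞) ≤ ∞ := by exact_mod_cast le_top
  have hu := tendstoUniformly_tsum (hF k) (fun i y => norm_iteratedFDeriv_le k (F i) y)
  rw [Metric.tendstoUniformly_iff] at hu
  filter_upwards [hu (ε / 2) (half_pos hε)] with s hsε
  refine lt_of_le_of_lt (derivSeminorm_le fun y => ?_) (half_lt_self hε)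
  have h1 : (∑ i ∈ s, F i - mk _ hs (fun k y => by simp only [periodic]) : SmoothTorus n) =
    ((fun z => ∑ i ∈ s, (F i) z) - fun z => ∑' i, F i z : (Fin n → ℝ) → ℂ) := by
    funext z
    simp [mk_apply]
  rw [h1, iteratedFDeriv_sub_apply
    ((ContDiff.sum fun i _ => (F i).contDiff.of_le hk).contDiffAt) ((hs.of_le hk).contDiffAt),
    iteratedFDeriv_tsum_apply (N := ⊤) (fun i => (F i).contDiff) (fun k _ => hF k)
      (fun k i y _ => norm_iteratedFDeriv_le k (F i) y) le_top,
    iteratedFDeriv_fun_sum_apply fun i _ => ((F i).contDiff.of_le hk).contDiffAt]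
  have := hsε y
  rw [dist_comm, dist_eq_norm] at this
  exact this.le

theorem derivSeminorm_le_tsum {ι : Type*} {F : ι → SmoothTorus n} {f : SmoothTorus n}
    (h : HasSum F f) {k : ℕ} (hk : Summable fun i => derivSeminorm n k (F i)) :
    derivSeminorm n k f ≤ ∑' i, derivSeminorm n k (F i) := by
  refine le_of_tendsto (((continuous_derivSeminorm k).tendsto f).comp h)
    (Filter.Eventually.of_forall fun s => ?_)
  refine (Finset.le_sum_of_subadditive _ (map_zero _).le (map_add_le_add _) s F).trans ?_
  exact hk.sum_le_tsum s fun i _ => apply_nonneg _ _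

end SmoothTorus

/-! ### Fourier coefficients -/

-- The normalised Haar measure on each circle gives a translation invariant probability measure on
-- the torus, so the Fourier coefficients need no factor of `2π`.
noncomputable local instance : MeasureSpace UnitAddCircle := ⟨AddCircle.haarAddCircle⟩

local instance : Measure.IsAddHaarMeasure (volume : Measure UnitAddCircle) :=
  inferInstanceAs (Measure.IsAddHaarMeasure AddCircle.haarAddCircle)

local instance : IsProbabilityMeasure (volume : Measure UnitAddCircle) :=
  inferInstanceAs (IsProbabilityMeasure AddCircle.haarAddCircle)

/-- The projection of `ℝⁿ` onto `(ℝ / ℤ)ⁿ`. -/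
def unitTorusMk (n : ℕ) : C(Fin n → ℝ, UnitAddTorus (Fin n)) where
  toFun x j := (x j : UnitAddCircle)
  continuous_toFun := continuous_pi fun j =>
    (AddCircle.continuous_mk' (1 : ℝ)).comp (continuous_apply j)

theorem isQuotientMap_unitTorusMk (n : ℕ) : Topology.IsQuotientMap (unitTorusMk n) :=
  (IsOpenQuotientMap.piMap (f := fun (_ : Fin n) (x : ℝ) => (x : UnitAddCircle))
    fun _ => QuotientAddGroup.isOpenQuotientMap_mk).isQuotientMap

namespace SmoothTorus

variable {n : ℕ}

/-- The function `x ↦ f(2πx)`. -/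
noncomputable def rescale (f : SmoothTorus n) : C(Fin n → ℝ, ℂ) :=
  ⟨fun x => f ((2 * π) • x), f.contDiff.continuous.comp (continuous_const_smul _)⟩

theorem factorsThrough_rescale (f : SmoothTorus n) :
    Function.FactorsThrough (rescale f) (unitTorusMk n) := by
  intro x x' h
  have h' (j : Fin n) : ∃ k : ℤ, x' j + k = x j := by
    have hj : ((x j - x' j : ℝ) : UnitAddCircle) = 0 := by
      rw [AddCircle.coe_sub, sub_eq_zero]
      exact congrFun h j
    obtain ⟨k, hk⟩ := (AddCircle.coe_eq_zero_iff _).1 hj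
    exact ⟨k, by simp at hk; linarith⟩
  choose k hk using h'
  have hx : (2 * π) • x = (2 * π) • x' + torusPeriod k := by
    funext j
    simp [torusPeriod, ← hk j, mul_add]
  simp only [rescale, ContinuousMap.coe_mk, hx, f.periodic]

/-- The function on `(ℝ / ℤ)ⁿ` induced by `f`. -/
noncomputable def lift (f : SmoothTorus n) : C(UnitAddTorus (Fin n), ℂ) :=
  (isQuotientMap_unitTorusMk n).lift (rescale f) (factorsThrough_rescale f)

theorem lift_mk (f : SmoothTorus n) (x : Fin n → ℝ) :
    lift f (unitTorusMk n x) = f ((2 * π) • x) :=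
  DFunLike.congr_fun ((isQuotientMap_unitTorusMk n).lift_comp (rescale f)
    (factorsThrough_rescale f)) x

theorem exists_unitTorusMk (z : UnitAddTorus (Fin n)) : ∃ x, unitTorusMk n x = z :=
  (isQuotientMap_unitTorusMk n).surjective z

theorem norm_lift_apply_le (f : SmoothTorus n) (z : UnitAddTorus (Fin n)) :
    ‖lift f z‖ ≤ derivSeminorm n 0 f := by
  obtain ⟨x, rfl⟩ := exists_unitTorusMk z
  rw [lift_mk]
  exact norm_apply_le f _

theorem expo_apply (η : Fin n → ℤ) (y : Fin n → ℝ) :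
    expo η y = Complex.exp (Complex.I * ((∑ j, y j * (η j : ℝ) : ℝ) : ℂ)) := rfl

theorem mFourier_unitTorusMk (η : Fin n → ℤ) (x : Fin n → ℝ) :
    UnitAddTorus.mFourier η (unitTorusMk n x) = expo η ((2 * π) • x) := by
  simp only [UnitAddTorus.mFourier, ContinuousMap.coe_mk, unitTorusMk, fourier_coe_apply]
  rw [← Complex.exp_sum, expo_apply]
  congr 1
  push_cast
  rw [Finset.mul_sum]
  refine Finset.sum_congr rfl fun j _ => ?_
  simp
  ring

@[simp] theorem norm_expo_apply (η : Fin n → ℤ) (y : Fin n → ℝ) : ‖expo η y‖ = 1 := by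
  rw [expo_apply, mul_comm, Complex.norm_exp_ofReal_mul_I]

theorem expo_add_apply (η : Fin n → ℤ) (y z : Fin n → ℝ) :
    expo η (y + z) = expo η y * expo η z := by
  simp only [expo_apply, ← Complex.exp_add, ← mul_add, Pi.add_apply, add_mul,
    Finset.sum_add_distrib, Complex.ofReal_add]

theorem hasDerivAt_expo_line (η : Fin n → ℤ) (y v : Fin n → ℝ) (h : ℝ) :
    HasDerivAt (fun h : ℝ => expo η (y + h • v))
      (Complex.I * ((∑ j, v j * (η j : ℝ) : ℝ) : ℂ) * expo η (y + h • v)) h := by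
  have h1 : HasDerivAt (fun h : ℝ => Complex.I *
      (((∑ j, y j * (η j : ℝ)) + h * (∑ j, v j * (η j : ℝ)) : ℝ) : ℂ))
      (Complex.I * ((∑ j, v j * (η j : ℝ) : ℝ) : ℂ)) h := by
    have := ((hasDerivAt_id h).mul_const (∑ j, v j * (η j : ℝ))).const_add (∑ j, y j * (η j : ℝ))
    simpa using (this.ofReal_comp).const_mul Complex.I
  have he : (fun h : ℝ => expo η (y + h • v)) = fun h : ℝ => Complex.exp (Complex.I *
      (((∑ j, y j * (η j : ℝ)) + h * (∑ j, v j * (η j : ℝ)) : ℝ) : ℂ)) := by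
    funext h
    rw [expo_apply]
    simp only [Pi.add_apply, Pi.smul_apply, smul_eq_mul, add_mul, Finset.sum_add_distrib,
      Finset.mul_sum, mul_assoc]
  have h2 := h1.cexp
  rw [← congrFun he h] at h2
  rw [he]
  simpa [mul_comm] using h2

theorem hasDerivAt_line (f : SmoothTorus n) (j : Fin n) (y : Fin n → ℝ) (h : ℝ) :
    HasDerivAt (fun h : ℝ => f (y + h • (Pi.single j 1 : Fin n → ℝ)))
      (Complex.I * D j f (y + h • (Pi.single j 1 : Fin n → ℝ))) h := by
  have h1 : HasDerivAt (fun h : ℝ => y + h • (Pi.single j 1 : Fin n → ℝ))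
      (Pi.single j 1 : Fin n → ℝ) h := by
    simpa using ((hasDerivAt_id h).smul_const (Pi.single j 1 : Fin n → ℝ)).const_add y
  have h2 := (f.differentiableAt (y + h • (Pi.single j 1 : Fin n → ℝ))).hasFDerivAt.comp_hasDerivAt
    h h1
  rw [D_apply, ← mul_assoc]
  simpa [Function.comp_def] using h2

theorem D_expo (j : Fin n) (η : Fin n → ℤ) : D j (expo η) = (η j : ℂ) • expo η := by
  refine DFunLike.ext _ _ fun y => ?_
  have h1 := hasDerivAt_line (expo η) j y 0
  have h2 := hasDerivAt_expo_line η y (Pi.single j 1) 0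
  have h := h1.unique h2
  simp only [zero_smul, add_zero] at h
  rw [mul_assoc] at h
  have h3 := mul_left_cancel₀ Complex.I_ne_zero h
  rw [h3]
  simp [Pi.single_apply]

/-- The Fourier coefficients of a smooth function on `𝕋ⁿ`. -/
noncomputable def coef (η : Fin n → ℤ) : SmoothTorus n →ₗ[ℂ] ℂ where
  toFun f := UnitAddTorus.mFourierCoeff (lift f) η
  map_add' f g := by
    have h : ∀ z, lift (f + g) z = lift f z + lift g z := fun z => by
      obtain ⟨x, rfl⟩ := exists_unitTorusMk z
      simp [lift_mk]
    simp only [UnitAddTorus.mFourierCoeff, h, smul_add]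
    exact integral_add (Continuous.integrable_of_hasCompactSupport (by fun_prop)
      (HasCompactSupport.of_compactSpace _)) (Continuous.integrable_of_hasCompactSupport
      (by fun_prop) (HasCompactSupport.of_compactSpace _))
  map_smul' a f := by
    have h : ∀ z, lift (a • f) z = a * lift f z := fun z => by
      obtain ⟨x, rfl⟩ := exists_unitTorusMk z
      simp [lift_mk]
    simp only [UnitAddTorus.mFourierCoeff, h, RingHom.id_apply, smul_eq_mul,
      mul_left_comm _ a]
    exact integral_const_mul _ _

theorem coef_apply (η : Fin n → ℤ) (f : SmoothTorus n) :
    coef η f = ∫ z, UnitAddTorus.mFourier (-η) z * lift f z := rfl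

theorem norm_coef_le (η : Fin n → ℤ) (f : SmoothTorus n) : ‖coef η f‖ ≤ derivSeminorm n 0 f := by
  rw [coef_apply]
  have h := norm_integral_le_of_norm_le_const (μ := (volume : Measure (UnitAddTorus (Fin n))))
    (f := fun z => UnitAddTorus.mFourier (-η) z * lift f z) (C := derivSeminorm n 0 f)
    (Filter.Eventually.of_forall fun z => by
      obtain ⟨x, rfl⟩ := exists_unitTorusMk z
      rw [norm_mul, mFourier_unitTorusMk, norm_expo_apply, one_mul]
      exact norm_lift_apply_le f _)
  simpa using h

theorem continuous_coef (η : Fin n → ℤ) : Continuous (coef (n := n) η) :=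
  continuous_functional_of_le (continuous_derivSeminorm 0) (map_zero _) (norm_coef_le η)

/-- No integration by parts is needed: translating `f` by `h e_j` multiplies its coefficient by a
character of `h`. Differentiate this identity at `h = 0`, under the integral on one side and
explicitly on the other. -/
theorem coef_D (η : Fin n → ℤ) (j : Fin n) (f : SmoothTorus n) :
    coef η (D j f) = (η j : ℂ) * coef η f := by
  let e : Fin n → ℝ := Pi.single j 1
  let F : ℝ → UnitAddTorus (Fin n) → ℂ := fun h z =>
    UnitAddTorus.mFourier (-η) z * lift f (z + unitTorusMk n (h • e))
  have hmk (x y : Fin n → ℝ) : unitTorusMk n x + unitTorusMk n y = unitTorusMk n (x + y) := rfl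
  have h2π : (2 * π : ℝ) ≠ 0 := by positivity
  have hF (h : ℝ) : ∫ z, F h z = expo η ((2 * π) • h • e) * coef η f := by
    rw [coef_apply, ← integral_const_mul,
      ← integral_add_right_eq_self (μ := (volume : Measure (UnitAddTorus (Fin n))))
        (fun z => expo η ((2 * π) • h • e) * (UnitAddTorus.mFourier (-η) z * lift f z))
        (unitTorusMk n (h • e))]
    refine integral_congr_ae (Filter.Eventually.of_forall fun z => ?_)
    obtain ⟨x, rfl⟩ := exists_unitTorusMk z
    simp only [F, hmk, mFourier_unitTorusMk, smul_add, expo_add_apply]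
    have : expo η ((2 * π) • h • e) * expo (-η) ((2 * π) • h • e) = 1 := by
      rw [expo_apply, expo_apply, ← Complex.exp_add, ← mul_add, ← Complex.ofReal_add,
        ← Finset.sum_add_distrib]
      simp
    linear_combination (-(expo (-η) ((2 * π) • x)) *
      lift f (unitTorusMk n (x + h • e))) * this
  have hline (x : Fin n → ℝ) (g : SmoothTorus n) (h : ℝ) :
      lift g (unitTorusMk n x + unitTorusMk n (h • e)) = g ((2 * π) • x + ((2 * π) * h) • e) := by
    rw [hmk, lift_mk, smul_add, smul_smul]
  have hder : HasDerivAt (fun h => ∫ z, F h z)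
      (∫ z, UnitAddTorus.mFourier (-η) z * (2 * π * Complex.I * lift (D j f) z)) 0 := by
    -- The dominating function is the constant `2π sup ‖D_j f‖`; the factor `2π` comes from the
    -- rescaling of the torus to period `1`.
    have key := hasDerivAt_integral_of_dominated_loc_of_deriv_le
      (μ := (volume : Measure (UnitAddTorus (Fin n)))) (F := F) (x₀ := (0 : ℝ)) (s := univ)
      (F' := fun h z => UnitAddTorus.mFourier (-η) z *
        (2 * π * Complex.I * lift (D j f) (z + unitTorusMk n (h • e))))
      (bound := fun _ => 2 * π * derivSeminorm n 0 (D j f)) Filter.univ_mem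
      (Filter.Eventually.of_forall fun h => Continuous.aestronglyMeasurable (by fun_prop))
      (Continuous.integrable_of_hasCompactSupport (by fun_prop)
        (HasCompactSupport.of_compactSpace _))
      (Continuous.aestronglyMeasurable (by fun_prop))
      (Filter.Eventually.of_forall fun z h _ => by
        obtain ⟨x, rfl⟩ := exists_unitTorusMk z
        rw [norm_mul, mFourier_unitTorusMk, norm_expo_apply, one_mul, norm_mul]
        have := norm_lift_apply_le (D j f) (unitTorusMk n x + unitTorusMk n (h • e))
        have h3 : ‖(2 * π * Complex.I : ℂ)‖ = 2 * π := by
          simp [abs_of_pos Real.pi_pos]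
        rw [h3]
        gcongr)
      (integrable_const _)
      (Filter.Eventually.of_forall fun z h _ => by
        obtain ⟨x, rfl⟩ := exists_unitTorusMk z
        simp only [F, hline]
        refine HasDerivAt.const_mul _ ?_
        have h1 := hasDerivAt_line f j ((2 * π) • x) (2 * π * h)
        have h2 := h1.scomp h ((hasDerivAt_id h).const_mul (2 * π))
        simp only [Function.comp_def, mul_one, Complex.real_smul] at h2
        have hv : 2 * π * Complex.I * D j f ((2 * π) • x + (2 * π * h) • e) = ((2 * π : ℝ) : ℂ) *
            (Complex.I * D j f ((2 * π) • x + (2 * π * h) • Pi.single j 1)) := by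
          push_cast
          ring
        rw [hv]
        exact h2)
    have := key.2
    have h0 : unitTorusMk n ((0 : ℝ) • e) = 0 := by
      rw [zero_smul]
      rfl
    simpa only [h0, add_zero] using this
  have hder2 : HasDerivAt (fun h => ∫ z, F h z)
      (2 * π * Complex.I * (η j : ℂ) * coef η f) 0 := by
    simp only [hF]
    have h1 := (hasDerivAt_expo_line η 0 ((2 * π) • e) 0).mul_const (coef η f)
    have h0 : expo η (0 : Fin n → ℝ) = 1 := by simp [expo_apply]
    simp only [zero_smul, add_zero, zero_add, h0, mul_one] at h1
    have h2 : (fun h : ℝ => expo η (h • (2 * π) • e) * coef η f) =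
        fun h : ℝ => expo η ((2 * π) • h • e) * coef η f := by
      funext h
      rw [smul_comm]
    rw [h2] at h1
    have hv : 2 * π * Complex.I * (η j : ℂ) * coef η f =
        Complex.I * ((∑ i, ((2 * π) • e) i * (η i : ℝ) : ℝ) : ℂ) * coef η f := by
      have hs : ∑ i, ((2 * π) • e) i * (η i : ℝ) = 2 * π * η j := by
        simp [e, Pi.single_apply]
      rw [hs]
      push_cast
      ring
    rw [hv]
    exact h1
  have h := hder.unique hder2
  have h4 : ∫ z, UnitAddTorus.mFourier (-η) z * (2 * π * Complex.I * lift (D j f) z) =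
      2 * π * Complex.I * coef η (D j f) := by
    rw [coef_apply, ← integral_const_mul]
    congr 1
    funext z
    ring
  rw [h4, mul_assoc _ (η j : ℂ)] at h
  exact mul_left_cancel₀ Complex.two_pi_I_ne_zero h

theorem coef_expo_self (η : Fin n → ℤ) : coef η (expo η) = 1 := by
  rw [coef_apply]
  have : ∀ z, UnitAddTorus.mFourier (-η) z * lift (expo η) z = 1 := fun z => by
    obtain ⟨x, rfl⟩ := exists_unitTorusMk z
    rw [lift_mk, mFourier_unitTorusMk, expo_apply, expo_apply, ← Complex.exp_add, ← mul_add,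
      ← Complex.ofReal_add, ← Finset.sum_add_distrib]
    simp
  simp [this]

/-- The coefficient is multiplied by both `η_j` and `k`. This single remark gives the orthogonality
of exponentials and the Fourier support of modes. -/
theorem coef_eq_zero_of_D_eq {η : Fin n → ℤ} {j : Fin n} {k : ℤ} {f : SmoothTorus n}
    (hf : D j f = (k : ℂ) • f) (hk : η j ≠ k) : coef η f = 0 := by
  have h := coef_D η j f
  rw [hf, map_smul, smul_eq_mul, ← sub_eq_zero, ← sub_mul] at h
  refine (mul_eq_zero.1 h).resolve_left ?_
  rw [sub_eq_zero]
  exact_mod_cast hk.symm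

theorem coef_expo_of_ne {η η' : Fin n → ℤ} (h : η ≠ η') : coef η (expo η') = 0 := by
  obtain ⟨j, hj⟩ := Function.ne_iff.1 h
  exact coef_eq_zero_of_D_eq (D_expo j η') hj

theorem one_add_latticeNorm_mul_norm_coef_le (η : Fin n → ℤ) (f : SmoothTorus n) :
    (1 + latticeNorm η) * ‖coef η f‖ ≤ ‖coef η f‖ + ∑ j, ‖coef η (D j f)‖ := by
  have h := mul_le_mul_of_nonneg_right (latticeNorm_le_sum η) (norm_nonneg (coef η f))
  simp only [coef_D, norm_mul, Complex.norm_intCast]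
  rw [Finset.sum_mul] at h
  linarith

/-- Each factor `1 + |η|` is traded for one derivative through `|η| ≤ ∑ |η_j|` and `coef_D`. The
constant does not depend on `f`, which later gives the continuity of the compatibility functionals.
-/
theorem exists_pow_mul_norm_coef_le_sum (n M : ℕ) :
    ∃ C, 0 ≤ C ∧ ∀ (f : SmoothTorus n) (η : Fin n → ℤ), (1 + latticeNorm η) ^ M * ‖coef η f‖ ≤
      C * ∑ k ∈ Finset.range (M + 1), derivSeminorm n k f := by
  induction M with
  | zero => exact ⟨1, zero_le_one, fun f η => by simpa using norm_coef_le η f⟩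
  | succ M ih =>
    obtain ⟨C, hC, h⟩ := ih
    refine ⟨C * (1 + n), by positivity, fun f η => ?_⟩
    have hw : 0 ≤ (1 + latticeNorm η) ^ M :=
      pow_nonneg (zero_le_one.trans (one_le_one_add_latticeNorm η)) _
    have h1 : ∑ k ∈ Finset.range (M + 1), derivSeminorm n k f ≤
        ∑ k ∈ Finset.range (M + 1 + 1), derivSeminorm n k f := by
      rw [Finset.sum_range_succ _ (M + 1)]
      exact le_add_of_nonneg_right (apply_nonneg _ _)
    have h2 (j : Fin n) : ∑ k ∈ Finset.range (M + 1), derivSeminorm n k (D j f) ≤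
        ∑ k ∈ Finset.range (M + 1 + 1), derivSeminorm n k f := by
      rw [Finset.sum_range_succ' _ (M + 1)]
      refine le_add_of_le_of_nonneg (Finset.sum_le_sum fun k _ => derivSeminorm_D_le k j f)
        (apply_nonneg _ _)
    rw [pow_succ, mul_assoc]
    refine (mul_le_mul_of_nonneg_left (one_add_latticeNorm_mul_norm_coef_le η f) hw).trans ?_
    rw [mul_add, Finset.mul_sum, mul_assoc, add_mul, one_mul, mul_add]
    refine add_le_add ((h f η).trans (mul_le_mul_of_nonneg_left h1 hC)) ?_
    refine (Finset.sum_le_sum fun j _ =>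
      (h (D j f) η).trans (mul_le_mul_of_nonneg_left (h2 j) hC)).trans (le_of_eq ?_)
    simp
    ring

theorem exists_pow_mul_norm_coef_le (M : ℕ) (f : SmoothTorus n) :
    ∃ C, ∀ η, (1 + latticeNorm η) ^ M * ‖coef η f‖ ≤ C := by
  obtain ⟨C, -, h⟩ := exists_pow_mul_norm_coef_le_sum n M
  exact ⟨_, h f⟩

theorem derivSeminorm_expo_le (k : ℕ) (η : Fin n → ℤ) :
    derivSeminorm n k (expo η) ≤ (n * (1 + latticeNorm η)) ^ k := by
  induction k with
  | zero => exact derivSeminorm_zero_le fun y => by simp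
  | succ k ih =>
    refine (derivSeminorm_succ_le k _).trans ?_
    have h (j : Fin n) : derivSeminorm n k (D j (expo η)) ≤
        (1 + latticeNorm η) * (n * (1 + latticeNorm η)) ^ k := by
      rw [D_expo, map_smul_eq_mul, Complex.norm_intCast]
      have := abs_le_latticeNorm η j
      have h0 := latticeNorm_nonneg η
      exact mul_le_mul (by linarith) ih (apply_nonneg _ _) (by linarith)
    refine (Finset.sum_le_sum fun j _ => h j).trans (le_of_eq ?_)
    simp [pow_succ]
    ring

/-- A series of exponentials with rapidly decreasing coefficients has summable seminorms. -/
theorem summable_derivSeminorm_smul_expo {a : (Fin n → ℤ) → ℂ}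
    (ha : ∀ M : ℕ, ∃ C, ∀ η, (1 + latticeNorm η) ^ M * ‖a η‖ ≤ C) (k : ℕ) :
    Summable fun η => derivSeminorm n k (a η • expo η) := by
  -- `k` powers pay for the seminorm of the exponential and `2n` for summability over the lattice.
  obtain ⟨C, hC⟩ := ha (k + 2 * n)
  refine Summable.of_nonneg_of_le (fun _ => apply_nonneg _ _) (fun η => ?_)
    ((summable_inv_one_add_latticeNorm_pow n).mul_left ((n : ℝ) ^ k * C))
  have hw : 0 < 1 + latticeNorm η := zero_lt_one.trans_le (one_le_one_add_latticeNorm η)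
  rw [map_smul_eq_mul]
  calc ‖a η‖ * derivSeminorm n k (expo η) ≤ ‖a η‖ * (n * (1 + latticeNorm η)) ^ k := by
        gcongr
        exact derivSeminorm_expo_le k η
    _ = (n : ℝ) ^ k * ((1 + latticeNorm η) ^ (k + 2 * n) * ‖a η‖) *
          ((1 + latticeNorm η) ^ (2 * n))⁻¹ := by
        rw [mul_pow, pow_add]
        field_simp
    _ ≤ _ := by
        gcongr
        exact hC η

theorem summable_coef (f : SmoothTorus n) : Summable fun η => coef η f := by
  have h := summable_derivSeminorm_smul_expo (fun M => exists_pow_mul_norm_coef_le M f) 0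
  refine Summable.of_norm_bounded h fun η => ?_
  simpa using norm_apply_le (coef η f • expo η) 0

theorem hasSum_coef_mul_expo_apply (f : SmoothTorus n) (y : Fin n → ℝ) :
    HasSum (fun η => coef η f * expo η y) (f y) := by
  have h := UnitAddTorus.hasSum_mFourier_series_apply_of_summable (f := lift f) (summable_coef f)
    (unitTorusMk n ((2 * π)⁻¹ • y))
  have h2 : (2 * π) • (2 * π)⁻¹ • y = y := by
    rw [smul_smul, mul_inv_cancel₀ (by positivity), one_smul]
  simp only [lift_mk, mFourier_unitTorusMk, h2] at h
  exact h

/-- A smooth function is determined by its Fourier coefficients. -/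
theorem ext_coef {f g : SmoothTorus n} (h : ∀ η, coef η f = coef η g) : f = g :=
  DFunLike.ext _ _ fun y => (hasSum_coef_mul_expo_apply f y).unique <| by
    simpa only [h] using hasSum_coef_mul_expo_apply g y

/-- Rapid decay gives convergence in the Fréchet topology, and continuity of evaluations identifies
the sum. Continuous operators may therefore be applied term by term. -/
theorem hasSum_coef_smul_expo (f : SmoothTorus n) : HasSum (fun η => coef η f • expo η) f := by
  obtain ⟨g, hg⟩ := exists_hasSum (fun η => coef η f • expo η)
    (summable_derivSeminorm_smul_expo fun M => exists_pow_mul_norm_coef_le M f)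
  have : g = f := DFunLike.ext _ _ fun y =>
    (hg.map (evalₗ y) (continuous_eval y)).unique (hasSum_coef_mul_expo_apply f y)
  rwa [this] at hg

/-- Every rapidly decreasing family consists of the Fourier coefficients of a smooth function. -/
theorem exists_coef_eq {a : (Fin n → ℤ) → ℂ}
    (ha : ∀ M : ℕ, ∃ C, ∀ η, (1 + latticeNorm η) ^ M * ‖a η‖ ≤ C) :
    ∃ f : SmoothTorus n, ∀ η, coef η f = a η := by
  obtain ⟨f, hf⟩ := exists_hasSum _ (summable_derivSeminorm_smul_expo ha)
  refine ⟨f, fun η => ?_⟩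
  have h := hasSum_single (f := fun η' => coef η (a η' • expo η')) η fun η' hη' => by
    simp [coef_expo_of_ne hη'.symm]
  rw [map_smul, coef_expo_self, smul_eq_mul, mul_one] at h
  exact (hf.map (coef η) (continuous_coef η)).unique h

/-! ### Products -/

/-- The pointwise product. -/
def mul (f g : SmoothTorus n) : SmoothTorus n :=
  mk (fun y => f y * g y) (f.contDiff.mul g.contDiff) fun k y => by rw [f.periodic, g.periodic]

@[simp] theorem mul_apply (f g : SmoothTorus n) (y : Fin n → ℝ) : mul f g y = f y * g y := rfl

theorem derivSeminorm_mul_le (k : ℕ) (f g : SmoothTorus n) :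
    derivSeminorm n k (mul f g) ≤ ∑ i ∈ Finset.range (k + 1),
      (k.choose i : ℝ) * derivSeminorm n i f * derivSeminorm n (k - i) g := by
  refine derivSeminorm_le fun y => ?_
  refine (norm_iteratedFDeriv_mul_le (N := ∞) f.contDiff g.contDiff y
    (by exact_mod_cast le_top)).trans (Finset.sum_le_sum fun i _ => ?_)
  gcongr
  · exact norm_iteratedFDeriv_le i f y
  · exact norm_iteratedFDeriv_le (k - i) g y

theorem D_mul (j : Fin n) (f g : SmoothTorus n) :
    D j (mul f g) = mul (D j f) g + mul f (D j g) := by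
  refine DFunLike.ext _ _ fun y => ?_
  have h1 := hasDerivAt_line (mul f g) j y 0
  have h2 := (hasDerivAt_line f j y 0).fun_mul (hasDerivAt_line g j y 0)
  have h := h1.unique h2
  simp only [zero_smul, add_zero] at h
  refine mul_left_cancel₀ Complex.I_ne_zero (h.trans ?_)
  simp only [add_apply, mul_apply]
  ring

end SmoothTorus

/-! ### Partial Fourier series in `x` -/

namespace SmoothTorus

variable {N : ℕ}

/-- `G(t, x) = G(t, 0) e^{i x·ξ}`, expressed by the eigenvalue equations `D_{x_j} G = ξ_j G`. -/
def IsMode (ξ : Fin N → ℤ) (G : SmoothTorus (N + 1)) : Prop :=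
  ∀ j : Fin N, D j.succ G = (ξ j : ℂ) • G

theorem isMode_expo (τ : ℤ) (ξ : Fin N → ℤ) : IsMode ξ (expo (Fin.cons τ ξ)) := fun j => by
  rw [D_expo, Fin.cons_succ]

theorem isMode_expo_tail (η : Fin (N + 1) → ℤ) : IsMode (Fin.tail η) (expo η) := fun j => by
  rw [D_expo, Fin.tail]

variable {ξ : Fin N → ℤ} {G : SmoothTorus (N + 1)}

theorem IsMode.coef_eq_zero (hG : IsMode ξ G) {η : Fin (N + 1) → ℤ} (h : Fin.tail η ≠ ξ) :
    coef η G = 0 := by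
  obtain ⟨j, hj⟩ := Function.ne_iff.1 h
  exact coef_eq_zero_of_D_eq (hG j) hj

theorem isMode_iff_coef : IsMode ξ G ↔ ∀ η, Fin.tail η ≠ ξ → coef η G = 0 := by
  refine ⟨fun h η => h.coef_eq_zero, fun h j => ext_coef fun η => ?_⟩
  rw [coef_D, map_smul, smul_eq_mul]
  by_cases hη : Fin.tail η = ξ
  · rw [← hη, Fin.tail]
  · rw [h η hη, mul_zero, mul_zero]

theorem IsMode.sub {G' : SmoothTorus (N + 1)} (hG : IsMode ξ G) (hG' : IsMode ξ G') :
    IsMode ξ (G - G') := fun j => by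
  rw [map_sub, hG j, hG' j, smul_sub]

theorem IsMode.add {G' : SmoothTorus (N + 1)} (hG : IsMode ξ G) (hG' : IsMode ξ G') :
    IsMode ξ (G + G') := fun j => by
  rw [map_add, hG j, hG' j, smul_add]

theorem IsMode.smul (a : ℂ) (hG : IsMode ξ G) : IsMode ξ (a • G) := fun j => by
  rw [map_smul, hG j, smul_comm]

theorem D_comm {n : ℕ} (i j : Fin n) (f : SmoothTorus n) : D i (D j f) = D j (D i f) :=
  ext_coef fun η => by simp only [coef_D]; ring

theorem IsMode.D (i : Fin (N + 1)) (hG : IsMode ξ G) : IsMode ξ (D i G) := fun j => by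
  rw [D_comm, hG j, map_smul]

/-- The restriction of `G` to `x = 0`. -/
def slice (G : SmoothTorus (N + 1)) (t : ℝ) : ℂ := G (Fin.cons t 0)

theorem cons_add_smul_single (t h : ℝ) :
    (Fin.cons t 0 : Fin (N + 1) → ℝ) + h • (Pi.single 0 1 : Fin (N + 1) → ℝ) =
      Fin.cons (t + h) 0 := by
  funext j
  refine Fin.cases ?_ (fun i => ?_) j <;> simp

theorem hasDerivAt_slice (G : SmoothTorus (N + 1)) (t : ℝ) :
    HasDerivAt (slice G) (Complex.I * slice (SmoothTorus.D 0 G) t) t := by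
  have h := hasDerivAt_line G 0 (Fin.cons 0 0) t
  simp only [cons_add_smul_single, zero_add] at h
  exact h

theorem contDiff_cons_zero : ContDiff ℝ ∞ fun t : ℝ => (Fin.cons t 0 : Fin (N + 1) → ℝ) := by
  rw [contDiff_pi]
  intro j
  refine Fin.cases ?_ (fun i => ?_) j
  · exact contDiff_id
  · exact contDiff_const

theorem contDiff_slice (G : SmoothTorus (N + 1)) : ContDiff ℝ ∞ (slice G) :=
  G.contDiff.comp contDiff_cons_zero

theorem periodic_slice (G : SmoothTorus (N + 1)) : Function.Periodic (slice G) (2 * π) := by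
  intro t
  have h := G.periodic (Pi.single 0 1) (Fin.cons t 0)
  rw [slice, slice, ← h]
  congr 1
  funext j
  refine Fin.cases ?_ (fun i => ?_) j <;> simp [torusPeriod]

theorem expo_eq_mul (η : Fin (N + 1) → ℤ) (y : Fin (N + 1) → ℝ) :
    expo η y = expo (Fin.cons 0 (Fin.tail η)) y * expo η (Fin.cons (y 0) 0) := by
  rw [expo_apply, expo_apply, expo_apply, ← Complex.exp_add, ← mul_add, ← Complex.ofReal_add]
  congr 3
  simp [Fin.sum_univ_succ, Fin.tail, add_comm]

/-- Only frequencies `(τ, ξ)` occur in the Fourier series of `G`, and their exponentials all contain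
the factor `e^{i x·ξ}`. Sup norms of modes thereby become sup norms of functions of `t`. -/
theorem IsMode.apply_eq (hG : IsMode ξ G) (y : Fin (N + 1) → ℝ) :
    G y = expo (Fin.cons 0 ξ) y * slice G (y 0) := by
  refine (hasSum_coef_mul_expo_apply G y).unique ?_
  convert! (hasSum_coef_mul_expo_apply G (Fin.cons (y 0) 0)).mul_left
    (expo (Fin.cons 0 ξ) y) using 2 with η
  by_cases hη : Fin.tail η = ξ
  · rw [expo_eq_mul, hη]
    ring
  · rw [hG.coef_eq_zero hη, zero_mul, zero_mul, mul_zero]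

theorem IsMode.norm_apply (hG : IsMode ξ G) (y : Fin (N + 1) → ℝ) : ‖G y‖ = ‖slice G (y 0)‖ := by
  rw [hG.apply_eq, norm_mul, norm_expo_apply, one_mul]

theorem IsMode.ext {G' : SmoothTorus (N + 1)} (hG : IsMode ξ G) (hG' : IsMode ξ G')
    (h : ∀ t, slice G t = slice G' t) : G = G' :=
  DFunLike.ext _ _ fun y => by rw [hG.apply_eq, hG'.apply_eq, h]

theorem IsMode.derivSeminorm_zero_le (hG : IsMode ξ G) {C : ℝ} (h : ∀ t, ‖slice G t‖ ≤ C) :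
    derivSeminorm (N + 1) 0 G ≤ C :=
  SmoothTorus.derivSeminorm_zero_le fun y => by
    rw [hG.norm_apply]
    exact h _

theorem norm_slice_le (G : SmoothTorus (N + 1)) (t : ℝ) :
    ‖slice G t‖ ≤ derivSeminorm (N + 1) 0 G := norm_apply_le G _

/-- The function `(t, x) ↦ g(t) e^{i x·ξ}`. -/
noncomputable def ofSlice (ξ : Fin N → ℤ) (g : ℝ → ℂ) (hg : ContDiff ℝ ∞ g)
    (hp : Function.Periodic g (2 * π)) : SmoothTorus (N + 1) :=
  mul (expo (Fin.cons 0 ξ)) <| mk (fun y => g (y 0)) (hg.comp (contDiff_apply ℝ ℝ 0))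
    fun k y => by
      have h := hp.int_mul (k 0) (y 0)
      rw [mul_comm] at h
      exact h

theorem ofSlice_apply {g : ℝ → ℂ} (hg : ContDiff ℝ ∞ g) (hp : Function.Periodic g (2 * π))
    (y : Fin (N + 1) → ℝ) : ofSlice ξ g hg hp y = expo (Fin.cons 0 ξ) y * g (y 0) := rfl

@[simp] theorem slice_ofSlice {g : ℝ → ℂ} (hg : ContDiff ℝ ∞ g)
    (hp : Function.Periodic g (2 * π)) : slice (ofSlice ξ g hg hp) = g := by
  funext t
  rw [slice, ofSlice_apply]
  have : expo (Fin.cons 0 ξ : Fin (N + 1) → ℤ) (Fin.cons t 0) = 1 := by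
    simp [expo_apply, Fin.sum_univ_succ]
  rw [this, one_mul, Fin.cons_zero]

theorem D_succ_eq_zero {n : ℕ} {f : SmoothTorus n} {j : Fin n}
    (h : ∀ (y : Fin n → ℝ) (s : ℝ), f (y + s • (Pi.single j 1 : Fin n → ℝ)) = f y) :
    SmoothTorus.D j f = 0 := by
  refine DFunLike.ext _ _ fun y => ?_
  have h1 := hasDerivAt_line f j y 0
  simp only [h, zero_smul, add_zero] at h1
  exact (mul_eq_zero.1 (h1.unique (hasDerivAt_const 0 (f y)))).resolve_left Complex.I_ne_zero

theorem isMode_mul {F : SmoothTorus (N + 1)} (hF : ∀ j : Fin N, SmoothTorus.D j.succ F = 0)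
    (hG : IsMode ξ G) : IsMode ξ (mul F G) := fun j => by
  rw [D_mul, hF j, hG j]
  refine DFunLike.ext _ _ fun y => ?_
  simp
  ring

theorem isMode_ofSlice {g : ℝ → ℂ} (hg : ContDiff ℝ ∞ g) (hp : Function.Periodic g (2 * π)) :
    IsMode ξ (ofSlice ξ g hg hp) := by
  have h (a b : SmoothTorus (N + 1)) : mul a b = mul b a :=
    DFunLike.ext _ _ fun y => mul_comm _ _
  rw [ofSlice, h]
  refine isMode_mul (fun j => D_succ_eq_zero fun y s => ?_) (isMode_expo 0 ξ)
  change g _ = g _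
  simp

/-- The term of index `ξ` of the partial Fourier series of `f` in `x`. -/
theorem exists_modeProj (ξ : Fin N → ℤ) (f : SmoothTorus (N + 1)) : ∃ G : SmoothTorus (N + 1),
    ∀ η, coef η G = if Fin.tail η = ξ then coef η f else 0 := by
  refine exists_coef_eq fun M => ?_
  obtain ⟨C, hC⟩ := exists_pow_mul_norm_coef_le M f
  refine ⟨C, fun η => le_trans ?_ (hC η)⟩
  have hw : 0 ≤ (1 + latticeNorm η) ^ M :=
    pow_nonneg (zero_le_one.trans (one_le_one_add_latticeNorm η)) _
  refine mul_le_mul_of_nonneg_left ?_ hw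
  split_ifs <;> simp

/-- The projection onto the term of index `ξ` of the partial Fourier series in `x`. -/
noncomputable def modeProj (ξ : Fin N → ℤ) : SmoothTorus (N + 1) →ₗ[ℂ] SmoothTorus (N + 1) where
  toFun f := (exists_modeProj ξ f).choose
  map_add' f g := ext_coef fun η => by
    rw [map_add, (exists_modeProj ξ f).choose_spec, (exists_modeProj ξ g).choose_spec,
      (exists_modeProj ξ (f + g)).choose_spec, map_add]
    split_ifs <;> simp
  map_smul' a f := ext_coef fun η => by
    rw [RingHom.id_apply, map_smul, (exists_modeProj ξ f).choose_spec,
      (exists_modeProj ξ (a • f)).choose_spec, map_smul]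
    split_ifs <;> simp

theorem coef_modeProj (η : Fin (N + 1) → ℤ) (ξ : Fin N → ℤ) (f : SmoothTorus (N + 1)) :
    coef η (modeProj ξ f) = if Fin.tail η = ξ then coef η f else 0 :=
  (exists_modeProj ξ f).choose_spec η

theorem isMode_modeProj (ξ : Fin N → ℤ) (f : SmoothTorus (N + 1)) : IsMode ξ (modeProj ξ f) :=
  isMode_iff_coef.2 fun η hη => by rw [coef_modeProj, if_neg hη]

theorem modeProj_D (ξ : Fin N → ℤ) (i : Fin (N + 1)) (f : SmoothTorus (N + 1)) :
    modeProj ξ (SmoothTorus.D i f) = SmoothTorus.D i (modeProj ξ f) := ext_coef fun η => by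
  simp only [coef_modeProj, coef_D, mul_ite, mul_zero]

theorem IsMode.modeProj_eq (hG : IsMode ξ G) : modeProj ξ G = G := ext_coef fun η => by
  rw [coef_modeProj, ite_eq_left_iff]
  exact fun h => (hG.coef_eq_zero h).symm

/-- The estimate of the terms of the partial Fourier series of `f`, uniform in `f`. -/
theorem exists_pow_mul_derivSeminorm_modeProj_le (N k M : ℕ) :
    ∃ C l, 0 ≤ C ∧ ∀ (f : SmoothTorus (N + 1)) (ξ : Fin N → ℤ),
      (1 + latticeNorm ξ) ^ M * derivSeminorm (N + 1) k (modeProj ξ f) ≤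
        C * ∑ i ∈ Finset.range l, derivSeminorm (N + 1) i f := by
  -- The exponent splits into `M` for the weight, `k` for the derivatives of the exponential and
  -- `2(N + 1)` for summability in dimension `N + 1`.
  obtain ⟨C, hC0, hC⟩ := exists_pow_mul_norm_coef_le_sum (N + 1) (M + k + 2 * (N + 1))
  have hs := summable_inv_one_add_latticeNorm_pow (N + 1)
  refine ⟨∑' η : Fin (N + 1) → ℤ, ((N + 1 : ℕ) : ℝ) ^ k * C *
    ((1 + latticeNorm η) ^ (2 * (N + 1)))⁻¹, M + k + 2 * (N + 1) + 1, tsum_nonneg fun η => ?_, fun f ξ => ?_⟩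
  · have := latticeNorm_nonneg η
    positivity
  set S := ∑ i ∈ Finset.range (M + k + 2 * (N + 1) + 1), derivSeminorm (N + 1) i f with hS
  have hS0 : 0 ≤ S := Finset.sum_nonneg fun _ _ => apply_nonneg _ _
  have hw0 : 0 < 1 + latticeNorm ξ := zero_lt_one.trans_le (one_le_one_add_latticeNorm ξ)
  have hb (η : Fin (N + 1) → ℤ) : (1 + latticeNorm ξ) ^ M *
      derivSeminorm (N + 1) k (coef η (modeProj ξ f) • expo η) ≤
      (((N + 1 : ℕ) : ℝ) ^ k * C * ((1 + latticeNorm η) ^ (2 * (N + 1)))⁻¹) * S := by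
    have hη : 0 < 1 + latticeNorm η := zero_lt_one.trans_le (one_le_one_add_latticeNorm η)
    rw [coef_modeProj]
    split_ifs with h
    · have hw : 1 + latticeNorm ξ ≤ 1 + latticeNorm η := by
        rw [← h, add_le_add_iff_left, ← Fin.cons_self_tail η, Fin.tail_cons]
        exact latticeNorm_le_latticeNorm_cons _ _
      rw [map_smul_eq_mul]
      calc (1 + latticeNorm ξ) ^ M * (‖coef η f‖ * derivSeminorm (N + 1) k (expo η))
          ≤ (1 + latticeNorm η) ^ M *
            (‖coef η f‖ * ((N + 1 : ℕ) * (1 + latticeNorm η)) ^ k) := by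
            gcongr
            exact derivSeminorm_expo_le k η
        _ = ((N + 1 : ℕ) : ℝ) ^ k * ((1 + latticeNorm η) ^ (2 * (N + 1)))⁻¹ *
            ((1 + latticeNorm η) ^ (M + k + 2 * (N + 1)) * ‖coef η f‖) := by
            rw [mul_pow, pow_add, pow_add]
            field_simp
        _ ≤ ((N + 1 : ℕ) : ℝ) ^ k * ((1 + latticeNorm η) ^ (2 * (N + 1)))⁻¹ * (C * S) := by
            refine mul_le_mul_of_nonneg_left (hC f η) ?_
            positivity
        _ = _ := by ring
    · rw [zero_smul, map_zero, mul_zero]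
      positivity
  have hsum := summable_derivSeminorm_smul_expo
    (fun M => exists_pow_mul_norm_coef_le M (modeProj ξ f)) k
  have h1 := derivSeminorm_le_tsum (hasSum_coef_smul_expo (modeProj ξ f)) hsum
  refine (mul_le_mul_of_nonneg_left h1 (pow_nonneg hw0.le M)).trans ?_
  rw [← tsum_mul_left, ← tsum_mul_right]
  exact (hsum.mul_left _).tsum_le_tsum hb ((hs.mul_left _).mul_right _)

theorem exists_pow_mul_derivSeminorm_modeProj (k M : ℕ) (f : SmoothTorus (N + 1)) :
    ∃ C, ∀ ξ : Fin N → ℤ,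
      (1 + latticeNorm ξ) ^ M * derivSeminorm (N + 1) k (modeProj ξ f) ≤ C := by
  obtain ⟨C, l, -, h⟩ := exists_pow_mul_derivSeminorm_modeProj_le N k M
  exact ⟨_, h f⟩

end SmoothTorus

/-! ### Rapid decrease along families of frequencies. -/

/-- Rapid decrease of `a i` with respect to the lattice points `ξ i`. -/
def RapidlyDecreasing {ι : Type*} {N : ℕ} (ξ : ι → Fin N → ℤ) (a : ι → ℝ) : Prop :=
  ∀ M : ℕ, ∃ C, ∀ i, (1 + latticeNorm (ξ i)) ^ M * a i ≤ C

namespace RapidlyDecreasing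

variable {ι : Type*} {N : ℕ} {ξ : ι → Fin N → ℤ} {a b : ι → ℝ}

theorem mono (ha : RapidlyDecreasing ξ a) (h : ∀ i, b i ≤ a i) : RapidlyDecreasing ξ b := by
  intro M
  obtain ⟨C, hC⟩ := ha M
  exact ⟨C, fun i => (mul_le_mul_of_nonneg_left (h i)
    (pow_nonneg (zero_le_one.trans (one_le_one_add_latticeNorm _)) _)).trans (hC i)⟩

theorem add (ha : RapidlyDecreasing ξ a) (hb : RapidlyDecreasing ξ b) :
    RapidlyDecreasing ξ fun i => a i + b i := by
  intro M
  obtain ⟨C, hC⟩ := ha M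
  obtain ⟨C', hC'⟩ := hb M
  exact ⟨C + C', fun i => by rw [mul_add]; exact add_le_add (hC i) (hC' i)⟩

theorem sum {κ : Type*} {s : Finset κ} {a : κ → ι → ℝ}
    (ha : ∀ j ∈ s, RapidlyDecreasing ξ (a j)) : RapidlyDecreasing ξ fun i => ∑ j ∈ s, a j i := by
  classical
  induction s using Finset.induction_on with
  | empty => exact fun M => ⟨0, fun i => by simp⟩
  | insert j s hj ih =>
    simp only [Finset.sum_insert hj]
    exact (ha j (Finset.mem_insert_self _ _)).add
      (ih fun i hi => ha i (Finset.mem_insert_of_mem hi))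

theorem pow_mul (ha : RapidlyDecreasing ξ a) {A : ℝ} (hA : 0 ≤ A) (p : ℕ) :
    RapidlyDecreasing ξ fun i => A * (1 + latticeNorm (ξ i)) ^ p * a i := by
  intro M
  obtain ⟨C, hC⟩ := ha (M + p)
  refine ⟨A * C, fun i => ?_⟩
  have := mul_le_mul_of_nonneg_left (hC i) hA
  rw [pow_add] at this
  linarith

theorem summable (ha : RapidlyDecreasing ξ a) (ha0 : ∀ i, 0 ≤ a i) (hξ : Function.Injective ξ) :
    Summable a := by
  obtain ⟨C, hC⟩ := ha (2 * N)
  refine Summable.of_nonneg_of_le ha0 (fun i => ?_)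
    (((summable_inv_one_add_latticeNorm_pow N).comp_injective hξ).mul_left C)
  have hw : 0 < (1 + latticeNorm (ξ i)) ^ (2 * N) :=
    pow_pos (zero_lt_one.trans_le (one_le_one_add_latticeNorm _)) _
  rw [Function.comp_apply, ← div_eq_mul_inv, le_div_iff₀ hw, mul_comm]
  exact hC i

end RapidlyDecreasing

/-! ### Tube type operators acting on modes -/

section TubeModes

open SmoothTorus

variable {N m : ℕ} {c : SmoothTorus (N + 1) →L[ℂ] SmoothTorus (N + 1)}

theorem discreteSymbol_eq (c : SmoothTorus (N + 1) →L[ℂ] SmoothTorus (N + 1))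
    (y : Fin (N + 1) → ℝ) (η : Fin (N + 1) → ℤ) :
    discreteSymbol c y η = expo (-η) y * c (expo η) y := by
  rw [discreteSymbol, expo_apply]
  congr 2
  simp

theorem expo_neg_mul_expo {n : ℕ} (η : Fin n → ℤ) (y : Fin n → ℝ) :
    expo (-η) y * expo η y = 1 := by
  rw [expo_apply, expo_apply, ← Complex.exp_add, ← mul_add, ← Complex.ofReal_add,
    ← Finset.sum_add_distrib]
  simp

theorem IsTubeType.discreteSymbol_eq_tubeSymbol (h : IsTubeType c) (y : Fin (N + 1) → ℝ)
    (η : Fin (N + 1) → ℤ) : discreteSymbol c y η = tubeSymbol c (y 0) (Fin.tail η) := by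
  rw [tubeSymbol, ← h (y 0) (Fin.tail y) 0 (η 0) 0 (Fin.tail η), Fin.cons_self_tail,
    Fin.cons_self_tail]

/-- The symbol `(t, x) ↦ c(t, ξ)`, as a smooth function on the torus. -/
noncomputable def symbolFun (c : SmoothTorus (N + 1) →L[ℂ] SmoothTorus (N + 1))
    (ξ : Fin N → ℤ) : SmoothTorus (N + 1) :=
  mul (expo (-Fin.cons 0 ξ)) (c (expo (Fin.cons 0 ξ)))

theorem IsTubeType.symbolFun_apply (h : IsTubeType c) (ξ : Fin N → ℤ) (y : Fin (N + 1) → ℝ) :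
    symbolFun c ξ y = tubeSymbol c (y 0) ξ := by
  rw [symbolFun, mul_apply, ← discreteSymbol_eq, h.discreteSymbol_eq_tubeSymbol, Fin.tail_cons]

theorem slice_symbolFun (c : SmoothTorus (N + 1) →L[ℂ] SmoothTorus (N + 1)) (ξ : Fin N → ℤ) :
    slice (symbolFun c ξ) = fun t => tubeSymbol c t ξ := by
  funext t
  rw [slice, symbolFun, mul_apply, ← discreteSymbol_eq, tubeSymbol]

theorem contDiff_tubeSymbol (c : SmoothTorus (N + 1) →L[ℂ] SmoothTorus (N + 1)) (ξ : Fin N → ℤ) :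
    ContDiff ℝ ∞ fun t => tubeSymbol c t ξ :=
  slice_symbolFun c ξ ▸ contDiff_slice _

theorem periodic_tubeSymbol (c : SmoothTorus (N + 1) →L[ℂ] SmoothTorus (N + 1)) (ξ : Fin N → ℤ) :
    Function.Periodic (fun t => tubeSymbol c t ξ) (2 * π) :=
  slice_symbolFun c ξ ▸ periodic_slice _

theorem IsTubeType.D_succ_symbolFun (h : IsTubeType c) (ξ : Fin N → ℤ) (j : Fin N) :
    D j.succ (symbolFun c ξ) = 0 :=
  D_succ_eq_zero fun y s => by
    rw [h.symbolFun_apply, h.symbolFun_apply]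
    simp

theorem HasOrder.exists_derivSeminorm_symbolFun_le (hord : HasOrder c (m : ℝ)) (k : ℕ) :
    ∃ C, 0 ≤ C ∧ ∀ ξ, derivSeminorm (N + 1) k (symbolFun c ξ) ≤ C * (1 + latticeNorm ξ) ^ m := by
  obtain ⟨C, hC, h⟩ := hord k
  refine ⟨C, hC.le, fun ξ => derivSeminorm_le fun y => ?_⟩
  have h1 := h y (Fin.cons 0 ξ)
  rw [latticeNorm_cons_zero, Real.rpow_natCast] at h1
  have h2 : (fun z => discreteSymbol c z (Fin.cons 0 ξ)) = symbolFun c ξ :=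
    funext fun z => discreteSymbol_eq c z _
  rwa [h2] at h1

theorem IsTubeType.map_expo (h : IsTubeType c) (η : Fin (N + 1) → ℤ) :
    c (expo η) = mul (symbolFun c (Fin.tail η)) (expo η) := by
  refine DFunLike.ext _ _ fun y => ?_
  rw [mul_apply, h.symbolFun_apply, ← h.discreteSymbol_eq_tubeSymbol, discreteSymbol_eq,
    mul_right_comm, expo_neg_mul_expo, one_mul]

/-- By continuity `c` acts term by term on the Fourier series of `G`. All its frequencies share the
same `ξ`, and the symbol does not see `τ`, so every term is multiplied by the same function. -/
theorem IsTubeType.map_mode (h : IsTubeType c) {ξ : Fin N → ℤ} {G : SmoothTorus (N + 1)}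
    (hG : IsMode ξ G) : c G = mul (symbolFun c ξ) G := by
  refine DFunLike.ext _ _ fun y => ?_
  have h1 := (c.hasSum (hasSum_coef_smul_expo G)).map (evalₗ y) (continuous_eval y)
  refine h1.unique ?_
  rw [mul_apply]
  convert! (hasSum_coef_mul_expo_apply G y).mul_left (symbolFun c ξ y) using 2 with η
  simp only [Function.comp_apply, evalₗ_apply, map_smul, h.map_expo, mul_apply, smul_eq_mul]
  by_cases hη : Fin.tail η = ξ
  · rw [hη]
    ring
  · rw [hG.coef_eq_zero hη, zero_mul, zero_mul, mul_zero]

theorem IsTubeType.isMode_map (h : IsTubeType c) {ξ : Fin N → ℤ} {G : SmoothTorus (N + 1)}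
    (hG : IsMode ξ G) : IsMode ξ (c G) := by
  rw [h.map_mode hG]
  exact isMode_mul (h.D_succ_symbolFun ξ) hG

/-- The operator `c` sends the exponential of frequency `η'` to a mode with the same spatial
frequency, so the coefficient of `c f` at `η` involves only the `η'` with the same tail. Truncation
before and after `c` therefore has the same effect. -/
theorem IsTubeType.modeProj_map (h : IsTubeType c) (ξ : Fin N → ℤ) (f : SmoothTorus (N + 1)) :
    modeProj ξ (c f) = c (modeProj ξ f) := by
  have key (g : SmoothTorus (N + 1)) (η : Fin (N + 1) → ℤ) :
      HasSum (fun η' => coef η' g * coef η (c (expo η'))) (coef η (c g)) := by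
    have := (c.hasSum (hasSum_coef_smul_expo g)).map (coef η) (continuous_coef η)
    simpa [Function.comp_def] using this
  refine ext_coef fun η => ?_
  refine HasSum.unique ?_ (key (modeProj ξ f) η)
  rw [coef_modeProj]
  split_ifs with hη
  · convert! key f η using 2 with η'
    rw [coef_modeProj]
    split_ifs with hη'
    · rfl
    · rw [(h.isMode_map (isMode_expo_tail η')).coef_eq_zero (fun h' => hη' (h' ▸ hη)), mul_zero,
        mul_zero]
  · convert! hasSum_zero using 2 with η'
    rw [coef_modeProj]
    split_ifs with hη'
    · rw [(h.isMode_map (isMode_expo_tail η')).coef_eq_zero (fun h' => hη (h'.trans hη')), mul_zero]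
    · rw [zero_mul]

theorem tubeOperator_apply (c : SmoothTorus (N + 1) →L[ℂ] SmoothTorus (N + 1))
    (f : SmoothTorus (N + 1)) : tubeOperator c f = D 0 f + c f := rfl

theorem IsTubeType.modeProj_tubeOperator (h : IsTubeType c) (ξ : Fin N → ℤ)
    (f : SmoothTorus (N + 1)) :
    modeProj ξ (tubeOperator c f) = tubeOperator c (modeProj ξ f) := by
  rw [tubeOperator_apply, tubeOperator_apply, map_add, modeProj_D, h.modeProj_map]

theorem IsTubeType.isMode_tubeOperator (h : IsTubeType c) {ξ : Fin N → ℤ}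
    {G : SmoothTorus (N + 1)} (hG : IsMode ξ G) : IsMode ξ (tubeOperator c G) :=
  (hG.D 0).add (h.isMode_map hG)

theorem IsTubeType.slice_tubeOperator (h : IsTubeType c) {ξ : Fin N → ℤ}
    {G : SmoothTorus (N + 1)} (hG : IsMode ξ G) (t : ℝ) :
    slice (tubeOperator c G) t = slice (D 0 G) t + tubeSymbol c t ξ * slice G t := by
  rw [tubeOperator_apply, h.map_mode hG, ← congrFun (slice_symbolFun c ξ) t]
  rfl

/-- On modes, the operator `P` is an ordinary differential operator in `t`. -/
theorem IsTubeType.hasDerivAt_slice (h : IsTubeType c) {ξ : Fin N → ℤ}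
    {G : SmoothTorus (N + 1)} (hG : IsMode ξ G) (t : ℝ) :
    HasDerivAt (slice G)
      (Complex.I * (slice (tubeOperator c G) t - tubeSymbol c t ξ * slice G t)) t := by
  rw [h.slice_tubeOperator hG, add_sub_cancel_right]
  exact SmoothTorus.hasDerivAt_slice G t

theorem IsTubeType.slice_tubeOperator_ofSlice (h : IsTubeType c) {ξ : Fin N → ℤ} {g : ℝ → ℂ}
    (hg : ContDiff ℝ ∞ g) (hp : Function.Periodic g (2 * π)) {g' : ℂ} {t : ℝ}
    (hd : HasDerivAt g g' t) :
    slice (tubeOperator c (ofSlice ξ g hg hp)) t = -Complex.I * g' + tubeSymbol c t ξ * g t := by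
  have h1 := h.hasDerivAt_slice (isMode_ofSlice (ξ := ξ) hg hp) t
  rw [slice_ofSlice] at h1
  rw [hd.unique h1]
  linear_combination ((slice (tubeOperator c (ofSlice ξ g hg hp)) t - tubeSymbol c t ξ * g t)) *
    Complex.I_sq

/-- The derivatives of order `k + 1` of a mode are controlled by those of lower order and by
the image under `P`. -/
theorem IsTubeType.exists_derivSeminorm_succ_le (h : IsTubeType c) (hord : HasOrder c (m : ℝ))
    (k : ℕ) : ∃ A, 0 ≤ A ∧ ∀ (ξ : Fin N → ℤ) (G : SmoothTorus (N + 1)), IsMode ξ G →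
      derivSeminorm (N + 1) (k + 1) G ≤ derivSeminorm (N + 1) k (tubeOperator c G) +
        ∑ l ∈ Finset.range (k + 1), A * (1 + latticeNorm ξ) ^ (m + 1) *
          derivSeminorm (N + 1) l G := by
  choose C hC0 hC using hord.exists_derivSeminorm_symbolFun_le
  refine ⟨∑ i ∈ Finset.range (k + 1), (k.choose i : ℝ) * C i + N, ?_, fun ξ G hG => ?_⟩
  · exact add_nonneg (Finset.sum_nonneg fun i _ => mul_nonneg (Nat.cast_nonneg _) (hC0 i))
      (Nat.cast_nonneg _)
  set w := 1 + latticeNorm ξ with hw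
  have hw1 : 1 ≤ w := one_le_one_add_latticeNorm ξ
  have hw0 : 0 ≤ w := zero_le_one.trans hw1
  set S := ∑ l ∈ Finset.range (k + 1), derivSeminorm (N + 1) l G with hS
  have hle (l : ℕ) (hl : l ≤ k) : derivSeminorm (N + 1) l G ≤ S :=
    Finset.single_le_sum (f := fun l => derivSeminorm (N + 1) l G)
      (fun _ _ => apply_nonneg _ _) (Finset.mem_range.2 (Nat.lt_succ_of_le hl))
  have hS0 : 0 ≤ S := (apply_nonneg _ _).trans (hle k le_rfl)
  -- The power `m + 1` dominates both losses: `w ^ m` from the order of the symbol and `w` from the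
  -- derivatives in `x`.
  have hpow : w ^ m ≤ w ^ (m + 1) := pow_le_pow_right₀ hw1 (Nat.le_succ m)
  have hpow1 : w ≤ w ^ (m + 1) := le_self_pow₀ hw1 (Nat.succ_ne_zero m)
  have hc : derivSeminorm (N + 1) k (c G) ≤
      (∑ i ∈ Finset.range (k + 1), (k.choose i : ℝ) * C i) * w ^ (m + 1) * S := by
    rw [h.map_mode hG, Finset.sum_mul, Finset.sum_mul]
    refine (derivSeminorm_mul_le k _ _).trans (Finset.sum_le_sum fun i _ => ?_)
    rw [mul_assoc (k.choose i : ℝ) (C i)]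
    have h1 := (hC i ξ).trans (mul_le_mul_of_nonneg_left hpow (hC0 i))
    have h2 := hle (k - i) (Nat.sub_le k i)
    have h3 : 0 ≤ C i * w ^ (m + 1) := mul_nonneg (hC0 i) (pow_nonneg hw0 _)
    exact mul_le_mul (mul_le_mul_of_nonneg_left h1 (Nat.cast_nonneg _)) h2 (apply_nonneg _ _)
      (mul_nonneg (Nat.cast_nonneg _) h3)
  have hx : ∑ j : Fin N, derivSeminorm (N + 1) k (D j.succ G) ≤ N * w ^ (m + 1) * S := by
    have (j : Fin N) : derivSeminorm (N + 1) k (D j.succ G) ≤ w ^ (m + 1) * S := by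
      rw [hG j, map_smul_eq_mul, Complex.norm_intCast]
      refine mul_le_mul (le_trans ?_ hpow1) (hle k le_rfl) (apply_nonneg _ _) (pow_nonneg hw0 _)
      linarith [abs_le_latticeNorm ξ j]
    refine (Finset.sum_le_sum fun j _ => this j).trans (le_of_eq ?_)
    simp [mul_assoc]
  -- The equation trades the derivative in `t` for `P G` and a term without additional derivatives.
  have ht : derivSeminorm (N + 1) k (D 0 G) ≤
      derivSeminorm (N + 1) k (tubeOperator c G) + derivSeminorm (N + 1) k (c G) := by
    have : D 0 G = tubeOperator c G - c G := by rw [tubeOperator_apply, add_sub_cancel_right]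
    rw [this]
    exact map_sub_le_add _ _ _
  refine (derivSeminorm_succ_le k G).trans ?_
  rw [Fin.sum_univ_succ, ← Finset.mul_sum, add_mul, add_mul]
  linarith

variable {ι : Type*} {ξ : ι → Fin N → ℤ} {U : ι → SmoothTorus (N + 1)}

theorem IsTubeType.rapidlyDecreasing_succ (h : IsTubeType c) (hord : HasOrder c (m : ℝ))
    (hU : ∀ i, IsMode (ξ i) (U i)) {k : ℕ}
    (h1 : ∀ l ≤ k, RapidlyDecreasing ξ fun i => derivSeminorm (N + 1) l (U i))
    (h2 : RapidlyDecreasing ξ fun i => derivSeminorm (N + 1) k (tubeOperator c (U i))) :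
    RapidlyDecreasing ξ fun i => derivSeminorm (N + 1) (k + 1) (U i) := by
  obtain ⟨A, hA0, hA⟩ := h.exists_derivSeminorm_succ_le hord k
  refine RapidlyDecreasing.mono (h2.add (RapidlyDecreasing.sum (s := Finset.range (k + 1))
    fun l hl => (h1 l (Nat.lt_succ_iff.1 (Finset.mem_range.1 hl))).pow_mul hA0 (m + 1)))
    fun i => hA (ξ i) (U i) (hU i)

/-- Regularity: a family of modes decreases rapidly with all derivatives if it does so uniformly
and its image under `P` does so up to multiples of the family itself. -/
theorem IsTubeType.rapidlyDecreasing_derivSeminorm (h : IsTubeType c) (hord : HasOrder c (m : ℝ))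
    (hU : ∀ i, IsMode (ξ i) (U i))
    (h0 : RapidlyDecreasing ξ fun i => derivSeminorm (N + 1) 0 (U i))
    (hP : ∀ k, RapidlyDecreasing ξ (fun i => derivSeminorm (N + 1) k (U i)) →
      RapidlyDecreasing ξ fun i => derivSeminorm (N + 1) k (tubeOperator c (U i))) (k : ℕ) :
    RapidlyDecreasing ξ fun i => derivSeminorm (N + 1) k (U i) := by
  induction k using Nat.strong_induction_on with
  | _ k ih =>
    cases k with
    | zero => exact h0
    | succ k =>
      exact h.rapidlyDecreasing_succ hord hU (fun l hl => ih l (Nat.lt_succ_of_le hl))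
        (hP k (ih k (Nat.lt_succ_self k)))

theorem exists_hasSum_of_rapidlyDecreasing (hξ : Function.Injective ξ)
    (hU : ∀ k, RapidlyDecreasing ξ fun i => derivSeminorm (N + 1) k (U i)) :
    ∃ u, HasSum U u :=
  exists_hasSum U fun k => (hU k).summable (fun _ => apply_nonneg _ _) hξ

theorem modeProj_of_hasSum {u : SmoothTorus (N + 1)} (hξ : Function.Injective ξ)
    (hU : ∀ i, IsMode (ξ i) (U i)) (hu : HasSum U u) (i : ι) : modeProj (ξ i) u = U i := by
  refine ext_coef fun η => ?_
  have h1 := hu.map (coef η) (continuous_coef η)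
  rw [coef_modeProj]
  split_ifs with hη
  · refine h1.unique (hasSum_single i fun i' hi' => (hU i').coef_eq_zero fun h' => hi' ?_)
    exact hξ (h'.symm.trans hη)
  · exact ((hU i).coef_eq_zero hη).symm

theorem eq_of_modeProj_eq {f g : SmoothTorus (N + 1)} (h : ∀ ξ, modeProj ξ f = modeProj ξ g) :
    f = g :=
  ext_coef fun η => by
    have := congrArg (coef η) (h (Fin.tail η))
    simpa only [coef_modeProj, if_true] using this

end TubeModes

/-! ### Periodic first order equations on the line -/

section PeriodicODE

theorem hasDerivAt_integral_zero {c : ℝ → ℂ} (hc : Continuous c) (t : ℝ) :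
    HasDerivAt (fun t => ∫ s in (0 : ℝ)..t, c s) (c t) t :=
  intervalIntegral.integral_hasDerivAt_right (hc.intervalIntegrable _ _)
    (hc.stronglyMeasurableAtFilter _ _) hc.continuousAt

theorem contDiff_integral_zero {c : ℝ → ℂ} (hc : ContDiff ℝ ∞ c) :
    ContDiff ℝ ∞ fun t => ∫ s in (0 : ℝ)..t, c s := by
  rw [contDiff_infty_iff_deriv]
  have h := hasDerivAt_integral_zero hc.continuous
  refine ⟨fun t => (h t).differentiableAt, ?_⟩
  rwa [show deriv (fun t => ∫ s in (0 : ℝ)..t, c s) = c from funext fun t => (h t).deriv]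

theorem integral_zero_add_period {c : ℝ → ℂ} (hc : Continuous c) {T : ℝ}
    (hp : Function.Periodic c T) (t : ℝ) :
    ∫ s in (0 : ℝ)..(t + T), c s = (∫ s in (0 : ℝ)..t, c s) + ∫ s in (0 : ℝ)..T, c s := by
  rw [hp.intervalIntegral_add_eq_add 0 t fun _ _ => hc.intervalIntegrable _ _, zero_add]

variable {c : ℝ → ℂ} {T : ℝ} {C : ℝ → ℂ}

theorem norm_exp_I_mul (z : ℂ) : ‖Complex.exp (Complex.I * z)‖ = Real.exp (-z.im) := by
  rw [Complex.norm_exp]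
  simp

/-- Solutions of `-i u' + c u = g` in terms of a primitive `C` of `c`. -/
theorem hasDerivAt_exp_mul_of_ode {u : ℝ → ℂ} {g : ℂ} {t : ℝ} (hC : HasDerivAt C (c t) t)
    (hu : HasDerivAt u (Complex.I * (g - c t * u t)) t) :
    HasDerivAt (fun t => Complex.exp (Complex.I * C t) * u t)
      (Complex.I * (Complex.exp (Complex.I * C t) * g)) t := by
  have h := (hC.const_mul Complex.I).cexp.mul hu
  convert! h using 1
  ring

theorem exp_mul_sub_exp_mul_of_ode {u g : ℝ → ℂ} (hC : ∀ t, HasDerivAt C (c t) t)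
    (hg : Continuous g) (hu : ∀ t, HasDerivAt u (Complex.I * (g t - c t * u t)) t) (s t : ℝ) :
    Complex.exp (Complex.I * C t) * u t - Complex.exp (Complex.I * C s) * u s =
      ∫ r in s..t, Complex.I * (Complex.exp (Complex.I * C r) * g r) := by
  have hCc : Continuous C := continuous_iff_continuousAt.2 fun t => (hC t).continuousAt
  exact (intervalIntegral.integral_eq_sub_of_hasDerivAt
    (fun r _ => hasDerivAt_exp_mul_of_ode (hC r) (hu r))
    (Continuous.intervalIntegrable (by fun_prop) _ _)).symm

theorem eq_exp_mul_of_homogeneous_ode {w : ℝ → ℂ} (hC : ∀ t, HasDerivAt C (c t) t)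
    (hw : ∀ t, HasDerivAt w (Complex.I * (0 - c t * w t)) t) (s t : ℝ) :
    Complex.exp (Complex.I * C t) * w t = Complex.exp (Complex.I * C s) * w s := by
  have := exp_mul_sub_exp_mul_of_ode hC (g := fun _ => 0) continuous_const hw s t
  simpa [sub_eq_zero] using this

/-- Since `|e^{iC(r)}| = e^{-Im C(r)}`, the integrating factor along the path is at most its value
at the endpoint `t`. That common factor is cancelled in the applications, leaving bounds independent
of the size of `C`. -/
theorem norm_exp_mul_sub_exp_mul_le {u g : ℝ → ℂ} (hC : ∀ t, HasDerivAt C (c t) t)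
    (hg : Continuous g) (hu : ∀ t, HasDerivAt u (Complex.I * (g t - c t * u t)) t) {s t K L : ℝ}
    (hK : ∀ r, ‖g r‖ ≤ K) (hL : |t - s| ≤ L) (hB : ∀ r ∈ uIcc s t, (C t).im ≤ (C r).im) :
    ‖Complex.exp (Complex.I * C t) * u t - Complex.exp (Complex.I * C s) * u s‖ ≤
      ‖Complex.exp (Complex.I * C t)‖ * (L * K) := by
  have hK0 : 0 ≤ K := (norm_nonneg _).trans (hK 0)
  rw [exp_mul_sub_exp_mul_of_ode hC hg hu]
  refine (intervalIntegral.norm_integral_le_of_norm_le_const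
    (C := ‖Complex.exp (Complex.I * C t)‖ * K) fun r hr => ?_).trans ?_
  · rw [norm_mul, Complex.norm_I, one_mul, norm_mul]
    refine mul_le_mul ?_ (hK r) (norm_nonneg _) (norm_nonneg _)
    rw [norm_exp_I_mul, norm_exp_I_mul]
    exact Real.exp_le_exp.2 (neg_le_neg (hB r (uIoc_subset_uIcc hr)))
  · rw [mul_comm L, ← mul_assoc]
    gcongr

/-- The bound for periodic solutions when the imaginary part of the primitive decreases. -/
theorem norm_mul_norm_le_of_antitone {u g : ℝ → ℂ} (hC : ∀ t, HasDerivAt C (c t) t) {ϖ : ℂ}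
    (hCT : ∀ t, C (t + T) = C t + ϖ) (hT : 0 ≤ T) (hg : Continuous g)
    (hu : ∀ t, HasDerivAt u (Complex.I * (g t - c t * u t)) t) (hp : Function.Periodic u T) {K : ℝ}
    (hK : ∀ r, ‖g r‖ ≤ K) (hB : Antitone fun t => (C t).im) (t : ℝ) :
    ‖1 - Complex.exp (Complex.I * -ϖ)‖ * ‖u t‖ ≤ T * K := by
  have h := norm_exp_mul_sub_exp_mul_le hC hg hu (s := t - T) (t := t) (L := T) hK
    (by rw [sub_sub_cancel, abs_of_nonneg hT]) fun r hr => hB (by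
      rw [uIcc_of_le (by linarith)] at hr
      exact hr.2)
  have h1 := hCT (t - T)
  rw [sub_add_cancel] at h1
  have h2 := hp (t - T)
  rw [sub_add_cancel] at h2
  have h3 : Complex.exp (Complex.I * C t) * u t - Complex.exp (Complex.I * C (t - T)) * u (t - T) =
      Complex.exp (Complex.I * C t) * ((1 - Complex.exp (Complex.I * -ϖ)) * u t) := by
    rw [show C (t - T) = C t + -ϖ by rw [h1]; ring, mul_add, Complex.exp_add, h2]
    ring
  rw [h3, norm_mul, norm_mul] at h
  exact le_of_mul_le_mul_left h (norm_pos_iff.2 (Complex.exp_ne_zero _))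

/-- The imaginary part of `C` is now at least its value at `t` on the period to the right of `t`, so
the integration runs backwards from `t + T`; this changes the sign of `ϖ`. -/
theorem norm_mul_norm_le_of_monotone {u g : ℝ → ℂ} (hC : ∀ t, HasDerivAt C (c t) t) {ϖ : ℂ}
    (hCT : ∀ t, C (t + T) = C t + ϖ) (hT : 0 ≤ T) (hg : Continuous g)
    (hu : ∀ t, HasDerivAt u (Complex.I * (g t - c t * u t)) t) (hp : Function.Periodic u T) {K : ℝ}
    (hK : ∀ r, ‖g r‖ ≤ K) (hB : Monotone fun t => (C t).im) (t : ℝ) :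
    ‖1 - Complex.exp (Complex.I * ϖ)‖ * ‖u t‖ ≤ T * K := by
  have h := norm_exp_mul_sub_exp_mul_le hC hg hu (s := t + T) (t := t) (L := T) hK
    (by rw [sub_add_cancel_left, abs_neg, abs_of_nonneg hT]) fun r hr => hB (by
      rw [uIcc_of_ge (by linarith)] at hr
      exact hr.1)
  have h3 : Complex.exp (Complex.I * C t) * u t - Complex.exp (Complex.I * C (t + T)) * u (t + T) =
      Complex.exp (Complex.I * C t) * ((1 - Complex.exp (Complex.I * ϖ)) * u t) := by
    rw [hCT, mul_add, Complex.exp_add, hp]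
    ring
  rw [h3, norm_mul, norm_mul] at h
  exact le_of_mul_le_mul_left h (norm_pos_iff.2 (Complex.exp_ne_zero _))

/-- The bound for periodic solutions that vanish at a point from which every other point can be
reached along an arc on which the imaginary part of the primitive is at least its value there. -/
theorem norm_le_of_arc {u g : ℝ → ℂ} (hC : ∀ t, HasDerivAt C (c t) t)
    (hT : 0 < T) (hg : Continuous g)
    (hu : ∀ t, HasDerivAt u (Complex.I * (g t - c t * u t)) t) (hp : Function.Periodic u T) {K : ℝ}
    (hK : ∀ r, ‖g r‖ ≤ K) {t₀ : ℝ} (h0 : u t₀ = 0)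
    (hB : ∀ t ∈ Icc t₀ (t₀ + T), (∀ r ∈ Icc t₀ t, (C t).im ≤ (C r).im) ∨
      ∀ r ∈ Icc t (t₀ + T), (C t).im ≤ (C r).im) (t : ℝ) : ‖u t‖ ≤ T * K := by
  wlog ht : t ∈ Icc t₀ (t₀ + T) generalizing t
  · have h1 := this (toIcoMod hT t₀ t) (Ico_subset_Icc_self (toIcoMod_mem_Ico hT t₀ t))
    have h2 : u (toIcoMod hT t₀ t) = u t := by
      rw [toIcoMod, hp.sub_zsmul_eq]
    rwa [h2] at h1
  -- The starting point `s` is `t₀` or its translate `t₀ + T`, according to the arc along which `t`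
  -- is reached; `u` vanishes at both.
  have key (s : ℝ) (hs : u s = 0) (hst : |t - s| ≤ T)
      (hBs : ∀ r ∈ uIcc s t, (C t).im ≤ (C r).im) : ‖u t‖ ≤ T * K := by
    have h := norm_exp_mul_sub_exp_mul_le hC hg hu hK hst hBs
    rw [hs, mul_zero, sub_zero, norm_mul] at h
    exact le_of_mul_le_mul_left h (norm_pos_iff.2 (Complex.exp_ne_zero _))
  obtain h | h := hB t ht
  · refine key t₀ h0 ?_ fun r hr => h r (by rwa [uIcc_of_le ht.1] at hr)
    rw [abs_of_nonneg] <;> linarith [ht.1, ht.2]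
  · refine key (t₀ + T) (by rw [hp, h0]) ?_ fun r hr => h r (by rwa [uIcc_of_ge ht.2] at hr)
    rw [abs_of_nonpos] <;> linarith [ht.1, ht.2]

/-- Variation of constants with initial value `κ`. The hypothesis on `κ` says `u(T) = u(0)`, which
suffices as `c` and `g` are periodic. The explicit formula is kept so that a zero of `u` can be
prescribed in the resonant case. -/
theorem exists_periodic_solution (hc : ContDiff ℝ ∞ c) (hcp : Function.Periodic c T) {g : ℝ → ℂ}
    (hg : ContDiff ℝ ∞ g) (hgp : Function.Periodic g T) {κ : ℂ}
    (hκ : κ + Complex.I * (∫ s in (0 : ℝ)..T,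
      Complex.exp (Complex.I * ∫ r in (0 : ℝ)..s, c r) * g s) =
        Complex.exp (Complex.I * ∫ r in (0 : ℝ)..T, c r) * κ) :
    ∃ u : ℝ → ℂ, ContDiff ℝ ∞ u ∧ Function.Periodic u T ∧
      (∀ t, HasDerivAt u (Complex.I * (g t - c t * u t)) t) ∧ ∀ t, u t =
        Complex.exp (-(Complex.I * ∫ r in (0 : ℝ)..t, c r)) * (κ + Complex.I * (∫ s in (0 : ℝ)..t,
          Complex.exp (Complex.I * ∫ r in (0 : ℝ)..s, c r) * g s)) := by
  set C : ℝ → ℂ := fun t => ∫ r in (0 : ℝ)..t, c r with hCdef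
  have hC : ContDiff ℝ ∞ C := contDiff_integral_zero hc
  have hCd : ∀ t, HasDerivAt C (c t) t := hasDerivAt_integral_zero hc.continuous
  have hCT : ∀ t, C (t + T) = C t + C T := integral_zero_add_period hc.continuous hcp
  set h : ℝ → ℂ := fun s => Complex.exp (Complex.I * C s) * g s with hh
  have hhs : ContDiff ℝ ∞ h := (contDiff_const.mul hC).cexp.mul hg
  set H : ℝ → ℂ := fun t => ∫ s in (0 : ℝ)..t, h s with hHdef
  have hH : ContDiff ℝ ∞ H := contDiff_integral_zero hhs
  have hHd : ∀ t, HasDerivAt H (h t) t := hasDerivAt_integral_zero hhs.continuous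
  have hHT (t : ℝ) : H (t + T) = H T + Complex.exp (Complex.I * C T) * H t := by
    have h1 : H (t + T) = H T + ∫ s in (0 : ℝ)..t, h (s + T) := by
      rw [intervalIntegral.integral_comp_add_right, zero_add, hHdef]
      exact (intervalIntegral.integral_add_adjacent_intervals
        (hhs.continuous.intervalIntegrable _ _) (hhs.continuous.intervalIntegrable _ _)).symm
    rw [h1, hHdef, ← intervalIntegral.integral_const_mul]
    congr 2
    funext s
    simp only [hh, hCT, hgp s, mul_add, Complex.exp_add]
    ring
  refine ⟨fun t => Complex.exp (-(Complex.I * C t)) * (κ + Complex.I * H t), ?_, fun t => ?_,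
    fun t => ?_, fun t => rfl⟩
  · exact (contDiff_const.mul hC).neg.cexp.mul (contDiff_const.add (contDiff_const.mul hH))
  · have h2 : κ + Complex.I * H (t + T) = Complex.exp (Complex.I * C T) *
        (κ + Complex.I * H t) := by
      rw [hHT, mul_add (Complex.exp _), ← hκ]
      ring
    have h3 : Complex.exp (-(Complex.I * (C t + C T))) * Complex.exp (Complex.I * C T) =
        Complex.exp (-(Complex.I * C t)) := by
      rw [← Complex.exp_add]
      congr 1
      ring
    simp only [h2, hCT]
    rw [← mul_assoc, h3]
  · have h4 := ((hCd t).const_mul Complex.I).neg.cexp.mul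
      (((hHd t).const_mul Complex.I).const_add κ)
    convert! h4 using 1
    have h5 : Complex.exp (-(Complex.I * C t)) * Complex.exp (Complex.I * C t) = 1 := by
      rw [← Complex.exp_add, neg_add_cancel, Complex.exp_zero]
    simp only [hh, Pi.neg_apply]
    linear_combination (-(Complex.I * g t)) * h5

end PeriodicODE

/-- A lower bound for `|1 - e^{2πiw}|` by the distance of `w` to the integers. -/
theorem le_norm_one_sub_exp {w : ℂ} {δ : ℝ} (hδ : δ ≤ 1 / 2)
    (h : ∀ k : ℤ, δ ≤ ‖(k : ℂ) + w‖) : δ ≤ ‖1 - Complex.exp (Complex.I * (2 * π * w))‖ := by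
  by_contra! hlt
  set z := Complex.exp (Complex.I * (2 * π * w)) - 1 with hz
  have hzn : ‖z‖ = ‖1 - Complex.exp (Complex.I * (2 * π * w))‖ := norm_sub_rev _ _
  have hz2 : ‖z‖ ≤ 1 / 2 := by rw [hzn]; linarith
  -- The logarithm of `1 + z = e^{2πiw}` is `2πi(k + w)` for some integer `k`, so `2πδ ≤ (3/2)‖z‖`.
  -- This contradicts `‖z‖ < δ`.
  have hlog := Complex.norm_log_one_add_half_le_self hz2
  have h1 : 1 + z = Complex.exp (Complex.I * (2 * π * w)) := by rw [hz]; ring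
  have hexp : Complex.exp (Complex.log (1 + z)) = Complex.exp (Complex.I * (2 * π * w)) := by
    rw [Complex.exp_log (h1 ▸ Complex.exp_ne_zero _), h1]
  obtain ⟨k, hk⟩ := Complex.exp_eq_exp_iff_exists_int.1 hexp
  have h2 : Complex.log (1 + z) = (2 * π * Complex.I) * ((k : ℂ) + w) := by
    rw [hk]
    ring
  have h3 : ‖(2 * π * Complex.I : ℂ)‖ = 2 * π := by simp [abs_of_pos Real.pi_pos]
  rw [h2, norm_mul, h3] at hlog
  have h4 := h k
  nlinarith [Real.pi_gt_three, norm_nonneg z, norm_nonneg ((k : ℂ) + w)]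

/-! ### Sublevel sets on the circle -/

section Circle

variable {f : ℝ → ℝ} {T : ℝ}

/-- If the sublevel sets on the circle are connected, every point can be joined to a maximum point
by an arc on which `f` is at least its value at the point. -/
theorem forall_le_or_forall_le_of_isPreconnected (hT : 0 < T) (hp : Function.Periodic f T)
    (hS : ∀ lam, IsPreconnected {θ : AddCircle T | ∃ t : ℝ, (t : AddCircle T) = θ ∧ f t < lam})
    {t₀ : ℝ} (hmax : ∀ t, f t ≤ f t₀) {t : ℝ} (ht : t ∈ Icc t₀ (t₀ + T)) :
    (∀ r ∈ Icc t₀ t, f t ≤ f r) ∨ ∀ r ∈ Icc t (t₀ + T), f t ≤ f r := by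
  by_contra! hcon
  obtain ⟨⟨r₁, hr₁, h₁⟩, r₂, hr₂, h₂⟩ := hcon
  have hfact : Fact (0 < T) := ⟨hT⟩
  have hne (s : ℝ) (hs : f s < f t) : s ≠ t₀ ∧ s ≠ t ∧ s ≠ t₀ + T := by
    refine ⟨?_, ?_, ?_⟩ <;> rintro rfl
    · exact absurd (hmax t) (not_le.2 hs)
    · exact lt_irrefl _ hs
    · rw [hp] at hs
      exact absurd (hmax t) (not_le.2 hs)
  have hopen (a b : ℝ) : IsOpen ((fun s : ℝ => (s : AddCircle T)) '' Ioo a b) :=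
    QuotientAddGroup.isOpenMap_coe _ isOpen_Ioo
  -- The set `f < f t` omits `t` and the maximum point `t₀`, so the two open arcs between them cover
  -- it. Both arcs meet it, at `r₁` and `r₂`, yet they are disjoint on the circle.
  obtain ⟨θ, -, ⟨a, ha, rfl⟩, b, hb, hab⟩ := hS (f t) _ _ (hopen t₀ t) (hopen t (t₀ + T)) (by
      rintro _ ⟨s, rfl, hs⟩
      have h1 := toIcoMod_mem_Ico hT t₀ s
      have h2 : f (toIcoMod hT t₀ s) = f s := by rw [toIcoMod, hp.sub_zsmul_eq]
      have h3 : ((toIcoMod hT t₀ s : ℝ) : AddCircle T) = (s : AddCircle T) := by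
        rw [toIcoMod, AddCircle.coe_sub, sub_eq_self]
        exact (AddCircle.coe_eq_zero_iff T).2 ⟨_, rfl⟩
      obtain ⟨h4, h5, -⟩ := hne _ (h2 ▸ hs)
      rcases lt_or_gt_of_ne h5 with h6 | h6
      · exact Or.inl ⟨_, ⟨lt_of_le_of_ne h1.1 h4.symm, h6⟩, h3⟩
      · exact Or.inr ⟨_, ⟨h6, h1.2⟩, h3⟩)
    (by
      obtain ⟨h4, h5, -⟩ := hne _ h₁
      exact ⟨_, ⟨r₁, rfl, h₁⟩, r₁,
        ⟨lt_of_le_of_ne hr₁.1 h4.symm, lt_of_le_of_ne hr₁.2 h5⟩, rfl⟩)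
    (by
      obtain ⟨-, h5, h6⟩ := hne _ h₂
      exact ⟨_, ⟨r₂, rfl, h₂⟩, r₂,
        ⟨lt_of_le_of_ne hr₂.1 h5.symm, lt_of_le_of_ne hr₂.2 h6⟩, rfl⟩)
  have := (AddCircle.coe_eq_coe_iff_of_mem_Ico (p := T) (a := t₀)
    ⟨(ht.1.trans_lt hb.1).le, hb.2⟩ ⟨ha.1.le, ha.2.trans_le ht.2⟩).1 hab
  exact absurd (hb.1.trans_eq this) (not_lt.2 ha.2.le)

/-- A disconnected sublevel set on the circle yields four points in cyclic order, alternately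
inside and outside the sublevel set. -/
theorem exists_alternating_of_not_isPreconnected (hT : 0 < T) (hp : Function.Periodic f T)
    {lam : ℝ}
    (hS : ¬IsPreconnected {θ : AddCircle T | ∃ t : ℝ, (t : AddCircle T) = θ ∧ f t < lam}) :
    ∃ p₁ q₁ p₂ q₂ : ℝ, p₁ < q₁ ∧ q₁ < p₂ ∧ p₂ < q₂ ∧ q₂ < p₁ + T ∧
      f p₁ < lam ∧ f p₂ < lam ∧ lam ≤ f q₁ ∧ lam ≤ f q₂ := by
  by_contra! hcon
  refine hS (isPreconnected_of_forall_pair ?_)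
  rintro _ ⟨a, rfl, ha⟩ _ ⟨b', rfl, hb'⟩
  obtain ⟨b, hb, hbb, hfb⟩ : ∃ b ∈ Ico a (a + T), (b : AddCircle T) = b' ∧ f b < lam := by
    refine ⟨toIcoMod hT a b', toIcoMod_mem_Ico hT a b', ?_, ?_⟩
    · rw [toIcoMod, AddCircle.coe_sub, sub_eq_self]
      exact (AddCircle.coe_eq_zero_iff T).2 ⟨_, rfl⟩
    · rwa [toIcoMod, hp.sub_zsmul_eq]
  have haT : ((a + T : ℝ) : AddCircle T) = a := by simp
  have harc (s t : ℝ) (h : ∀ r ∈ Icc s t, f r < lam) :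
      (fun r : ℝ => (r : AddCircle T)) '' Icc s t ⊆
        {θ : AddCircle T | ∃ t : ℝ, (t : AddCircle T) = θ ∧ f t < lam} := by
    rintro _ ⟨r, hr, rfl⟩
    exact ⟨r, rfl, h r hr⟩
  have hpre (s t : ℝ) : IsPreconnected ((fun r : ℝ => (r : AddCircle T)) '' Icc s t) :=
    isPreconnected_Icc.image _ (AddCircle.continuous_mk' T).continuousOn
  -- If either closed arc between the two points lies in the sublevel set, it connects them there;
  -- otherwise each arc supplies a point outside.
  by_cases h1 : ∀ r ∈ Icc a b, f r < lam
  · exact ⟨_, harc a b h1, ⟨a, ⟨le_rfl, hb.1⟩, rfl⟩, ⟨b, ⟨hb.1, le_rfl⟩, hbb⟩, hpre a b⟩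
  by_cases h2 : ∀ r ∈ Icc b (a + T), f r < lam
  · exact ⟨_, harc b (a + T) h2, ⟨a + T, ⟨hb.2.le, le_rfl⟩, haT⟩, ⟨b, ⟨le_rfl, hb.2.le⟩, hbb⟩,
      hpre b (a + T)⟩
  push Not at h1 h2
  obtain ⟨q₁, hq₁, h1⟩ := h1
  obtain ⟨q₂, hq₂, h2⟩ := h2
  have hlt {x y : ℝ} (hx : f x < lam) (hy : lam ≤ f y) : x ≠ y := fun h => by
    rw [h] at hx
    exact absurd hy (not_le.2 hx)
  have := hcon a q₁ b q₂ (lt_of_le_of_ne hq₁.1 (hlt ha h1)) (lt_of_le_of_ne hq₁.2 (hlt hfb h1).symm)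
    (lt_of_le_of_ne hq₂.1 (hlt hfb h2))
    (lt_of_le_of_ne hq₂.2 (hlt (by rwa [hp]) h2).symm) ha hfb h1
  exact absurd h2 (not_le.2 this)

end Circle

/-! ### Sufficiency of the conditions -/

section Sufficiency

open SmoothTorus

variable {N m : ℕ} {c : SmoothTorus (N + 1) →L[ℂ] SmoothTorus (N + 1)}

/-- The primitive `C(t, ξ) = ∫_0^t c(s, ξ) ds`. -/
noncomputable def symbolPrimitive (c : SmoothTorus (N + 1) →L[ℂ] SmoothTorus (N + 1))
    (ξ : Fin N → ℤ) (t : ℝ) : ℂ := ∫ s in (0 : ℝ)..t, tubeSymbol c s ξ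

theorem hasDerivAt_symbolPrimitive (c : SmoothTorus (N + 1) →L[ℂ] SmoothTorus (N + 1))
    (ξ : Fin N → ℤ) (t : ℝ) : HasDerivAt (symbolPrimitive c ξ) (tubeSymbol c t ξ) t :=
  hasDerivAt_integral_zero (contDiff_tubeSymbol c ξ).continuous t

theorem contDiff_symbolPrimitive (c : SmoothTorus (N + 1) →L[ℂ] SmoothTorus (N + 1))
    (ξ : Fin N → ℤ) : ContDiff ℝ ∞ (symbolPrimitive c ξ) :=
  contDiff_integral_zero (contDiff_tubeSymbol c ξ)

theorem symbolPrimitive_zero (c : SmoothTorus (N + 1) →L[ℂ] SmoothTorus (N + 1))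
    (ξ : Fin N → ℤ) : symbolPrimitive c ξ 0 = 0 := intervalIntegral.integral_same

theorem symbolPrimitive_two_pi (c : SmoothTorus (N + 1) →L[ℂ] SmoothTorus (N + 1))
    (ξ : Fin N → ℤ) : symbolPrimitive c ξ (2 * π) = 2 * π * symbolAverage c ξ := by
  have h : (2 * π : ℂ) ≠ 0 := by exact_mod_cast Real.two_pi_pos.ne'
  rw [symbolAverage, symbolPrimitive, mul_inv_cancel_left₀ h]

theorem symbolPrimitive_add_two_pi (c : SmoothTorus (N + 1) →L[ℂ] SmoothTorus (N + 1))
    (ξ : Fin N → ℤ) (t : ℝ) :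
    symbolPrimitive c ξ (t + 2 * π) = symbolPrimitive c ξ t + 2 * π * symbolAverage c ξ := by
  rw [← symbolPrimitive_two_pi]
  exact integral_zero_add_period (contDiff_tubeSymbol c ξ).continuous (periodic_tubeSymbol c ξ) t

theorem im_symbolPrimitive (c : SmoothTorus (N + 1) →L[ℂ] SmoothTorus (N + 1))
    (ξ : Fin N → ℤ) (t : ℝ) : (symbolPrimitive c ξ t).im = imPrimitive c t ξ :=
  (Complex.imCLM.intervalIntegral_comp_comm
    ((contDiff_tubeSymbol c ξ).continuous.intervalIntegrable _ _)).symm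

theorem hasDerivAt_imPrimitive (c : SmoothTorus (N + 1) →L[ℂ] SmoothTorus (N + 1))
    (ξ : Fin N → ℤ) (t : ℝ) :
    HasDerivAt (fun t => imPrimitive c t ξ) (imSymbol c t ξ) t := by
  have h := Complex.imCLM.hasFDerivAt.comp_hasDerivAt t (hasDerivAt_symbolPrimitive c ξ t)
  have he : (fun t => imPrimitive c t ξ) = Complex.imCLM ∘ symbolPrimitive c ξ :=
    funext fun t => (im_symbolPrimitive c ξ t).symm
  rw [he]
  exact h

theorem continuous_imPrimitive (c : SmoothTorus (N + 1) →L[ℂ] SmoothTorus (N + 1))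
    (ξ : Fin N → ℤ) : Continuous fun t => imPrimitive c t ξ :=
  continuous_iff_continuousAt.2 fun t => (hasDerivAt_imPrimitive c ξ t).continuousAt

theorem mem_resonantSet_iff (c : SmoothTorus (N + 1) →L[ℂ] SmoothTorus (N + 1))
    (ξ : Fin N → ℤ) :
    ξ ∈ resonantSet c ↔ Complex.exp (Complex.I * (2 * π * symbolAverage c ξ)) = 1 := by
  rw [Complex.exp_eq_one_iff]
  refine exists_congr fun k => ⟨fun h => by rw [h]; ring, fun h => ?_⟩
  refine mul_left_cancel₀ Complex.two_pi_I_ne_zero ?_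
  linear_combination h

theorem periodic_imPrimitive {ξ : Fin N → ℤ} (hξ : ξ ∈ resonantSet c) :
    Function.Periodic (fun t => imPrimitive c t ξ) (2 * π) := by
  intro t
  obtain ⟨k, hk⟩ := hξ
  have h := congrArg Complex.im (symbolPrimitive_add_two_pi c ξ t)
  rw [hk, Complex.add_im, im_symbolPrimitive, im_symbolPrimitive] at h
  simpa using h

/-- Doubling the zero frequency gives `c(t, 0) = 2^m c(t, 0)` with `2^m ≠ 1`. The frequency `0` is
thus resonant with `B = 0`, which is why the conditions may ignore it. -/
theorem IsPosHomogeneous.tubeSymbol_zero (hm : 1 ≤ m) (hhom : IsPosHomogeneous c m) (t : ℝ) :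
    tubeSymbol c t 0 = 0 := by
  have h := hhom t 0 2 one_le_two
  rw [smul_zero] at h
  have h2 : ((2 : ℕ) : ℂ) ^ m ≠ 1 := by
    have : (1 : ℕ) < 2 ^ m := Nat.one_lt_two_pow (by omega)
    exact_mod_cast this.ne'
  have h3 : (1 - ((2 : ℕ) : ℂ) ^ m) * tubeSymbol c t 0 = 0 := by linear_combination h
  exact (mul_eq_zero.1 h3).resolve_left (sub_ne_zero.2 h2.symm)

theorem IsPosHomogeneous.imPrimitive_zero (hm : 1 ≤ m) (hhom : IsPosHomogeneous c m) (t : ℝ) :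
    imPrimitive c t 0 = 0 := by
  simp [imPrimitive, imSymbol, hhom.tubeSymbol_zero hm]

theorem IsPosHomogeneous.zero_mem_resonantSet (hm : 1 ≤ m) (hhom : IsPosHomogeneous c m) :
    0 ∈ resonantSet c :=
  ⟨0, by simp [symbolAverage, hhom.tubeSymbol_zero hm]⟩

/-- A solution of the ordinary differential equation yields a mode. -/
theorem IsTubeType.tubeOperator_ofSlice_eq (h : IsTubeType c) {ξ : Fin N → ℤ}
    {F : SmoothTorus (N + 1)} (hF : IsMode ξ F) {u : ℝ → ℂ} (hu : ContDiff ℝ ∞ u)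
    (hp : Function.Periodic u (2 * π))
    (hd : ∀ t, HasDerivAt u (Complex.I * (slice F t - tubeSymbol c t ξ * u t)) t) :
    tubeOperator c (ofSlice ξ u hu hp) = F := by
  refine (h.isMode_tubeOperator (isMode_ofSlice hu hp)).ext hF fun t => ?_
  rw [h.slice_tubeOperator_ofSlice hu hp (hd t)]
  linear_combination (-(slice F t - tubeSymbol c t ξ * u t)) * Complex.I_sq

/-- Here `e^{2πi c_0} ≠ 1` determines the initial value. The sign of `b` makes `B` monotone, so the
only loss is the divisor `|1 - e^{±2πi c_0}|`, at least `δ` by `le_norm_one_sub_exp`. -/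
theorem IsTubeType.exists_mode_of_not_mem_resonantSet (h : IsTubeType c) {ξ : Fin N → ℤ}
    (hξ : ξ ∉ resonantSet c)
    (hsign : (∀ t : ℝ, 0 ≤ imSymbol c t ξ) ∨ (∀ t : ℝ, imSymbol c t ξ ≤ 0)) {δ : ℝ}
    (hδ2 : δ ≤ 1 / 2) (hδ : ∀ τ : ℤ, δ ≤ ‖(τ : ℂ) + symbolAverage c ξ‖) {F : SmoothTorus (N + 1)}
    (hF : IsMode ξ F) : ∃ U, IsMode ξ U ∧ tubeOperator c U = F ∧
      δ * derivSeminorm (N + 1) 0 U ≤ 2 * π * derivSeminorm (N + 1) 0 F := by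
  have hκ := (mem_resonantSet_iff c ξ).not.1 hξ
  rw [← symbolPrimitive_two_pi] at hκ
  obtain ⟨u, hu, hp, hd, -⟩ := exists_periodic_solution (contDiff_tubeSymbol c ξ)
    (periodic_tubeSymbol c ξ) (contDiff_slice F) (periodic_slice F)
    (κ := Complex.I * (∫ s in (0 : ℝ)..(2 * π), Complex.exp (Complex.I *
      ∫ r in (0 : ℝ)..s, tubeSymbol c r ξ) * slice F s) /
      (Complex.exp (Complex.I * symbolPrimitive c ξ (2 * π)) - 1)) (by
      have := sub_ne_zero.2 hκ
      change _ = Complex.exp (Complex.I * symbolPrimitive c ξ (2 * π)) * _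
      field_simp
      ring)
  have hb : ∀ t, δ * ‖u t‖ ≤ 2 * π * derivSeminorm (N + 1) 0 F := by
    intro t
    rcases hsign with hs | hs
    · refine (mul_le_mul_of_nonneg_right (le_norm_one_sub_exp hδ2 hδ) (norm_nonneg _)).trans ?_
      refine norm_mul_norm_le_of_monotone (hasDerivAt_symbolPrimitive c ξ)
        (symbolPrimitive_add_two_pi c ξ) Real.two_pi_pos.le (contDiff_slice F).continuous hd hp
        (norm_slice_le F) ?_ t
      simp only [im_symbolPrimitive]
      exact monotone_of_hasDerivAt_nonneg (hasDerivAt_imPrimitive c ξ) hs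
    · have h1 : ∀ τ : ℤ, δ ≤ ‖(τ : ℂ) + -symbolAverage c ξ‖ := fun τ => by
        rw [← norm_neg, neg_add, neg_neg, ← Int.cast_neg]
        exact hδ _
      refine (mul_le_mul_of_nonneg_right (le_norm_one_sub_exp hδ2 h1) (norm_nonneg _)).trans ?_
      rw [mul_neg]
      refine norm_mul_norm_le_of_antitone (hasDerivAt_symbolPrimitive c ξ)
        (symbolPrimitive_add_two_pi c ξ) Real.two_pi_pos.le (contDiff_slice F).continuous hd hp
        (norm_slice_le F) ?_ t
      simp only [im_symbolPrimitive]
      exact antitone_of_hasDerivAt_nonpos (hasDerivAt_imPrimitive c ξ) hs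
  refine ⟨ofSlice ξ u hu hp, isMode_ofSlice hu hp, h.tubeOperator_ofSlice_eq hF hu hp hd, ?_⟩
  rcases le_or_gt δ 0 with h0 | h0
  · exact (mul_nonpos_of_nonpos_of_nonneg h0 (apply_nonneg _ _)).trans (by positivity)
  · rw [← le_div_iff₀' h0]
    refine (isMode_ofSlice hu hp).derivSeminorm_zero_le fun t => ?_
    rw [slice_ofSlice, le_div_iff₀' h0]
    exact hb t

/-- The compatibility functional at a resonant frequency. -/
noncomputable def compatibility (c : SmoothTorus (N + 1) →L[ℂ] SmoothTorus (N + 1))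
    (ξ : Fin N → ℤ) : SmoothTorus (N + 1) →ₗ[ℂ] ℂ where
  toFun f := ∫ s in (0 : ℝ)..(2 * π),
    Complex.exp (Complex.I * symbolPrimitive c ξ s) * slice (modeProj ξ f) s
  map_add' f g := by
    have hC := (contDiff_symbolPrimitive c ξ).continuous
    have h1 := (contDiff_slice (modeProj ξ f)).continuous
    have h2 := (contDiff_slice (modeProj ξ g)).continuous
    rw [← intervalIntegral.integral_add (Continuous.intervalIntegrable (by fun_prop) _ _)
      (Continuous.intervalIntegrable (by fun_prop) _ _)]
    simp only [map_add, slice, add_apply, mul_add]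
  map_smul' a f := by
    rw [RingHom.id_apply, smul_eq_mul, ← intervalIntegral.integral_const_mul]
    simp only [map_smul, slice, smul_apply, mul_left_comm _ a]

theorem compatibility_apply (c : SmoothTorus (N + 1) →L[ℂ] SmoothTorus (N + 1))
    (ξ : Fin N → ℤ) (f : SmoothTorus (N + 1)) : compatibility c ξ f = ∫ s in (0 : ℝ)..(2 * π),
      Complex.exp (Complex.I * symbolPrimitive c ξ s) * slice (modeProj ξ f) s := rfl

theorem continuous_compatibility (c : SmoothTorus (N + 1) →L[ℂ] SmoothTorus (N + 1))
    (ξ : Fin N → ℤ) : Continuous (compatibility c ξ) := by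
  obtain ⟨A, l, -, hA⟩ := exists_pow_mul_derivSeminorm_modeProj_le N 0 0
  have hC := (contDiff_symbolPrimitive c ξ).continuous
  obtain ⟨K, hK⟩ := (isCompact_uIcc (a := (0 : ℝ)) (b := 2 * π)).exists_bound_of_continuousOn
    (f := fun s => Complex.exp (Complex.I * symbolPrimitive c ξ s))
    (Continuous.continuousOn (by fun_prop))
  have hK0 : 0 ≤ K := (norm_nonneg _).trans (hK 0 left_mem_uIcc)
  refine continuous_functional_of_le
    (q := fun f => K * (A * ∑ i ∈ Finset.range l, derivSeminorm (N + 1) i f) * (2 * π))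
    (by
      have := fun i => continuous_derivSeminorm (n := N + 1) i
      fun_prop) (by simp) fun f => ?_
  have h1 := intervalIntegral.norm_integral_le_of_norm_le_const (a := 0) (b := 2 * π)
    (f := fun s => Complex.exp (Complex.I * symbolPrimitive c ξ s) * slice (modeProj ξ f) s)
    (C := K * (A * ∑ i ∈ Finset.range l, derivSeminorm (N + 1) i f)) fun s hs => by
      rw [norm_mul]
      have h2 := hA f ξ
      rw [pow_zero, one_mul] at h2
      exact mul_le_mul (hK s (uIoc_subset_uIcc hs)) ((norm_slice_le _ s).trans h2) (norm_nonneg _)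
        hK0
  rwa [sub_zero, abs_of_pos Real.two_pi_pos] at h1

/-- Up to the factor `i`, the integral is the increment of the periodic function `e^{iC} u` over one
period, where `u` is the `ξ`-mode of `f`; resonance is what makes `e^{iC}` periodic. -/
theorem IsTubeType.compatibility_tubeOperator (h : IsTubeType c) {ξ : Fin N → ℤ}
    (hξ : ξ ∈ resonantSet c) (f : SmoothTorus (N + 1)) :
    compatibility c ξ (tubeOperator c f) = 0 := by
  have h1 := exp_mul_sub_exp_mul_of_ode (hasDerivAt_symbolPrimitive c ξ)
    (contDiff_slice (tubeOperator c (modeProj ξ f))).continuous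
    (h.hasDerivAt_slice (isMode_modeProj ξ f)) 0 (2 * π)
  have h2 := periodic_slice (modeProj ξ f) 0
  rw [zero_add] at h2
  rw [symbolPrimitive_two_pi, (mem_resonantSet_iff c ξ).1 hξ, symbolPrimitive_zero, mul_zero,
    Complex.exp_zero, h2, sub_self, intervalIntegral.integral_const_mul] at h1
  rw [compatibility_apply, h.modeProj_tubeOperator]
  exact (mul_eq_zero.1 h1.symm).resolve_left Complex.I_ne_zero

/-- The freedom of adding multiples of `e^{-iC}` is spent on making the solution vanish at a maximum
point of `B`; `norm_le_of_arc` then applies. -/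
theorem IsTubeType.exists_mode_of_mem_resonantSet (h : IsTubeType c) {ξ : Fin N → ℤ}
    (hξ : ξ ∈ resonantSet c) (hS : ∀ lam : ℝ, IsPreconnected (sublevelSet c ξ lam))
    {F : SmoothTorus (N + 1)} (hF : IsMode ξ F) (hcomp : compatibility c ξ F = 0) :
    ∃ U, IsMode ξ U ∧ tubeOperator c U = F ∧
      derivSeminorm (N + 1) 0 U ≤ 2 * π * derivSeminorm (N + 1) 0 F := by
  obtain ⟨t₀, -, hmax⟩ := (isCompact_Icc (a := (0 : ℝ)) (b := 2 * π)).exists_isMaxOn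
    ⟨0, left_mem_Icc.2 Real.two_pi_pos.le⟩ (continuous_imPrimitive c ξ).continuousOn
  have hper := periodic_imPrimitive hξ
  have hmax' (t : ℝ) : imPrimitive c t ξ ≤ imPrimitive c t₀ ξ := by
    have h1 := toIcoMod_mem_Ico Real.two_pi_pos 0 t
    rw [zero_add] at h1
    have h2 := hmax (Ico_subset_Icc_self h1)
    have h3 : imPrimitive c (toIcoMod Real.two_pi_pos 0 t) ξ = imPrimitive c t ξ := by
      rw [toIcoMod]
      exact hper.sub_zsmul_eq _
    rwa [← h3]
  rw [compatibility_apply, hF.modeProj_eq] at hcomp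
  let H : ℝ → ℂ := fun t => ∫ s in (0 : ℝ)..t,
    Complex.exp (Complex.I * symbolPrimitive c ξ s) * slice F s
  obtain ⟨u, hu, hp, hd, hform⟩ := exists_periodic_solution (contDiff_tubeSymbol c ξ)
    (periodic_tubeSymbol c ξ) (contDiff_slice F) (periodic_slice F)
    -- Every `κ` gives a periodic solution, since `e^{iC(2π)} = 1` and `H(2π) = 0`; this one gives
    -- `u t₀ = 0`.
    (κ := -(Complex.I * H t₀)) (by
      have h1 := (mem_resonantSet_iff c ξ).1 hξ
      rw [← symbolPrimitive_two_pi] at h1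
      change _ + Complex.I * H (2 * π) = Complex.exp (Complex.I * symbolPrimitive c ξ (2 * π)) * _
      rw [h1, show H (2 * π) = 0 from hcomp]
      ring)
  have h0 : u t₀ = 0 := by
    rw [hform]
    change _ * (-(Complex.I * H t₀) + Complex.I * H t₀) = 0
    ring
  refine ⟨ofSlice ξ u hu hp, isMode_ofSlice hu hp, h.tubeOperator_ofSlice_eq hF hu hp hd, ?_⟩
  refine (isMode_ofSlice hu hp).derivSeminorm_zero_le fun t => ?_
  rw [slice_ofSlice]
  refine norm_le_of_arc (hasDerivAt_symbolPrimitive c ξ) Real.two_pi_pos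
    (contDiff_slice F).continuous hd hp (norm_slice_le F) h0 (fun t ht => ?_) t
  simp only [im_symbolPrimitive]
  exact forall_le_or_forall_le_of_isPreconnected Real.two_pi_pos hper hS hmax' ht

theorem globallySolvable_of_conditions (hm : 1 ≤ m) (hord : HasOrder c (m : ℝ))
    (htube : IsTubeType c) (hhom : IsPosHomogeneous c m) (h1 : DiophantineCondition c)
    (h2 : ∀ ξ : Fin N → ℤ, ξ ≠ 0 → ξ ∉ resonantSet c →
      (∀ t : ℝ, 0 ≤ imSymbol c t ξ) ∨ (∀ t : ℝ, imSymbol c t ξ ≤ 0))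
    (h3 : ∀ ξ : Fin N → ℤ, ξ ≠ 0 → ξ ∈ resonantSet c →
      ∀ lam : ℝ, IsPreconnected (sublevelSet c ξ lam)) :
    GloballySolvable (tubeOperator c) := by
  have h3' (ξ : Fin N → ℤ) (hξ : ξ ∈ resonantSet c) (lam : ℝ) :
      IsPreconnected (sublevelSet c ξ lam) := by
    rcases eq_or_ne ξ 0 with rfl | h0
    · simp only [sublevelSet, hhom.imPrimitive_zero hm]
      by_cases hl : 0 < lam
      · simp only [hl, and_true]
        rw [show {θ : AddCircle (2 * π) | ∃ t : ℝ, (t : AddCircle (2 * π)) = θ} = univ from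
          eq_univ_of_forall fun θ => QuotientAddGroup.mk_surjective θ]
        have : ConnectedSpace (AddCircle (2 * π)) := inferInstance
        exact isPreconnected_univ
      · simp only [hl, and_false, exists_false, ofPred_false]
        exact isPreconnected_empty
    · exact h3 ξ h0 hξ lam
  have hrange : range (tubeOperator c) = ⋂ ξ ∈ resonantSet c, {f | compatibility c ξ f = 0} := by
    refine Subset.antisymm ?_ fun f hf => ?_
    · rintro _ ⟨u, rfl⟩
      exact mem_iInter₂.2 fun ξ hξ => htube.compatibility_tubeOperator hξ u
    · obtain ⟨C, hC, M, hdio⟩ := h1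
      -- The bound `1 / 2` is required by `le_norm_one_sub_exp`. It also makes `C'⁻¹ ≥ 1`, so that
      -- one estimate covers resonant and nonresonant frequencies.
      set C' := min C (1 / 2) with hC'
      have hC'0 : 0 < C' := lt_min hC one_half_pos
      have key (ξ : Fin N → ℤ) : ∃ U, IsMode ξ U ∧ tubeOperator c U = modeProj ξ f ∧
          derivSeminorm (N + 1) 0 U ≤ 2 * π * C'⁻¹ * (1 + latticeNorm ξ) ^ M *
            derivSeminorm (N + 1) 0 (modeProj ξ f) := by
        have hw1 := one_le_one_add_latticeNorm ξ
        have hw : 1 ≤ (1 + latticeNorm ξ) ^ M := one_le_pow₀ hw1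
        have hw0 := zero_lt_one.trans_le hw
        by_cases hξ : ξ ∈ resonantSet c
        · have hcomp : compatibility c ξ (modeProj ξ f) = 0 := by
            have h := mem_iInter₂.1 hf ξ hξ
            change compatibility c ξ f = 0 at h
            rw [compatibility_apply] at h
            rw [compatibility_apply, (isMode_modeProj ξ f).modeProj_eq, h]
          obtain ⟨U, hU, hPU, hle⟩ := htube.exists_mode_of_mem_resonantSet hξ (h3' ξ hξ)
            (isMode_modeProj ξ f) hcomp
          refine ⟨U, hU, hPU, hle.trans ?_⟩
          have h4 : 1 ≤ C'⁻¹ := (one_le_inv₀ hC'0).2 ((min_le_right _ _).trans (by norm_num))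
          have h5 : 1 ≤ C'⁻¹ * (1 + latticeNorm ξ) ^ M := one_le_mul_of_one_le_of_one_le h4 hw
          rw [mul_assoc (2 * π)]
          exact mul_le_mul_of_nonneg_right (le_mul_of_one_le_right Real.two_pi_pos.le h5)
            (apply_nonneg _ _)
        · have hne : ξ ≠ 0 := fun h => hξ (h ▸ hhom.zero_mem_resonantSet hm)
          have hinv : ((1 + latticeNorm ξ) ^ M)⁻¹ ≤ 1 := inv_le_one_of_one_le₀ hw
          have hinv0 := inv_pos.2 hw0
          obtain ⟨U, hU, hPU, hle⟩ := htube.exists_mode_of_not_mem_resonantSet hξ (h2 ξ hne hξ)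
            (δ := C' * ((1 + latticeNorm ξ) ^ M)⁻¹)
            ((mul_le_of_le_one_right hC'0.le hinv).trans (min_le_right _ _))
            (fun τ => le_trans (by
              rw [zpow_neg, zpow_natCast]
              exact mul_le_mul_of_nonneg_right (min_le_left _ _) hinv0.le) (hdio τ ξ hξ))
            (isMode_modeProj ξ f)
          refine ⟨U, hU, hPU, ?_⟩
          rw [← le_div_iff₀' (mul_pos hC'0 hinv0)] at hle
          refine hle.trans (le_of_eq ?_)
          field_simp
      choose U hU hPU hle using key
      have hF (k : ℕ) : RapidlyDecreasing (fun ξ : Fin N → ℤ => ξ)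
          fun ξ => derivSeminorm (N + 1) k (modeProj ξ f) := fun M =>
        exists_pow_mul_derivSeminorm_modeProj k M f
      have hUR := htube.rapidlyDecreasing_derivSeminorm hord (ξ := fun ξ : Fin N → ℤ => ξ) hU
        (((hF 0).pow_mul (A := 2 * π * C'⁻¹) (by positivity) M).mono hle)
        fun k _ => by simpa only [hPU] using hF k
      obtain ⟨u, hu⟩ := exists_hasSum_of_rapidlyDecreasing Function.injective_id hUR
      refine ⟨u, eq_of_modeProj_eq fun ξ => ?_⟩
      rw [htube.modeProj_tubeOperator, modeProj_of_hasSum (ξ := fun ξ : Fin N → ℤ => ξ)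
        Function.injective_id hU hu ξ, hPU]
  rw [GloballySolvable, hrange]
  exact isClosed_biInter fun ξ _ => isClosed_eq (continuous_compatibility c ξ) continuous_const

end Sufficiency

/-! ### Necessity of the conditions -/

section Necessity

open SmoothTorus

variable {N m : ℕ} {c : SmoothTorus (N + 1) →L[ℂ] SmoothTorus (N + 1)}
variable {ι : Type*} {ξ : ι → Fin N → ℤ}

/-- Infinitely many distinct lattice points are unbounded, so a rapidly decreasing family along them
cannot stay above `δ`. This ends all three necessity arguments. -/
theorem RapidlyDecreasing.false_of_le [Infinite ι] {a : ι → ℝ} (ha : RapidlyDecreasing ξ a)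
    (hξ : Function.Injective ξ) {δ : ℝ} (hδ : 0 < δ) (h : ∀ i, δ ≤ a i) : False := by
  obtain ⟨C, hC⟩ := ha 1
  refine (Set.infinite_range_of_injective hξ) ((finite_latticeNorm_le (C / δ)).subset ?_)
  rintro _ ⟨i, rfl⟩
  change latticeNorm (ξ i) ≤ C / δ
  rw [le_div_iff₀ hδ]
  have h1 := hC i
  rw [pow_one] at h1
  nlinarith [h i, latticeNorm_nonneg (ξ i)]

/-- If the range of `P` is closed, a rapidly decreasing family of solvable modes is solved by a
rapidly decreasing family of modes. -/
theorem GloballySolvable.exists_rapidlyDecreasing (hP : GloballySolvable (tubeOperator c))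
    (htube : IsTubeType c) (hξ : Function.Injective ξ) {U : ι → SmoothTorus (N + 1)}
    (hU : ∀ i, IsMode (ξ i) (U i))
    (hR : ∀ k, RapidlyDecreasing ξ fun i => derivSeminorm (N + 1) k (tubeOperator c (U i))) :
    ∃ V : ι → SmoothTorus (N + 1), (∀ i, IsMode (ξ i) (V i)) ∧
      (∀ i, tubeOperator c (V i) = tubeOperator c (U i)) ∧
      RapidlyDecreasing ξ fun i => derivSeminorm (N + 1) 0 (V i) := by
  obtain ⟨f, hf⟩ := exists_hasSum_of_rapidlyDecreasing hξ hR
  -- The partial sums are images of finite sums of the `U i`, although the series of the `U i`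
  -- itself need not converge.
  obtain ⟨v, hv⟩ : f ∈ range (tubeOperator c) :=
    IsClosed.mem_of_tendsto hP hf (Filter.Eventually.of_forall fun s =>
      ⟨∑ i ∈ s, U i, map_sum _ _ _⟩)
  refine ⟨fun i => modeProj (ξ i) v, fun i => isMode_modeProj _ _, fun i => ?_, fun M => ?_⟩
  · rw [← htube.modeProj_tubeOperator, hv]
    exact modeProj_of_hasSum hξ (fun i => htube.isMode_tubeOperator (hU i)) hf i
  · obtain ⟨C, hC⟩ := exists_pow_mul_derivSeminorm_modeProj 0 M v
    exact ⟨C, fun i => hC (ξ i)⟩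

theorem IsTubeType.exp_mul_slice_eq (htube : IsTubeType c) {ξ : Fin N → ℤ}
    {W : SmoothTorus (N + 1)} (hW : IsMode ξ W) (h0 : tubeOperator c W = 0) (s t : ℝ) :
    Complex.exp (Complex.I * symbolPrimitive c ξ t) * slice W t =
      Complex.exp (Complex.I * symbolPrimitive c ξ s) * slice W s := by
  refine eq_exp_mul_of_homogeneous_ode (hasDerivAt_symbolPrimitive c ξ) (fun t => ?_) s t
  have h := htube.hasDerivAt_slice hW t
  rw [h0] at h
  exact h

/-- The difference is a periodic multiple of `e^{-iC}`, and off `𝒵` the factor `e^{2πi c_0} ≠ 1`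
makes it vanish. -/
theorem IsTubeType.eq_of_tubeOperator_eq (htube : IsTubeType c) {ξ : Fin N → ℤ}
    (hξ : ξ ∉ resonantSet c) {U V : SmoothTorus (N + 1)} (hU : IsMode ξ U) (hV : IsMode ξ V)
    (h : tubeOperator c V = tubeOperator c U) : V = U := by
  have hW := hV.sub hU
  have hW0 : tubeOperator c (V - U) = 0 := by rw [map_sub, h, sub_self]
  refine hV.ext hU fun t => ?_
  have h1 := htube.exp_mul_slice_eq hW hW0 t (t + 2 * π)
  rw [periodic_slice, symbolPrimitive_add_two_pi, mul_add, Complex.exp_add] at h1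
  have h2 := sub_ne_zero.2 ((mem_resonantSet_iff c ξ).not.1 hξ)
  have h3 := Complex.exp_ne_zero (Complex.I * symbolPrimitive c ξ t)
  have h4 : (Complex.exp (Complex.I * symbolPrimitive c ξ t) *
      (Complex.exp (Complex.I * (2 * π * symbolAverage c ξ)) - 1)) * slice (V - U) t = 0 := by
    linear_combination h1
  have h5 := (mul_eq_zero.1 h4).resolve_left (mul_ne_zero h3 h2)
  exact sub_eq_zero.1 h5

/-! #### The diophantine condition -/

/-- A normalized eigenmode of `P`. -/
theorem IsTubeType.exists_eigenmode (htube : IsTubeType c) (ξ : Fin N → ℤ) (τ : ℤ) :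
    ∃ U, IsMode ξ U ∧ derivSeminorm (N + 1) 0 U = 1 ∧
      tubeOperator c U = ((τ : ℂ) + symbolAverage c ξ) • U := by
  set μ := (τ : ℂ) + symbolAverage c ξ with hμ
  -- Over one period the exponent gains `2πi(μ - c_0) = 2πiτ`, so `u` is periodic.
  let u : ℝ → ℂ := fun t => Complex.exp (Complex.I * (μ * t - symbolPrimitive c ξ t))
  have hu : ContDiff ℝ ∞ u := (contDiff_const.mul
    ((contDiff_const.mul Complex.ofRealCLM.contDiff).sub (contDiff_symbolPrimitive c ξ))).cexp
  have hp : Function.Periodic u (2 * π) := fun t => by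
    rw [Complex.exp_eq_exp_iff_exists_int]
    refine ⟨τ, ?_⟩
    rw [symbolPrimitive_add_two_pi, hμ]
    push_cast
    ring
  have hd (t : ℝ) : HasDerivAt u (Complex.I * (μ * u t - tubeSymbol c t ξ * u t)) t := by
    have h1 : HasDerivAt (fun t : ℝ => Complex.I * (μ * t - symbolPrimitive c ξ t))
        (Complex.I * (μ * 1 - tubeSymbol c t ξ)) t :=
      (((hasDerivAt_id t).ofReal_comp.const_mul μ).sub
        (hasDerivAt_symbolPrimitive c ξ t)).const_mul Complex.I
    convert! h1.cexp using 1
    simp only [u]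
    ring
  set G := ofSlice ξ u hu hp with hG
  have hGm : IsMode ξ G := isMode_ofSlice hu hp
  have hPG : tubeOperator c G = μ • G :=
    htube.tubeOperator_ofSlice_eq (hGm.smul μ) hu hp fun t => by
      have : slice (μ • G) t = μ * u t := by
        rw [← congrFun (slice_ofSlice (ξ := ξ) hu hp) t]
        rfl
      rw [this]
      exact hd t
  have hpos : 0 < derivSeminorm (N + 1) 0 G := by
    refine lt_of_lt_of_le ?_ (norm_slice_le G 0)
    rw [hG, slice_ofSlice]
    exact norm_pos_iff.2 (Complex.exp_ne_zero _)
  refine ⟨(((derivSeminorm (N + 1) 0 G)⁻¹ : ℝ) : ℂ) • G, ?_, ?_, ?_⟩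
  · exact hGm.smul _
  · rw [map_smul_eq_mul, Complex.norm_real, Real.norm_of_nonneg (inv_nonneg.2 hpos.le),
      inv_mul_cancel₀ hpos.ne']
  · rw [map_smul, hPG, smul_comm]

theorem exists_pos_le_norm_of_not_mem_resonantSet {ξ : Fin N → ℤ} (hξ : ξ ∉ resonantSet c) :
    ∃ δ, 0 < δ ∧ ∀ τ : ℤ, δ ≤ ‖(τ : ℂ) + symbolAverage c ξ‖ := by
  have h1 : symbolAverage c ξ ∈ (range ((↑) : ℤ → ℂ))ᶜ := fun ⟨k, hk⟩ => hξ ⟨k, hk.symm⟩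
  obtain ⟨δ, hδ, hb⟩ := Metric.isOpen_iff.1 Complex.isClosed_range_intCast.isOpen_compl _ h1
  refine ⟨δ, hδ, fun τ => not_lt.1 fun hlt => ?_⟩
  refine hb (a := ((-τ : ℤ) : ℂ)) ?_ ⟨_, rfl⟩
  rw [mem_ball_iff_norm', Int.cast_neg, sub_neg_eq_add, add_comm]
  exact hlt

/-- Finitely many frequencies satisfy `|ξ| ≤ R`, and each nonresonant one has positive distance to
the integers. They can be absorbed into the constant, so a failure must persist beyond `R`. -/
theorem exists_small_divisor_of_not_diophantineCondition (h : ¬DiophantineCondition c) (R : ℝ)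
    (M : ℕ) : ∃ ξ : Fin N → ℤ, ∃ τ : ℤ, ξ ∉ resonantSet c ∧ R < latticeNorm ξ ∧
      (1 + latticeNorm ξ) ^ M * ‖(τ : ℂ) + symbolAverage c ξ‖ ≤ 1 := by
  by_contra! hcon
  refine h ?_
  have hfin : ∀ᶠ ε in nhdsWithin (0 : ℝ) (Ioi 0), ∀ ξ ∈ {ξ : Fin N → ℤ | latticeNorm ξ ≤ R},
      ξ ∉ resonantSet c → ∀ τ : ℤ, ε ≤ ‖(τ : ℂ) + symbolAverage c ξ‖ := by
    refine (Set.Finite.eventually_all (finite_latticeNorm_le R)).2 fun ξ _ => ?_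
    by_cases hξ : ξ ∈ resonantSet c
    · exact Filter.Eventually.of_forall fun ε h' => absurd hξ h'
    · obtain ⟨δ, hδ, hle⟩ := exists_pos_le_norm_of_not_mem_resonantSet hξ
      filter_upwards [Ioo_mem_nhdsGT hδ] with ε hε _ τ
      exact hε.2.le.trans (hle τ)
  obtain ⟨ε, hε, hε1, hε0⟩ := (hfin.and (Ioo_mem_nhdsGT one_pos)).exists
  refine ⟨ε, hε1, M, fun τ ξ hξ => ?_⟩
  have hw := pow_pos (zero_lt_one.trans_le (one_le_one_add_latticeNorm ξ)) M
  rw [zpow_neg, zpow_natCast, ← div_eq_mul_inv, div_le_iff₀ hw]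
  rcases le_or_gt (latticeNorm ξ) R with hR | hR
  · exact (hε ξ hR hξ τ).trans (le_mul_of_one_le_right (norm_nonneg _)
      (one_le_pow₀ (one_le_one_add_latticeNorm ξ)))
  · have := hcon ξ τ hξ hR
    rw [mul_comm]
    linarith

/-- Normalised eigenmodes with eigenvalues `μ n` have rapidly decreasing images. Off `𝒵` they are
the only solutions, and their norm is `1`. -/
theorem GloballySolvable.diophantineCondition (hP : GloballySolvable (tubeOperator c))
    (hord : HasOrder c (m : ℝ)) (htube : IsTubeType c) : DiophantineCondition c := by
  by_contra hD
  choose g τ hg hR hle using exists_small_divisor_of_not_diophantineCondition hD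
  -- The threshold at each step is the norm of the previous frequency, so the norms increase
  -- strictly and the frequencies are distinct.
  let ρ : ℕ → ℝ := fun n => Nat.rec (0 : ℝ) (fun n r => latticeNorm (g r n)) n
  let ξ : ℕ → Fin N → ℤ := fun n => g (ρ n) n
  have hρ (n : ℕ) : ρ (n + 1) = latticeNorm (ξ n) := rfl
  have hmono : StrictMono ρ := strictMono_nat_of_lt_succ fun n => hR (ρ n) n
  have hinj : Function.Injective ξ := fun a b hab => by
    have : ρ (a + 1) = ρ (b + 1) := by rw [hρ, hρ, hab]
    exact Nat.succ_injective (hmono.injective this)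
  let μ : ℕ → ℂ := fun n => (τ (ρ n) n : ℂ) + symbolAverage c (ξ n)
  have hμ (n : ℕ) : (1 + latticeNorm (ξ n)) ^ n * ‖μ n‖ ≤ 1 := hle (ρ n) n
  have hμ1 (n : ℕ) : ‖μ n‖ ≤ 1 :=
    (le_mul_of_one_le_left (norm_nonneg _) (one_le_pow₀ (one_le_one_add_latticeNorm _))).trans
      (hμ n)
  have hμR : RapidlyDecreasing ξ fun n => ‖μ n‖ := by
    intro M
    have hnn (n : ℕ) : 0 ≤ (1 + latticeNorm (ξ n)) ^ M * ‖μ n‖ :=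
      mul_nonneg (pow_nonneg (zero_le_one.trans (one_le_one_add_latticeNorm _)) _) (norm_nonneg _)
    refine ⟨1 + ∑ n ∈ Finset.range M, (1 + latticeNorm (ξ n)) ^ M * ‖μ n‖, fun n => ?_⟩
    rcases lt_or_ge n M with h | h
    · have := Finset.single_le_sum (fun n _ => hnn n) (Finset.mem_range.2 h)
      linarith
    · have h1 := mul_le_mul_of_nonneg_right
        (pow_le_pow_right₀ (one_le_one_add_latticeNorm (ξ n)) h) (norm_nonneg (μ n))
      have h2 := Finset.sum_nonneg fun n (_ : n ∈ Finset.range M) => hnn n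
      linarith [hμ n]
  choose U hU hU1 hPU using fun n => htube.exists_eigenmode (ξ n) (τ (ρ n) n)
  have hPU' (n : ℕ) : tubeOperator c (U n) = μ n • U n := hPU n
  -- Regularity is applied to the images `P U_n`, since the `U_n` do not decay; it closes up because
  -- `P (P U_n) = μ_n P U_n` with `|μ_n| ≤ 1`.
  have hreg := htube.rapidlyDecreasing_derivSeminorm hord
    (fun n => htube.isMode_tubeOperator (hU n))
    (by simpa only [hPU', map_smul_eq_mul, hU1, mul_one] using hμR) fun k hk => hk.mono fun n => by
      rw [hPU', map_smul, hPU', map_smul_eq_mul]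
      exact mul_le_of_le_one_left (apply_nonneg _ _) (hμ1 n)
  obtain ⟨V, hV, hVU, hVR⟩ := hP.exists_rapidlyDecreasing htube hinj hU hreg
  refine hVR.false_of_le hinj one_pos fun n => ?_
  rw [htube.eq_of_tubeOperator_eq (hg _ _) (hU n) (hV n) (hVU n), hU1]

end Necessity

/-! #### Periodization -/

section Periodize

/-- The `2π`-periodic function that agrees with `g` on `[a, a + 2π)`. -/
noncomputable def periodize (a : ℝ) (g : ℝ → ℂ) (t : ℝ) : ℂ := g (toIcoMod Real.two_pi_pos a t)

theorem periodic_periodize (a : ℝ) (g : ℝ → ℂ) : Function.Periodic (periodize a g) (2 * π) :=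
  fun t => by rw [periodize, toIcoMod_periodic Real.two_pi_pos a t, periodize]

variable {a p₁ p₂ : ℝ} {g g' : ℝ → ℂ}

/-- The support lies strictly inside one period, so the agreement extends past both ends of the
period up to the neighbouring copies of the support. -/
theorem periodize_eq (h1 : a < p₁) (h2 : p₂ < a + 2 * π) (hg : ∀ t ∉ Icc p₁ p₂, g t = 0) {t : ℝ}
    (ht : t ∈ Ioo (p₂ - 2 * π) (p₁ + 2 * π)) : periodize a g t = g t := by
  have key (s : ℝ) (hs : s ∈ Ico a (a + 2 * π)) : periodize a g s = g s := by
    rw [periodize, (toIcoMod_eq_self Real.two_pi_pos).2 hs]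
  rcases lt_or_ge p₂ p₁ with h12 | h12
  · rw [periodize, hg _ fun h => not_le.2 h12 (h.1.trans h.2),
      hg _ fun h => not_le.2 h12 (h.1.trans h.2)]
  rcases lt_or_ge t a with h | h
  · rw [← periodic_periodize a g t, key _ ⟨by linarith [ht.1], by linarith⟩,
      hg _ fun h' => by linarith [ht.1, h'.2], hg _ fun h' => by linarith [h'.1]]
  · rcases lt_or_ge t (a + 2 * π) with h' | h'
    · exact key t ⟨h, h'⟩
    · have h3 := periodic_periodize a g (t - 2 * π)
      rw [sub_add_cancel] at h3
      rw [h3, key _ ⟨by linarith, by linarith [ht.2]⟩, hg _ fun h' => by linarith [ht.2, h'.1],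
        hg _ fun h'' => by linarith [h''.2]]

/-- The shift and the neighbourhood do not depend on `g`, so they serve a function and its
derivative at once. -/
theorem exists_eventually_periodize_eq (h1 : a < p₁) (h2 : p₂ < a + 2 * π) (t : ℝ) :
    ∃ k : ℤ, ∀ᶠ s in nhds t, ∀ g : ℝ → ℂ, (∀ t ∉ Icc p₁ p₂, g t = 0) →
      periodize a g s = g (s - k • (2 * π)) := by
  refine ⟨toIcoDiv Real.two_pi_pos a t, ?_⟩
  have h3 := toIcoMod_mem_Ico Real.two_pi_pos a t
  have hc : Continuous fun s : ℝ => s - toIcoDiv Real.two_pi_pos a t • (2 * π) := by fun_prop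
  have h4 : t - toIcoDiv Real.two_pi_pos a t • (2 * π) ∈ Ioo (p₂ - 2 * π) (p₁ + 2 * π) :=
    ⟨by linarith [h3.1, toIcoMod.eq_def Real.two_pi_pos a t],
      by linarith [h3.2, toIcoMod.eq_def Real.two_pi_pos a t]⟩
  filter_upwards [hc.continuousAt.eventually_mem (isOpen_Ioo.mem_nhds h4)] with s hs g hg
  rw [← (periodic_periodize a g).sub_zsmul_eq (toIcoDiv Real.two_pi_pos a t),
    periodize_eq h1 h2 hg hs]

theorem contDiff_periodize (h1 : a < p₁) (h2 : p₂ < a + 2 * π)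
    (hg : ∀ t ∉ Icc p₁ p₂, g t = 0) (hs : ContDiff ℝ ∞ g) : ContDiff ℝ ∞ (periodize a g) := by
  refine contDiff_iff_contDiffAt.2 fun t => ?_
  obtain ⟨k, hk⟩ := exists_eventually_periodize_eq h1 h2 t
  have : ContDiff ℝ ∞ fun s => g (s - k • (2 * π)) := hs.comp (contDiff_id.sub contDiff_const)
  exact this.contDiffAt.congr_of_eventuallyEq (hk.mono fun s hs => hs g hg)

theorem hasDerivAt_periodize (h1 : a < p₁) (h2 : p₂ < a + 2 * π)
    (hg : ∀ t ∉ Icc p₁ p₂, g t = 0) (hg' : ∀ t ∉ Icc p₁ p₂, g' t = 0)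
    (hd : ∀ t, HasDerivAt g (g' t) t) (t : ℝ) :
    HasDerivAt (periodize a g) (periodize a g' t) t := by
  obtain ⟨k, hk⟩ := exists_eventually_periodize_eq h1 h2 t
  rw [hk.self_of_nhds g' hg']
  exact ((hd _).comp_sub_const t (k • (2 * π))).congr_of_eventuallyEq
    (hk.mono fun s hs => hs g hg)

theorem norm_periodize_le {K : ℝ} (h : ∀ t, ‖g t‖ ≤ K) (t : ℝ) : ‖periodize a g t‖ ≤ K := h _

end Periodize

/-! #### Concentrated families of modes -/

section Concentration

open SmoothTorus

variable {N m : ℕ} {c : SmoothTorus (N + 1) →L[ℂ] SmoothTorus (N + 1)} {ξ : Fin N → ℤ}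

theorem IsPosHomogeneous.symbolPrimitive_nsmul (hhom : IsPosHomogeneous c m) (ξ : Fin N → ℤ)
    {n : ℕ} (hn : 1 ≤ n) (t : ℝ) :
    symbolPrimitive c ((n : ℤ) • ξ) t = (n : ℂ) ^ m * symbolPrimitive c ξ t := by
  rw [symbolPrimitive, symbolPrimitive, ← intervalIntegral.integral_const_mul]
  simp only [hhom _ ξ n hn]

theorem IsPosHomogeneous.symbolAverage_nsmul (hhom : IsPosHomogeneous c m) (ξ : Fin N → ℤ)
    {n : ℕ} (hn : 1 ≤ n) :
    symbolAverage c ((n : ℤ) • ξ) = (n : ℂ) ^ m * symbolAverage c ξ := by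
  have h : (2 * π : ℂ) ≠ 0 := by exact_mod_cast Real.two_pi_pos.ne'
  refine mul_left_cancel₀ h ?_
  rw [← symbolPrimitive_two_pi, hhom.symbolPrimitive_nsmul ξ hn, symbolPrimitive_two_pi]
  ring

/-- The function `h e^{-l (i C + K)}`, where `C` is the primitive of `c(·, ξ)`. -/
noncomputable def wave (c : SmoothTorus (N + 1) →L[ℂ] SmoothTorus (N + 1)) (ξ : Fin N → ℤ)
    (K l : ℝ) (h : ℝ → ℂ) (t : ℝ) : ℂ :=
  h t * Complex.exp ((l : ℂ) * (-(Complex.I * symbolPrimitive c ξ t) - K))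

theorem norm_wave (c : SmoothTorus (N + 1) →L[ℂ] SmoothTorus (N + 1)) (ξ : Fin N → ℤ)
    (K l : ℝ) (h : ℝ → ℂ) (t : ℝ) :
    ‖wave c ξ K l h t‖ = ‖h t‖ * Real.exp (l * (imPrimitive c t ξ - K)) := by
  rw [wave, norm_mul, Complex.norm_exp, Complex.re_ofReal_mul]
  simp [im_symbolPrimitive]

theorem contDiff_wave {h : ℝ → ℂ} (hh : ContDiff ℝ ∞ h) (K l : ℝ) :
    ContDiff ℝ ∞ (wave c ξ K l h) :=
  hh.mul (contDiff_const.mul (((contDiff_const.mul (contDiff_symbolPrimitive c ξ)).neg).sub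
    contDiff_const)).cexp

theorem hasDerivAt_wave {h : ℝ → ℂ} {t : ℝ} {d : ℂ} (hh : HasDerivAt h d t) (K l : ℝ) :
    HasDerivAt (wave c ξ K l h) (d * Complex.exp ((l : ℂ) *
      (-(Complex.I * symbolPrimitive c ξ t) - K)) -
        Complex.I * (l * tubeSymbol c t ξ) * wave c ξ K l h t) t := by
  have h1 := (((hasDerivAt_symbolPrimitive c ξ t).const_mul Complex.I).neg.sub_const
    (K : ℂ)).const_mul (l : ℂ)
  convert! hh.mul h1.cexp using 1
  rw [wave]
  simp only [Pi.neg_apply]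
  ring

variable {a p₁ p₂ K : ℝ}

/-- The operator `P` acts on concentrated modes by differentiation of the amplitude. -/
theorem IsTubeType.slice_tubeOperator_wave (htube : IsTubeType c) (hhom : IsPosHomogeneous c m)
    (h1 : a < p₁) (h2 : p₂ < a + 2 * π) {h : ℝ → ℂ} (hh : ContDiff ℝ ∞ h)
    (hs : ∀ t ∉ Icc p₁ p₂, h t = 0) {n : ℕ} (hn : 1 ≤ n) {U : SmoothTorus (N + 1)}
    (hU : IsMode ((n : ℤ) • ξ) U) (hUs : slice U = periodize a (wave c ξ K ((n : ℝ) ^ m) h)) :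
    slice (tubeOperator c U) =
      periodize a (wave c ξ K ((n : ℝ) ^ m) fun t => -Complex.I * deriv h t) := by
  have hsw : ∀ t ∉ Icc p₁ p₂, wave c ξ K ((n : ℝ) ^ m) h t = 0 := fun t ht => by
    rw [wave, hs t ht, zero_mul]
  have hder0 : ∀ t ∉ Icc p₁ p₂, deriv h t = 0 := fun t ht => by
    have : h =ᶠ[nhds t] fun _ => 0 := by
      filter_upwards [isClosed_Icc.isOpen_compl.mem_nhds ht] with s hs' using hs s hs'
    rw [this.deriv_eq, deriv_const]
  have hd (t : ℝ) := hasDerivAt_wave (c := c) (ξ := ξ)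
    ((hh.differentiable (by simp)) t).hasDerivAt K ((n : ℝ) ^ m)
  have hd' := hasDerivAt_periodize h1 h2 hsw (fun t ht => by
    rw [hder0 t ht, hsw t ht, zero_mul, mul_zero, sub_zero]) hd
  funext t
  have h3 := htube.hasDerivAt_slice hU t
  rw [hUs] at h3
  have h4 := h3.unique (hd' t)
  have hper : tubeSymbol c (toIcoMod Real.two_pi_pos a t) ξ = tubeSymbol c t ξ := by
    rw [toIcoMod]
    exact (periodic_tubeSymbol c ξ).sub_zsmul_eq _
  -- By homogeneity `c(t, nξ) = n^m c(t, ξ)` is exactly the coefficient produced by differentiating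
  -- the exponential, so only the derivative of the amplitude remains.
  rw [hhom t ξ n hn] at h4
  simp only [periodize, hper] at h4
  simp only [periodize]
  rw [wave]
  push_cast at h4 ⊢
  linear_combination (-Complex.I) * h4 + (slice (tubeOperator c U) t) * Complex.I_sq

theorem pow_mul_exp_neg_le {δ : ℝ} (hδ : 0 < δ) (M n : ℕ) :
    (n : ℝ) ^ M * Real.exp (-(n * δ)) ≤ M.factorial / δ ^ M := by
  have h := Real.pow_div_factorial_le_exp (n * δ) (by positivity) M
  have hf : (0 : ℝ) < M.factorial := by exact_mod_cast M.factorial_pos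
  rw [div_le_iff₀ hf, mul_pow] at h
  rw [Real.exp_neg, ← div_eq_mul_inv, div_le_div_iff₀ (Real.exp_pos _) (by positivity)]
  linarith

variable {ι : Type*} {ν : ι → ℕ}

theorem rapidlyDecreasing_exp_neg (ξ : Fin N → ℤ) (hν : ∀ i, 1 ≤ ν i) {δ H : ℝ} (hδ : 0 < δ)
    (hH : 0 ≤ H) : RapidlyDecreasing (fun i => (ν i : ℤ) • ξ)
      fun i => H * Real.exp (-(ν i * δ)) := by
  intro M
  refine ⟨(1 + latticeNorm ξ) ^ M * (H * (M.factorial / δ ^ M)), fun i => ?_⟩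
  have hn : (1 : ℝ) ≤ ν i := by exact_mod_cast hν i
  have hL := latticeNorm_nonneg ξ
  have h1 : 1 + latticeNorm ((ν i : ℤ) • ξ) ≤ (1 + latticeNorm ξ) * ν i := by
    rw [latticeNorm_nsmul]
    linarith
  have h0 : 0 ≤ 1 + latticeNorm ((ν i : ℤ) • ξ) :=
    zero_le_one.trans (one_le_one_add_latticeNorm _)
  calc (1 + latticeNorm ((ν i : ℤ) • ξ)) ^ M * (H * Real.exp (-(ν i * δ)))
      ≤ ((1 + latticeNorm ξ) * ν i) ^ M * (H * Real.exp (-(ν i * δ))) := by gcongr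
    _ = (1 + latticeNorm ξ) ^ M * (H * ((ν i : ℝ) ^ M * Real.exp (-(ν i * δ)))) := by
        rw [mul_pow]
        ring
    _ ≤ _ := by
        gcongr
        exact pow_mul_exp_neg_le hδ M (ν i)

/-- Concentrated modes whose amplitude lives where `B ≤ K - δ` decrease rapidly. -/
theorem IsTubeType.rapidlyDecreasing_wave (hm : 1 ≤ m) (hord : HasOrder c (m : ℝ))
    (htube : IsTubeType c) (hhom : IsPosHomogeneous c m) (h1 : a < p₁) (h2 : p₂ < a + 2 * π)
    (hν : ∀ i, 1 ≤ ν i) {A : Set ℝ} (hAc : IsClosed A) (hA : A ⊆ Icc p₁ p₂) {δ : ℝ} (hδ : 0 < δ)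
    (hB : ∀ t ∈ A, imPrimitive c t ξ ≤ K - δ) (k : ℕ) {h : ℝ → ℂ} (hh : ContDiff ℝ ∞ h)
    (hs : ∀ t ∉ A, h t = 0) {U : ι → SmoothTorus (N + 1)}
    (hU : ∀ i, IsMode ((ν i : ℤ) • ξ) (U i))
    (hUs : ∀ i, slice (U i) = periodize a (wave c ξ K ((ν i : ℝ) ^ m) h)) :
    RapidlyDecreasing (fun i => (ν i : ℤ) • ξ) fun i => derivSeminorm (N + 1) k (U i) := by
  -- Amplitude and modes vary in the induction, because `P` turns a wave with amplitude `h` into one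
  -- with amplitude `-i h'`, again vanishing off `A`.
  induction k using Nat.strong_induction_on generalizing h U with
  | _ k ih =>
    cases k with
    | zero =>
      obtain ⟨H, hH⟩ := (isCompact_Icc.of_isClosed_subset hAc hA).exists_bound_of_continuousOn
        hh.continuous.continuousOn
      refine (rapidlyDecreasing_exp_neg ξ hν hδ (abs_nonneg H)).mono fun i => ?_
      refine (hU i).derivSeminorm_zero_le fun t => ?_
      rw [hUs]
      refine norm_periodize_le (fun s => ?_) t
      rw [norm_wave]
      by_cases hsA : s ∈ A
      · refine mul_le_mul ((hH s hsA).trans (le_abs_self H)) (Real.exp_le_exp.2 ?_)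
          (Real.exp_pos _).le (abs_nonneg H)
        have hn : (ν i : ℝ) ≤ (ν i : ℝ) ^ m :=
          le_self_pow₀ (by exact_mod_cast hν i) (by omega)
        have := hB s hsA
        have hn0 : (0 : ℝ) ≤ (ν i : ℝ) ^ m := by positivity
        nlinarith
      · rw [hs s hsA, norm_zero, zero_mul]
        positivity
    | succ k =>
      refine htube.rapidlyDecreasing_succ hord hU (fun l hl => ih l (Nat.lt_succ_of_le hl) hh hs hU
        hUs) (ih k (Nat.lt_succ_self k) (h := fun t => -Complex.I * deriv h t)
          (contDiff_const.mul (contDiff_infty_iff_deriv.1 hh).2) (fun t ht => ?_)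
          (fun i => htube.isMode_tubeOperator (hU i)) fun i => ?_)
      · have : h =ᶠ[nhds t] fun _ => 0 := by
          filter_upwards [hAc.isOpen_compl.mem_nhds ht] with s hs' using hs s hs'
        rw [this.deriv_eq, deriv_const, mul_zero]
      · exact htube.slice_tubeOperator_wave hhom h1 h2 hh (fun t ht => hs t fun h' => ht (hA h'))
          (hν i) (hU i) (hUs i)

/-- A cutoff function that is `1` away from the ends of an interval. -/
theorem exists_cutoff {p₁ p₂ ε : ℝ} (hε : 0 < ε) (h : 2 * ε < p₂ - p₁) :
    ∃ ψ : ℝ → ℂ, ContDiff ℝ ∞ ψ ∧ (∀ t ∈ Icc (p₁ + ε) (p₂ - ε), ψ t = 1) ∧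
      ∀ t ∉ Icc p₁ p₂, ψ t = 0 := by
  let b : ContDiffBump ((p₁ + p₂) / 2 : ℝ) :=
    ⟨(p₂ - p₁) / 2 - ε, (p₂ - p₁) / 2, by linarith, by linarith⟩
  refine ⟨fun t => (b t : ℂ), Complex.ofRealCLM.contDiff.comp b.contDiff, fun t ht => ?_,
    fun t ht => ?_⟩
  · change ((b t : ℝ) : ℂ) = 1
    rw [b.one_of_mem_closedBall, Complex.ofReal_one]
    change |t - (p₁ + p₂) / 2| ≤ (p₂ - p₁) / 2 - ε
    rw [abs_le]
    exact ⟨by linarith [ht.1], by linarith [ht.2]⟩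
  · change ((b t : ℝ) : ℂ) = 0
    rw [b.zero_of_le_dist, Complex.ofReal_zero]
    change (p₂ - p₁) / 2 ≤ |t - (p₁ + p₂) / 2|
    by_contra! hlt
    rw [abs_lt] at hlt
    exact ht ⟨by linarith, by linarith⟩

/-- If `B(·, ξ)` is at least `K` at a point `q` and less than `K` at two points `p₁ < q < p₂`, there
are modes at the multiples of `ξ` that are concentrated between `p₁` and `p₂`, of modulus at least
`1` at `q`, and with rapidly decreasing image under `P`. -/
theorem IsTubeType.exists_concentrated (hm : 1 ≤ m) (hord : HasOrder c (m : ℝ))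
    (htube : IsTubeType c) (hhom : IsPosHomogeneous c m) (hν : ∀ i, 1 ≤ ν i) {q : ℝ}
    (hp₁ : p₁ < q) (hp₂ : q < p₂) (hp : p₂ < p₁ + 2 * π) (hB₁ : imPrimitive c p₁ ξ < K)
    (hB₂ : imPrimitive c p₂ ξ < K) (hBq : K ≤ imPrimitive c q ξ) :
    ∃ U : ι → SmoothTorus (N + 1), (∀ i, IsMode ((ν i : ℤ) • ξ) (U i)) ∧
      (∀ i, ‖slice (U i) q‖ = Real.exp ((ν i : ℝ) ^ m * (imPrimitive c q ξ - K))) ∧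
      (∀ i, ∀ t ∈ Ioo p₂ (p₁ + 2 * π), slice (U i) t = 0) ∧
      ∀ k, RapidlyDecreasing (fun i => (ν i : ℤ) • ξ)
        fun i => derivSeminorm (N + 1) k (tubeOperator c (U i)) := by
  have hcont := continuous_imPrimitive c ξ
  obtain ⟨δ, hδ, hδ₁, hδ₂⟩ : ∃ δ, 0 < δ ∧ imPrimitive c p₁ ξ < K - δ ∧
      imPrimitive c p₂ ξ < K - δ := by
    refine ⟨min (K - imPrimitive c p₁ ξ) (K - imPrimitive c p₂ ξ) / 2, ?_, ?_, ?_⟩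
    · exact half_pos (lt_min (by linarith) (by linarith))
    · linarith [min_le_left (K - imPrimitive c p₁ ξ) (K - imPrimitive c p₂ ξ)]
    · linarith [min_le_right (K - imPrimitive c p₁ ξ) (K - imPrimitive c p₂ ξ)]
  obtain ⟨ε₁, hε₁, hb₁⟩ := Metric.isOpen_iff.1 (isOpen_lt hcont continuous_const) p₁ hδ₁
  obtain ⟨ε₂, hε₂, hb₂⟩ := Metric.isOpen_iff.1 (isOpen_lt hcont continuous_const) p₂ hδ₂
  obtain ⟨ε, hε, hle⟩ : ∃ ε, 0 < ε ∧ ε < ε₁ ∧ ε < ε₂ ∧ 2 * ε < p₂ - p₁ := by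
    refine ⟨min (min ε₁ ε₂) (p₂ - p₁) / 3, ?_, ?_, ?_, ?_⟩
    · have : 0 < min (min ε₁ ε₂) (p₂ - p₁) := lt_min (lt_min hε₁ hε₂) (by linarith)
      positivity
    all_goals
      have h1 := min_le_left (min ε₁ ε₂) (p₂ - p₁)
      have h2 := min_le_right (min ε₁ ε₂) (p₂ - p₁)
      have h3 := min_le_left ε₁ ε₂
      have h4 := min_le_right ε₁ ε₂
      linarith
  -- The derivative of the cutoff is confined to `A`, where `B ≤ K - δ`; since `B q ≥ K`, the point
  -- `q` lies where the cutoff is `1`.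
  set A := Icc p₁ (p₁ + ε) ∪ Icc (p₂ - ε) p₂ with hAdef
  have hB : ∀ t ∈ A, imPrimitive c t ξ ≤ K - δ := by
    rintro t (ht | ht)
    · refine (hb₁ (a := t) ?_).le
      rw [mem_ball_iff_norm, Real.norm_eq_abs, abs_lt]
      exact ⟨by linarith [ht.1], by linarith [ht.2]⟩
    · refine (hb₂ (a := t) ?_).le
      rw [mem_ball_iff_norm, Real.norm_eq_abs, abs_lt]
      exact ⟨by linarith [ht.1], by linarith [ht.2]⟩
  have hA : A ⊆ Icc p₁ p₂ := union_subset (Icc_subset_Icc le_rfl (by linarith))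
    (Icc_subset_Icc (by linarith) le_rfl)
  have hAc : IsClosed A := isClosed_Icc.union isClosed_Icc
  have hqA : q ∉ A := fun h => by linarith [hB q h]
  have hmid {t : ℝ} (ht : t ∈ Icc p₁ p₂) (htA : t ∉ A) : t ∈ Ioo (p₁ + ε) (p₂ - ε) := by
    refine ⟨not_le.1 fun h => htA (Or.inl ⟨ht.1, h⟩), not_le.1 fun h => htA (Or.inr ⟨h, ht.2⟩)⟩
  obtain ⟨ψ, hψ, hψ1, hψ0⟩ := exists_cutoff hε hle.2.2
  have hψ' : ∀ t ∉ A, -Complex.I * deriv ψ t = 0 := by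
    intro t ht
    by_cases htI : t ∈ Icc p₁ p₂
    · have : ψ =ᶠ[nhds t] fun _ => 1 := by
        filter_upwards [isOpen_Ioo.mem_nhds (hmid htI ht)] with s hs
        exact hψ1 s (Ioo_subset_Icc_self hs)
      rw [this.deriv_eq, deriv_const, mul_zero]
    · have : ψ =ᶠ[nhds t] fun _ => 0 := by
        filter_upwards [isClosed_Icc.isOpen_compl.mem_nhds htI] with s hs
        exact hψ0 s hs
      rw [this.deriv_eq, deriv_const, mul_zero]
  -- The period used for periodization is centred at the midpoint of `p₁` and `p₂`.
  have ha₁ : (p₁ + p₂ - 2 * π) / 2 < p₁ := by linarith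
  have ha₂ : p₂ < (p₁ + p₂ - 2 * π) / 2 + 2 * π := by linarith
  have hw0 (l : ℝ) : ∀ t ∉ Icc p₁ p₂, wave c ξ K l ψ t = 0 := fun t ht => by
    rw [wave, hψ0 t ht, zero_mul]
  have hU (i : ι) : IsMode ((ν i : ℤ) • ξ) (ofSlice ((ν i : ℤ) • ξ)
      (periodize ((p₁ + p₂ - 2 * π) / 2) (wave c ξ K ((ν i : ℝ) ^ m) ψ))
      (contDiff_periodize ha₁ ha₂ (hw0 _) (contDiff_wave hψ K _)) (periodic_periodize _ _)) :=
    isMode_ofSlice _ _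
  refine ⟨_, hU, fun i => ?_, fun i t ht => ?_, fun k => ?_⟩
  · rw [slice_ofSlice, periodize_eq ha₁ ha₂ (hw0 _) ⟨by linarith, by linarith⟩, norm_wave,
      hψ1 q (Ioo_subset_Icc_self (hmid ⟨hp₁.le, hp₂.le⟩ hqA)), norm_one, one_mul]
  · rw [slice_ofSlice, periodize_eq ha₁ ha₂ (hw0 _) ⟨by linarith [ht.1, Real.pi_pos], ht.2⟩]
    exact hw0 _ t fun h => absurd ht.1 (not_lt.2 h.2)
  · refine htube.rapidlyDecreasing_wave hm hord hhom ha₁ ha₂ hν hAc hA hδ hB k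
      (h := fun t => -Complex.I * deriv ψ t)
      (contDiff_const.mul (contDiff_infty_iff_deriv.1 hψ).2) hψ'
      (fun i => htube.isMode_tubeOperator (hU i)) fun i => ?_
    exact htube.slice_tubeOperator_wave hhom ha₁ ha₂ hψ hψ0 (hν i) (hU i) (slice_ofSlice _ _)

theorem injective_zsmul_of_injective (hν : Function.Injective ν) (hξ : ξ ≠ 0) :
    Function.Injective fun i => (ν i : ℤ) • ξ := by
  intro i j hij
  obtain ⟨l, hl⟩ := Function.ne_iff.1 hξ
  have h : (ν i : ℤ) * ξ l = (ν j : ℤ) * ξ l := congrFun hij l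
  exact hν (by exact_mod_cast mul_right_cancel₀ hl h)

/-! #### The sign condition and the connectedness condition -/

/-- If all large multiples were resonant, `n^m c_0` and `(n + 1)^m c_0` would be integers for some
`n`. These powers are coprime, so Bézout would make `c_0` an integer. -/
theorem IsPosHomogeneous.infinite_not_mem_resonantSet (hhom : IsPosHomogeneous c m)
    (hξ : ξ ∉ resonantSet c) : {n : ℕ | 1 ≤ n ∧ (n : ℤ) • ξ ∉ resonantSet c}.Infinite := by
  intro hfin
  obtain ⟨n₀, hn₀⟩ := hfin.bddAbove
  have key (n : ℕ) (hn : n₀ < n) : ∃ k : ℤ, (n : ℂ) ^ m * symbolAverage c ξ = k := by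
    have h1 : 1 ≤ n := by omega
    have h2 : (n : ℤ) • ξ ∈ resonantSet c := by
      by_contra h
      have := hn₀ ⟨h1, h⟩
      omega
    obtain ⟨k, hk⟩ := h2
    exact ⟨k, by rw [← hhom.symbolAverage_nsmul ξ h1, hk]⟩
  obtain ⟨k, hk⟩ := key (n₀ + 1) (Nat.lt_succ_self _)
  obtain ⟨l, hl⟩ := key (n₀ + 2) (by omega)
  have hcop : IsCoprime (((n₀ + 1 : ℕ) : ℤ) ^ m) (((n₀ + 2 : ℕ) : ℤ) ^ m) := by
    refine IsCoprime.pow ⟨-1, 1, ?_⟩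
    push_cast
    ring
  obtain ⟨x, y, hxy⟩ := hcop
  refine hξ ⟨x * k + y * l, ?_⟩
  have hxy' : (x : ℂ) * ((n₀ + 1 : ℕ) : ℂ) ^ m + y * ((n₀ + 2 : ℕ) : ℂ) ^ m = 1 := by
    exact_mod_cast hxy
  push_cast at hk hl hxy' ⊢
  linear_combination (x : ℂ) * hk + (y : ℂ) * hl - symbolAverage c ξ * hxy'

theorem exists_lt_of_hasDerivAt_pos {f : ℝ → ℝ} {d t : ℝ} (hf : HasDerivAt f d t) (hd : 0 < d)
    {ε : ℝ} (hε : 0 < ε) : ∃ s ∈ Ioo (t - ε) t, f s < f t := by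
  have h1 := (hasDerivAt_iff_tendsto_slope.1 hf).eventually (lt_mem_nhds hd)
  have h2 : ∀ᶠ s in nhdsWithin t (Iio t), 0 < slope f t s :=
    h1.filter_mono (nhdsWithin_mono _ fun s hs => ne_of_lt hs)
  obtain ⟨s, hs, hs'⟩ := (h2.and (Ioo_mem_nhdsLT (show t - ε < t by linarith))).exists
  refine ⟨s, hs', ?_⟩
  rw [slope_def_field] at hs
  have h3 : s - t < 0 := by linarith [hs'.2]
  by_contra! hcon
  exact absurd hs (not_lt.2 (div_nonpos_of_nonneg_of_nonpos (by linarith) h3.le))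

theorem exists_lt_of_hasDerivAt_neg {f : ℝ → ℝ} {d t : ℝ} (hf : HasDerivAt f d t) (hd : d < 0)
    {ε : ℝ} (hε : 0 < ε) : ∃ s ∈ Ioo t (t + ε), f s < f t := by
  have h0 : HasDerivAt (fun s => f (-s)) (-d) (-t) := by
    have := HasDerivAt.scomp (-t) (by rwa [neg_neg]) (hasDerivAt_neg (-t)) (g₁ := f) (g₁' := d)
    simpa [Function.comp_def] using this
  obtain ⟨s, hs, hlt⟩ := exists_lt_of_hasDerivAt_pos h0 (by linarith) hε
  exact ⟨-s, ⟨by linarith [hs.2], by linarith [hs.1]⟩, by simpa using hlt⟩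

/-- Take `b > 0` at `t₁` and `b < 0` at a later `t₂` within one period. A maximum point of `B` on
`[t₁, t₂]` is a peak, because `B` takes smaller values just left of `t₁` and just right of `t₂`.
Periodicity of `B`, which may fail off `𝒵`, is not needed. -/
theorem exists_peak_of_sign_change
    (h : ¬((∀ t : ℝ, 0 ≤ imSymbol c t ξ) ∨ (∀ t : ℝ, imSymbol c t ξ ≤ 0))) :
    ∃ p₁ q p₂, p₁ < q ∧ q < p₂ ∧ p₂ < p₁ + 2 * π ∧
      imPrimitive c p₁ ξ < imPrimitive c q ξ ∧ imPrimitive c p₂ ξ < imPrimitive c q ξ := by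
  push Not at h
  obtain ⟨⟨s, hs⟩, t₁, ht₁⟩ := h
  have hper : Function.Periodic (fun t => imSymbol c t ξ) (2 * π) := fun t =>
    congrArg Complex.im (periodic_tubeSymbol c ξ t)
  obtain ⟨t₂, ht₂, hb₂⟩ : ∃ t₂ ∈ Ico t₁ (t₁ + 2 * π), imSymbol c t₂ ξ < 0 := by
    refine ⟨toIcoMod Real.two_pi_pos t₁ s, toIcoMod_mem_Ico _ _ _, ?_⟩
    have : imSymbol c (toIcoMod Real.two_pi_pos t₁ s) ξ = imSymbol c s ξ := by
      rw [toIcoMod]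
      exact hper.sub_zsmul_eq _
    rwa [this]
  have hgap : 0 < (t₁ + 2 * π - t₂) / 2 := by linarith [ht₂.2]
  obtain ⟨p₁, hp₁, hB₁⟩ := exists_lt_of_hasDerivAt_pos (hasDerivAt_imPrimitive c ξ t₁) ht₁ hgap
  obtain ⟨p₂, hp₂, hB₂⟩ := exists_lt_of_hasDerivAt_neg (hasDerivAt_imPrimitive c ξ t₂) hb₂ hgap
  obtain ⟨q, hq, hmax⟩ := (isCompact_Icc (a := t₁) (b := t₂)).exists_isMaxOn
    ⟨t₁, left_mem_Icc.2 ht₂.1⟩ (continuous_imPrimitive c ξ).continuousOn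
  have h1 : imPrimitive c t₁ ξ ≤ imPrimitive c q ξ := hmax (left_mem_Icc.2 ht₂.1)
  have h2 : imPrimitive c t₂ ξ ≤ imPrimitive c q ξ := hmax (right_mem_Icc.2 ht₂.1)
  exact ⟨p₁, q, p₂, hp₁.2.trans_le hq.1, hq.2.trans_lt hp₂.1, by linarith [hp₁.1, hp₂.2],
    hB₁.trans_le h1, hB₂.trans_le h2⟩

/-- With `K = B(q)` the waves have modulus `1` at the peak. Only nonresonant multiples of `ξ` are
used, so that uniqueness excludes any other solution. -/
theorem GloballySolvable.sign_condition (hP : GloballySolvable (tubeOperator c)) (hm : 1 ≤ m)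
    (hord : HasOrder c (m : ℝ)) (htube : IsTubeType c) (hhom : IsPosHomogeneous c m)
    (hξ0 : ξ ≠ 0) (hξ : ξ ∉ resonantSet c) :
    (∀ t : ℝ, 0 ≤ imSymbol c t ξ) ∨ (∀ t : ℝ, imSymbol c t ξ ≤ 0) := by
  by_contra hcon
  obtain ⟨p₁, q, p₂, hp₁, hp₂, hp, hB₁, hB₂⟩ := exists_peak_of_sign_change hcon
  let S := {n : ℕ | 1 ≤ n ∧ (n : ℤ) • ξ ∉ resonantSet c}
  have hS : Infinite S := (hhom.infinite_not_mem_resonantSet hξ).to_subtype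
  have hinj := injective_zsmul_of_injective (ν := fun n : S => (n : ℕ)) Subtype.val_injective hξ0
  obtain ⟨U, hU, hUq, -, hR⟩ := htube.exists_concentrated (ν := fun n : S => (n : ℕ)) hm hord hhom
    (fun n => n.2.1) hp₁ hp₂ hp hB₁ hB₂ le_rfl
  obtain ⟨V, hV, hVU, hVR⟩ := hP.exists_rapidlyDecreasing htube hinj hU hR
  refine hVR.false_of_le hinj one_pos fun n => ?_
  rw [htube.eq_of_tubeOperator_eq n.2.2 (hU n) (hV n) (hVU n)]
  refine le_trans (le_of_eq ?_) (norm_slice_le (U n) q)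
  rw [hUq, sub_self, mul_zero, Real.exp_zero]

/-- Solutions may now differ from the waves by multiples of `e^{-iC}`. Since `U n` vanishes at `q'`,
such a multiple is bounded there by `V n`, and comparing `q` with `q'` shows that it cannot cancel
the wave at `q` while `V n` stays small. -/
theorem GloballySolvable.isPreconnected_sublevelSet (hP : GloballySolvable (tubeOperator c))
    (hm : 1 ≤ m) (hord : HasOrder c (m : ℝ)) (htube : IsTubeType c) (hhom : IsPosHomogeneous c m)
    (hξ0 : ξ ≠ 0) (hξ : ξ ∈ resonantSet c) (lam : ℝ) : IsPreconnected (sublevelSet c ξ lam) := by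
  by_contra hcon
  obtain ⟨p₁, q, p₂, q', hp₁, hp₂, hq', hq'', hB₁, hB₂, hBq, hBq'⟩ :=
    exists_alternating_of_not_isPreconnected Real.two_pi_pos (periodic_imPrimitive hξ) hcon
  have hinj := injective_zsmul_of_injective (ν := fun n : ℕ => n + 1) (add_left_injective 1) hξ0
  obtain ⟨U, hU, hUq, hUq', hR⟩ := htube.exists_concentrated (ν := fun n : ℕ => n + 1) hm hord hhom
    (fun n => n.succ_pos) hp₁ hp₂ (hq'.trans hq'') hB₁ hB₂ hBq
  obtain ⟨V, hV, hVU, hVR⟩ := hP.exists_rapidlyDecreasing htube hinj hU hR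
  refine hVR.false_of_le hinj one_half_pos fun n => ?_
  set P := derivSeminorm (N + 1) 0 (V n) with hPdef
  set l : ℝ := ((n + 1 : ℕ) : ℝ) ^ m with hl
  have hl0 : 0 ≤ l := by positivity
  have hW := (hV n).sub (hU n)
  have hexp := congrArg norm (htube.exp_mul_slice_eq hW (by rw [map_sub, hVU, sub_self]) q' q)
  have him (t : ℝ) : (symbolPrimitive c (((n + 1 : ℕ) : ℤ) • ξ) t).im = l * imPrimitive c t ξ := by
    rw [hhom.symbolPrimitive_nsmul ξ n.succ_pos, ← im_symbolPrimitive, hl,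
      ← Complex.im_ofReal_mul]
    push_cast
    rfl
  rw [norm_mul, norm_mul, norm_exp_I_mul, norm_exp_I_mul, him, him] at hexp
  have hWq' : ‖slice (V n - U n) q'‖ ≤ P := by
    have : slice (V n - U n) q' = slice (V n) q' := by
      change slice (V n) q' - slice (U n) q' = _
      rw [hUq' n q' ⟨hq', hq''⟩, sub_zero]
    rw [this]
    exact norm_slice_le _ _
  have hUV : ‖slice (U n) q‖ ≤ P + ‖slice (V n - U n) q‖ := by
    have : slice (U n) q = slice (V n) q - slice (V n - U n) q := by
      change _ = slice (V n) q - (slice (V n) q - slice (U n) q)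
      ring
    rw [this]
    exact (norm_sub_le _ _).trans (add_le_add_left (norm_slice_le _ _) _)
  have hP0 : 0 ≤ P := apply_nonneg _ _
  rw [hUq] at hUV
  have e1 : Real.exp (-(l * imPrimitive c q ξ)) * Real.exp (l * (imPrimitive c q ξ - lam)) =
      Real.exp (-(l * lam)) := by
    rw [← Real.exp_add]
    congr 1
    ring
  have e2 : Real.exp (-(l * imPrimitive c q ξ)) ≤ Real.exp (-(l * lam)) :=
    Real.exp_le_exp.2 (neg_le_neg (mul_le_mul_of_nonneg_left hBq hl0))
  have e3 : Real.exp (-(l * imPrimitive c q' ξ)) ≤ Real.exp (-(l * lam)) :=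
    Real.exp_le_exp.2 (neg_le_neg (mul_le_mul_of_nonneg_left hBq' hl0))
  -- Weighting by `e^{-l B(q)}` moves the homogeneous part to `q'`. As `B ≥ lam` at both points,
  -- this gives `e^{-l lam} ≤ 2 e^{-l lam} P`, that is `P ≥ 1 / 2`.
  have h1 := mul_le_mul_of_nonneg_left hUV (Real.exp_pos (-(l * imPrimitive c q ξ))).le
  rw [e1, mul_add, hexp] at h1
  have h2 := mul_le_mul e2 le_rfl hP0 (Real.exp_pos _).le
  have h3 := mul_le_mul e3 hWq' (norm_nonneg _) (Real.exp_pos _).le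
  have h4 : Real.exp (-(l * lam)) * 1 ≤ Real.exp (-(l * lam)) * (2 * P) := by linarith
  linarith [le_of_mul_le_mul_left h4 (Real.exp_pos _)]

end Concentration

theorem mainTheorem2 {N m : ℕ} (hm : 1 ≤ m)
    (c : SmoothTorus (N + 1) →L[ℂ] SmoothTorus (N + 1))
    (hord : HasOrder c (m : ℝ)) (htube : IsTubeType c) (hhom : IsPosHomogeneous c m) :
    GloballySolvable (tubeOperator c) ↔
      DiophantineCondition c ∧
      (∀ ξ : Fin N → ℤ, ξ ≠ 0 → ξ ∉ resonantSet c →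
        (∀ t : ℝ, 0 ≤ imSymbol c t ξ) ∨ (∀ t : ℝ, imSymbol c t ξ ≤ 0)) ∧
      (∀ ξ : Fin N → ℤ, ξ ≠ 0 → ξ ∈ resonantSet c →
        ∀ lam : ℝ, IsPreconnected (sublevelSet c ξ lam)) :=
  ⟨fun hP => ⟨hP.diophantineCondition hord htube,
    fun _ hξ0 hξ => hP.sign_condition hm hord htube hhom hξ0 hξ,
    fun _ hξ0 hξ lam => hP.isPreconnected_sublevelSet hm hord htube hhom hξ0 hξ lam⟩,
    fun ⟨h1, h2, h3⟩ => globallySolvable_of_conditions hm hord htube hhom h1 h2 h3⟩
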